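/- Let $d\ge 1$ and let $(W,X,Y(0),Y(1))$ be a random vector with $W\in\{0,1\}$, $X\in\mathbb R^d$ and integrable real $Y(0),Y(1)$. Let $\mathcal X$ be the support of $X$, let $g_w(x)=\mathbb E[Y(w)\mid X=x]$ for $w\in\{0,1\}$, write $|\cdot|$ for Lebesgue measure, $B(x,r)$ for closed Euclidean balls and $\delta(x)$ for the distance from $x$ to $\mathcal X^c$. Assume: (T1) $\mathcal X$ is compact. (T2) There is $c>0$ such that $|B(x,r)\cap\mathcal X|\ge c\,|B(x,r)|$ for all $x\in\mathcal X$ and $0\le r\le\operatorname{diam}(\mathcal X)$. (T3) $X$ has a Lebesgue density $f$, and there are $\underline f,\bar f>0$ with $\underline f\le f(x)\le\bar f$ for almost all $x\in\mathcal X$. (T4) $W$ is independent of $(Y(0),Y(1))$ conditionally on $X$. (T5) $\eta>0$ is such that $\eta<\mathbb P(W=1\mid X=x)<1-\eta$ for almost all $x\in\mathcal X$. (T6) $g_0$ and $g_1$ are, on $\mathcal X$, restrictions of twice continuously differentiable functions defined on an open convex neighbourhood of $\mathcal X$. (T7) The laws of $X$ given $W=0$ and given $W=1$ have Lebesgue densities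 $f_0$ and $f_1$, which are Lipschitz continuous on $\mathcal X$. (T8) $\displaystyle\sup_{L>0,\;w\in\{0,1\}}L^{1/d}\int_{\mathcal X}\exp\bigl(-L\,\delta(x)^d\bigr)f_w(x)\,dx<\infty$. Then there is a constant $C>0$, depending only on $d,\mathcal X,\eta,g_0,g_1,f_0,f_1$, such that the following holds for all integers $1\le k\le N$. Let $(W_i,X_i,Y_i(0),Y_i(1))$, $1\le i\le N$, be i.i.d. copies of $(W,X,Y(0),Y(1))$, let $\hat i_{\ell,w}(x)$ be the index of the $\ell$-th nearest neighbour of $x$ among the $X_j$ with $W_j=w$ (ties broken by the index), and let $$B=\frac1N\sum_{i=1}^N(2W_i-1)\Bigl(g_{1-W_i}(X_i)-\frac1k\sum_{\ell=1}^k g_{1-W_i}\bigl(X_{\hat i_{\ell,1-W_i}(X_i)}\bigr)\Bigr)$$ be the conditional bias of the Abadie–Imbens matching estimator of the average treatment effect with $k$ matches, where the terms of the inner sum for which no $\ell$-th nearest neighbour exists are omitted (the factor $1/k$ is kept). Then $B$ is square integrable and $$\mathbb E[B^2]\le C\left(\frac kN\right)^{\min(3,\,4/d)}.$$ -/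

import Mathlib

open MeasureTheory ProbabilityTheory

/-! Nearest-neighbour matching for average treatment effects. Covariates live in
`EuclideanSpace ℝ (Fin d)` (Euclidean norm, Lebesgue measure `volume`), treatments in `Fin 2`. -/

noncomputable section

/-- The units that received the treatment `a`. -/
def treatmentGroup {N : ℕ} (w : Fin N → Fin 2) (a : Fin 2) : Finset (Fin N) :=
  {i | w i = a}

/-- The position (starting from `1`) of the unit `j` when the units of the group `s` are listed by
increasing distance of their covariate to `z`; ties are broken by the index. -/
def neighbourRank {d N : ℕ} (x : Fin N → EuclideanSpace ℝ (Fin d)) (s : Finset (Fin N))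
    (z : EuclideanSpace ℝ (Fin d)) (j : Fin N) : ℕ :=
  Finset.card {i ∈ s | dist (x i) z < dist (x j) z ∨ (dist (x i) z = dist (x j) z ∧ i ≤ j)}

/-- The value of `g` at the `ℓ`-th nearest neighbour of `z` within the group `s`. For
`1 ≤ ℓ ≤ #s` exactly one unit has rank `ℓ` and the sum has one term; if the group has fewer than
`ℓ` units, there is no such neighbour and the sum is empty. -/
def neighbourValue {d N : ℕ} (g : EuclideanSpace ℝ (Fin d) → ℝ)
    (x : Fin N → EuclideanSpace ℝ (Fin d)) (s : Finset (Fin N))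
    (z : EuclideanSpace ℝ (Fin d)) (ℓ : ℕ) : ℝ :=
  ∑ j ∈ s with neighbourRank x s z j = ℓ, g (x j)

/-- The conditional bias of the matching estimator with `k` matches, for the regression functions
`g 0`, `g 1`, the treatments `w` and the covariates `x`:
`N⁻¹ ∑ᵢ (2 wᵢ - 1) (g_{1-wᵢ}(xᵢ) - k⁻¹ ∑_{ℓ ≤ k} g_{1-wᵢ}(ℓ-th neighbour of xᵢ in group 1-wᵢ))`. -/
def conditionalBias {d N : ℕ} (g : Fin 2 → EuclideanSpace ℝ (Fin d) → ℝ) (k : ℕ)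
    (w : Fin N → Fin 2) (x : Fin N → EuclideanSpace ℝ (Fin d)) : ℝ :=
  (1 / (N : ℝ)) * ∑ i : Fin N, (2 * ((w i : ℕ) : ℝ) - 1) *
    (g (1 - w i) (x i) -
      (1 / (k : ℝ)) * ∑ ℓ ∈ Finset.Icc 1 k,
        neighbourValue (g (1 - w i)) x (treatmentGroup w (1 - w i)) (x i) ℓ)

/-- `ν` has the (nonnegative, measurable) density `p` with respect to the Lebesgue measure. -/
def HasLebesgueDensity {d : ℕ} (ν : Measure (EuclideanSpace ℝ (Fin d)))
    (p : EuclideanSpace ℝ (Fin d) → ℝ) : Prop :=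
  Measurable p ∧ (∀ x, 0 ≤ p x) ∧ ν = volume.withDensity (fun x => ENNReal.ofReal (p x))

/-- `U` and `V` are conditionally independent given the sigma-algebra `𝒢`:
`P(U ∈ s, V ∈ t | 𝒢) = P(U ∈ s | 𝒢) P(V ∈ t | 𝒢)` almost surely for all measurable `s`, `t`. -/
def CondIndepGiven {Ω α β : Type*} [MeasurableSpace α] [MeasurableSpace β]
    (𝒢 : MeasurableSpace Ω) [MeasurableSpace Ω] (P : Measure Ω) (U : Ω → α) (V : Ω → β) : Prop :=
  ∀ (s : Set α) (t : Set β), MeasurableSet s → MeasurableSet t →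
    P⟦U ⁻¹' s ∩ V ⁻¹' t|𝒢⟧ =ᵐ[P] fun ω => (P⟦U ⁻¹' s|𝒢⟧) ω * (P⟦V ⁻¹' t|𝒢⟧) ω

/-- The assumptions on the law of the generic vector `(W, X, Y(0), Y(1))` under `P`, with
covariate support `𝒳`, overlap constant `η`, regression functions `g w` and densities `f w` of the
covariate given `W = w`. -/
structure MatchingAssumptions {d : ℕ} (𝒳 : Set (EuclideanSpace ℝ (Fin d))) (η : ℝ)
    (g f : Fin 2 → EuclideanSpace ℝ (Fin d) → ℝ) {Ω : Type*} [MeasurableSpace Ω]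
    (P : Measure Ω) (W : Ω → Fin 2) (X : Ω → EuclideanSpace ℝ (Fin d))
    (Y : Fin 2 → Ω → ℝ) : Prop where
  measurable_treatment : Measurable W
  measurable_covariate : Measurable X
  measurable_outcome : ∀ w, Measurable (Y w)
  integrable_outcome : ∀ w, Integrable (Y w) P
  /-- `g w` is the regression function: `E[Y(w) | X] = g w (X)`. -/
  regression : ∀ w, P[Y w|MeasurableSpace.comap X inferInstance] =ᵐ[P] fun ω => g w (X ω)
  /-- `𝒳` is the support of `X`, and it is compact. -/
  support_eq : (P.map X).support = 𝒳
  compact_support : IsCompact 𝒳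
  /-- Every ball centred in `𝒳` has a fixed proportion of its volume in `𝒳`. -/
  ball_volume : ∃ c : ℝ, 0 < c ∧ ∀ x ∈ 𝒳, ∀ r : ℝ, 0 ≤ r → r ≤ Metric.diam 𝒳 →
    ENNReal.ofReal c * volume (Metric.closedBall x r) ≤ volume (Metric.closedBall x r ∩ 𝒳)
  /-- `X` has a density that is bounded and bounded away from zero on `𝒳`. -/
  density_bounds : ∃ p : EuclideanSpace ℝ (Fin d) → ℝ, HasLebesgueDensity (P.map X) p ∧
    ∃ lo hi : ℝ, 0 < lo ∧ 0 < hi ∧ ∀ᵐ x ∂(volume.restrict 𝒳), lo ≤ p x ∧ p x ≤ hi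
  /-- Unconfoundedness. -/
  unconfounded : CondIndepGiven (MeasurableSpace.comap X inferInstance) P W (fun ω w => Y w ω)
  /-- Overlap. -/
  overlap_pos : 0 < η
  overlap : ∀ᵐ ω ∂P, η < (P⟦W ⁻¹' {1}|MeasurableSpace.comap X inferInstance⟧) ω ∧
    (P⟦W ⁻¹' {1}|MeasurableSpace.comap X inferInstance⟧) ω < 1 - η
  /-- Both regression functions extend to `C²` functions on an open convex neighbourhood. -/
  regression_smooth : ∀ w, ∃ (U : Set (EuclideanSpace ℝ (Fin d)))
    (G : EuclideanSpace ℝ (Fin d) → ℝ), IsOpen U ∧ Convex ℝ U ∧ 𝒳 ⊆ U ∧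
      ContDiffOn ℝ 2 G U ∧ Set.EqOn (g w) G 𝒳
  /-- The covariate given `W = w` has density `f w`, which is Lipschitz on `𝒳`. -/
  group_density : ∀ w, HasLebesgueDensity ((ProbabilityTheory.cond P (W ⁻¹' {w})).map X) (f w)
  group_density_lipschitz : ∀ w, ∃ K, LipschitzOnWith K (f w) 𝒳
  /-- The boundary condition, for both groups. -/
  boundary : ∃ M : ℝ, ∀ L : ℝ, 0 < L → ∀ w,
    L ^ (1 / (d : ℝ)) * ∫ x in 𝒳, Real.exp (-L * Metric.infDist x 𝒳ᶜ ^ d) * f w x ≤ M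

end

/-! ### Ranks of nearest neighbours within a group -/

section Ranks

variable {d N : ℕ}

/-! Put ε = (k/N)^(1/d), the order of the distance from a unit to its matches. Once both groups have
at least k units, the bias equals (Nk)⁻¹ ∑ T(i,l), where T(i,l) is ±(g(X_i) − g(X_l)) if l is a
match of i and 0 otherwise. Its square is a sum over quadruples (i,l,j,q), and E[T(i,l) T(j,q)] is
bounded according to how the indices coincide (`exists_abs_integral_matchTerm_mul_le`).

All sizes come from one tail bound. If l is a match of i, then fewer than k of the remaining units
of the opposite group are closer to X_i, and by a Chernoff bound this is exponentially unlikely in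
(|X_i − X_l|/ε)^d. Given the positions of the four units, the product is therefore dominated by
kernels |x − y| exp(−θ(|x − y|/ε)^d), whose integral in y has order ε^(d+1). Different pairs sharing
a unit number at most 4N³ and contribute N³(Nk)⁻² ε^(2d+2) = ε²/N ≤ ε^(d+2). Equal or swapped pairs
number 2N² and contribute k⁻² ε^(d+2).

For four distinct units absolute values lose too much. Suppose both match distances are less than
half of |X_i − X_j|. Reflecting X_l in X_i then changes neither of the two match relations
(`separatedMatches_reflection`), so the first-order Taylor term, which is odd, integrates to zero.
What remains has order |x − y|², or |x − y| when y is at least as far from x as the complement of 𝒳;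
thanks to the boundary condition both parts have mean of order ε^(d+2)
(`exists_lintegral_evenMass_le`). The expectation is thus of order ε^(2d+4), which sums to ε⁴.
Without separation X_j is confined to distance of order ε from X_i; this gains a factor ε^d and sums
to ε^(d+2).

With t = k/N the total is t^(4/d) + t^(1+2/d). Since 1 + 2/d is 3 for d = 1 and at least 4/d for d ≥
2, the exponent is min(3, 4/d). Samples in which a group has fewer than k units have probability of
order at most ε⁴, and there the bias is bounded. `RegularDesign` collects the regularity with
explicit constants, which keeps the final constant independent of the law. -/

theorem one_le_neighbourRank (x : Fin N → EuclideanSpace ℝ (Fin d)) {s : Finset (Fin N)}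
    (z : EuclideanSpace ℝ (Fin d)) {j : Fin N} (hj : j ∈ s) : 1 ≤ neighbourRank x s z j :=
  Finset.card_pos.mpr ⟨j, by simp [hj]⟩

theorem neighbourRank_le_card (x : Fin N → EuclideanSpace ℝ (Fin d)) (s : Finset (Fin N))
    (z : EuclideanSpace ℝ (Fin d)) (j : Fin N) : neighbourRank x s z j ≤ s.card :=
  Finset.card_filter_le _ _

/-- The rank is the size of an initial segment of the group in the lexicographic order by distance
and index, and an earlier unit has a strictly smaller initial segment. -/
theorem neighbourRank_injOn (x : Fin N → EuclideanSpace ℝ (Fin d)) (s : Finset (Fin N))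
    (z : EuclideanSpace ℝ (Fin d)) : Set.InjOn (neighbourRank x s z) s := by
  have key : ∀ i ∈ s, ∀ j ∈ s,
      (dist (x i) z < dist (x j) z ∨ (dist (x i) z = dist (x j) z ∧ i < j)) →
      neighbourRank x s z i < neighbourRank x s z j := by
    intro i hi j hj hij
    refine Finset.card_lt_card (Finset.ssubset_iff_of_subset ?_ |>.mpr ⟨j, ?_, ?_⟩)
    · intro p
      simp only [Finset.mem_filter]
      rintro ⟨hp, h⟩
      refine ⟨hp, ?_⟩
      rcases h with h | ⟨h, h'⟩ <;> rcases hij with h2 | ⟨h2, h2'⟩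
      · exact Or.inl (h.trans h2)
      · exact Or.inl (h2 ▸ h)
      · exact Or.inl (h ▸ h2)
      · exact Or.inr ⟨h.trans h2, h'.trans h2'.le⟩
    · simp [hj]
    · simp only [Finset.mem_filter, not_and, not_or]
      intro _
      rcases hij with h2 | ⟨h2, h2'⟩
      · exact ⟨h2.not_gt, fun h => absurd h h2.ne'⟩
      · exact ⟨by rw [h2]; exact lt_irrefl _, fun _ => h2'.not_ge⟩
  intro i hi j hj hij
  by_contra hne
  rcases lt_trichotomy (dist (x i) z) (dist (x j) z) with h | h | h
  · exact (key i hi j hj (Or.inl h)).ne hij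
  · rcases lt_or_gt_of_ne hne with h' | h'
    · exact (key i hi j hj (Or.inr ⟨h, h'⟩)).ne hij
    · exact (key j hj i hi (Or.inr ⟨h.symm, h'⟩)).ne hij.symm
  · exact (key j hj i hi (Or.inl h)).ne hij.symm

theorem card_neighbourRank_le (x : Fin N → EuclideanSpace ℝ (Fin d)) (s : Finset (Fin N))
    (z : EuclideanSpace ℝ (Fin d)) (k : ℕ) :
    ({j ∈ s | neighbourRank x s z j ≤ k} : Finset (Fin N)).card ≤ k := by
  have h := Finset.card_le_card_of_injOn (s := {j ∈ s | neighbourRank x s z j ≤ k})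
    (t := Finset.Icc 1 k) (neighbourRank x s z) ?_ ?_
  · simpa using h
  · intro j hj
    simp only [Finset.coe_filter, Set.mem_ofPred_eq] at hj
    simpa using ⟨one_le_neighbourRank x z hj.1, hj.2⟩
  · exact (neighbourRank_injOn x s z).mono (by intro j hj; simp at hj; exact hj.1)

/-- Injectivity with values in `Icc 1 s.card` forces the ranks to fill this interval, so every rank
up to `k` is attained. -/
theorem card_neighbourRank_eq (x : Fin N → EuclideanSpace ℝ (Fin d)) (s : Finset (Fin N))
    (z : EuclideanSpace ℝ (Fin d)) {k : ℕ} (hk : k ≤ s.card) :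
    ({j ∈ s | neighbourRank x s z j ≤ k} : Finset (Fin N)).card = k := by
  refine le_antisymm (card_neighbourRank_le x s z k) ?_
  have himg : s.image (neighbourRank x s z) = Finset.Icc 1 s.card := by
    apply Finset.eq_of_subset_of_card_le
    · intro r hr
      obtain ⟨j, hj, rfl⟩ := Finset.mem_image.mp hr
      exact Finset.mem_Icc.mpr ⟨one_le_neighbourRank x z hj, neighbourRank_le_card x s z j⟩
    · rw [Finset.card_image_of_injOn (neighbourRank_injOn x s z)]; simp
  have h2 : Finset.Icc 1 k ⊆
      ({j ∈ s | neighbourRank x s z j ≤ k} : Finset (Fin N)).image (neighbourRank x s z) := by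
    intro r hr
    have hr' := Finset.mem_Icc.mp hr
    have : r ∈ s.image (neighbourRank x s z) := by
      rw [himg]; exact Finset.mem_Icc.mpr ⟨hr'.1, hr'.2.trans hk⟩
    obtain ⟨j, hj, rfl⟩ := Finset.mem_image.mp this
    exact Finset.mem_image.mpr ⟨j, by simp [hj, hr'.2], rfl⟩
  have h3 := (Finset.card_le_card h2).trans Finset.card_image_le
  simpa using h3

theorem sum_neighbourValue (g : EuclideanSpace ℝ (Fin d) → ℝ)
    (x : Fin N → EuclideanSpace ℝ (Fin d)) (s : Finset (Fin N))
    (z : EuclideanSpace ℝ (Fin d)) (k : ℕ) :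
    ∑ ℓ ∈ Finset.Icc 1 k, neighbourValue g x s z ℓ =
      ∑ j ∈ s with neighbourRank x s z j ≤ k, g (x j) := by
  unfold neighbourValue
  rw [← Finset.sum_fiberwise_of_maps_to (s := {j ∈ s | neighbourRank x s z j ≤ k})
    (t := Finset.Icc 1 k) (g := neighbourRank x s z)]
  · refine Finset.sum_congr rfl fun ℓ hℓ => Finset.sum_congr ?_ fun _ _ => rfl
    ext j
    simp only [Finset.mem_filter]
    constructor
    · rintro ⟨h, rfl⟩; exact ⟨⟨h, (Finset.mem_Icc.mp hℓ).2⟩, rfl⟩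
    · rintro ⟨⟨h, _⟩, h'⟩; exact ⟨h, h'⟩
  · intro j hj
    simp only [Finset.mem_filter] at hj
    exact Finset.mem_Icc.mpr ⟨one_le_neighbourRank x z hj.1, hj.2⟩

end Ranks

/-! ### The bias as a sum over pairs of matched units -/

section Pairs

variable {d N : ℕ}

/-- Unit `l` is one of the `k` matches of unit `i` in the sample `z` of (treatment, covariate)
pairs. -/
def IsNeighbour (k : ℕ) (z : Fin N → Fin 2 × EuclideanSpace ℝ (Fin d)) (i l : Fin N) : Prop :=
  (z l).1 = 1 - (z i).1 ∧
    neighbourRank (fun p => (z p).2) (treatmentGroup (fun p => (z p).1) (1 - (z i).1)) (z i).2 l ≤ k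

/-- The sign of a treatment: `1` for treated units and `-1` for controls. -/
noncomputable def treatmentSign (a : Fin 2) : ℝ := 2 * ((a : ℕ) : ℝ) - 1

theorem abs_treatmentSign (a : Fin 2) : |treatmentSign a| = 1 := by
  fin_cases a <;> norm_num [treatmentSign]

open Classical in
/-- The contribution of the match `l` of `i` to the conditional bias. -/
noncomputable def matchTerm (g : Fin 2 → EuclideanSpace ℝ (Fin d) → ℝ) (k : ℕ) (i l : Fin N)
    (z : Fin N → Fin 2 × EuclideanSpace ℝ (Fin d)) : ℝ :=
  if IsNeighbour k z i l then
    treatmentSign (z i).1 * (g (1 - (z i).1) (z i).2 - g (1 - (z i).1) (z l).2) else 0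

/-- The conditional bias as a function of the (treatment, covariate) pairs. -/
noncomputable def pairBias (g : Fin 2 → EuclideanSpace ℝ (Fin d) → ℝ) (k : ℕ)
    (z : Fin N → Fin 2 × EuclideanSpace ℝ (Fin d)) : ℝ :=
  conditionalBias g k (fun i => (z i).1) (fun i => (z i).2)

open Classical in
theorem pairBias_eq_sum (g : Fin 2 → EuclideanSpace ℝ (Fin d) → ℝ) (k : ℕ)
    (z : Fin N → Fin 2 × EuclideanSpace ℝ (Fin d)) :
    pairBias g k z = (1 / (N : ℝ)) * ∑ i, treatmentSign (z i).1 *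
      (g (1 - (z i).1) (z i).2 -
        (1 / (k : ℝ)) * ∑ l with IsNeighbour k z i l, g (1 - (z i).1) (z l).2) := by
  unfold pairBias conditionalBias
  congr 1
  refine Finset.sum_congr rfl fun i _ => ?_
  rw [sum_neighbourValue]
  unfold treatmentSign
  congr 4
  ext l
  simp [IsNeighbour, treatmentGroup]

open Classical in
theorem card_isNeighbour_le (k : ℕ) (z : Fin N → Fin 2 × EuclideanSpace ℝ (Fin d)) (i : Fin N) :
    ({l | IsNeighbour k z i l} : Finset (Fin N)).card ≤ k := by
  refine le_trans (le_of_eq (congrArg _ ?_)) (card_neighbourRank_le (fun p => (z p).2)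
    (treatmentGroup (fun p => (z p).1) (1 - (z i).1)) (z i).2 k)
  ext l
  simp [IsNeighbour, treatmentGroup]

open Classical in
theorem card_isNeighbour_eq {k : ℕ} (z : Fin N → Fin 2 × EuclideanSpace ℝ (Fin d)) (i : Fin N)
    (hk : k ≤ (treatmentGroup (fun p => (z p).1) (1 - (z i).1)).card) :
    ({l | IsNeighbour k z i l} : Finset (Fin N)).card = k := by
  refine Eq.trans (congrArg _ ?_) (card_neighbourRank_eq (fun p => (z p).2)
    (treatmentGroup (fun p => (z p).1) (1 - (z i).1)) (z i).2 hk)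
  ext l
  simp [IsNeighbour, treatmentGroup]

/-- With at least `k` units in either group, every unit has exactly `k` matches, so its own
regression value is the average of `k` copies and can be moved inside the sum over matches. -/
theorem pairBias_eq_sum_matchTerm (g : Fin 2 → EuclideanSpace ℝ (Fin d) → ℝ) {k : ℕ} (hk : 1 ≤ k)
    (z : Fin N → Fin 2 × EuclideanSpace ℝ (Fin d))
    (hz : ∀ a, k ≤ (treatmentGroup (fun p => (z p).1) a).card) :
    pairBias g k z = (1 / ((N : ℝ) * k)) * ∑ i, ∑ l, matchTerm g k i l z := by
  classical
  have hk0 : (k : ℝ) ≠ 0 := by positivity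
  rw [pairBias_eq_sum, one_div_mul_eq_div, one_div_mul_eq_div, mul_comm (N : ℝ), ← div_div]
  refine congrArg (· / (N : ℝ)) ?_
  rw [Finset.sum_div]
  refine Finset.sum_congr rfl fun i _ => ?_
  have hc := card_isNeighbour_eq z i (hz _)
  simp only [matchTerm]
  rw [← Finset.sum_filter, ← Finset.mul_sum, Finset.sum_sub_distrib, Finset.sum_const, hc]
  rw [nsmul_eq_mul]
  field_simp

/-- A unit never has more than `k` matches, so this bound also covers samples in which a group is
too small. -/
theorem abs_pairBias_le (g : Fin 2 → EuclideanSpace ℝ (Fin d) → ℝ) {k : ℕ} (hk : 1 ≤ k)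
    {Γ : ℝ} (hΓ : 0 ≤ Γ) (hg : ∀ a x, |g a x| ≤ Γ)
    (z : Fin N → Fin 2 × EuclideanSpace ℝ (Fin d)) : |pairBias g k z| ≤ 2 * Γ := by
  classical
  rw [pairBias_eq_sum, abs_mul]
  have hk0 : (0 : ℝ) < k := by positivity
  have hterm : ∀ i ∈ (Finset.univ : Finset (Fin N)), |treatmentSign (z i).1 *
      (g (1 - (z i).1) (z i).2 -
        (1 / (k : ℝ)) * ∑ l with IsNeighbour k z i l, g (1 - (z i).1) (z l).2)| ≤ 2 * Γ := by
    intro i _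
    rw [abs_mul, abs_treatmentSign, one_mul]
    have h1 : |∑ l with IsNeighbour k z i l, g (1 - (z i).1) (z l).2| ≤ k * Γ := by
      refine (Finset.abs_sum_le_sum_abs _ _).trans
        ((Finset.sum_le_card_nsmul _ _ Γ fun l _ => hg _ _).trans ?_)
      rw [nsmul_eq_mul]
      gcongr
      exact card_isNeighbour_le k z i
    have h2 : |(1 / (k : ℝ)) * ∑ l with IsNeighbour k z i l, g (1 - (z i).1) (z l).2| ≤ Γ := by
      rw [abs_mul, abs_of_nonneg (by positivity), one_div_mul_eq_div, div_le_iff₀ hk0]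
      linarith
    have h3 := abs_sub (g (1 - (z i).1) (z i).2)
      ((1 / (k : ℝ)) * ∑ l with IsNeighbour k z i l, g (1 - (z i).1) (z l).2)
    linarith [hg (1 - (z i).1) (z i).2]
  have hsum := (Finset.abs_sum_le_sum_abs (fun i => treatmentSign (z i).1 *
      (g (1 - (z i).1) (z i).2 - (1 / (k : ℝ)) *
        ∑ l with IsNeighbour k z i l, g (1 - (z i).1) (z l).2)) Finset.univ).trans
    (Finset.sum_le_card_nsmul _ _ _ hterm)
  rw [Finset.card_univ, Fintype.card_fin, nsmul_eq_mul] at hsum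
  rcases Nat.eq_zero_or_pos N with rfl | hN
  · simp; positivity
  · have hN0 : (0 : ℝ) < N := by positivity
    rw [abs_of_nonneg (by positivity), one_div_mul_eq_div, div_le_iff₀ hN0]
    linarith

end Pairs

/-! ### Resampling coordinates of a product measure; a Chernoff bound -/

section ProductMeasures

variable {ι S : Type*} [Fintype ι] [DecidableEq ι] [MeasurableSpace S] (μ : Measure S)
  [IsProbabilityMeasure μ]

/-- The decoupling device: the units in `Q` are kept and all others are replaced by an independent
copy, without changing the law of the sample. -/
theorem measurePreserving_piecewise (Q : Finset ι) :
    MeasurePreserving (fun p : (ι → S) × (ι → S) => Q.piecewise p.1 p.2)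
      ((Measure.pi fun _ : ι => μ).prod (Measure.pi fun _ : ι => μ)) (Measure.pi fun _ : ι => μ) := by
  have hmeas : Measurable (fun p : (ι → S) × (ι → S) => Q.piecewise p.1 p.2) := by
    refine measurable_pi_lambda _ fun i => ?_
    by_cases hi : i ∈ Q
    · simp only [Finset.piecewise_eq_of_mem _ _ _ hi]; fun_prop
    · simp only [Finset.piecewise_eq_of_notMem _ _ _ hi]; fun_prop
  refine ⟨hmeas, (Measure.pi_eq fun s hs => ?_).symm⟩
  rw [Measure.map_apply hmeas (MeasurableSet.univ_pi hs)]
  have : (fun p : (ι → S) × (ι → S) => Q.piecewise p.1 p.2) ⁻¹' Set.univ.pi s =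
      (Set.univ.pi fun i => if i ∈ Q then s i else Set.univ) ×ˢ
        (Set.univ.pi fun i => if i ∈ Q then Set.univ else s i) := by
    ext ⟨z, z'⟩
    simp only [Set.mem_preimage, Set.mem_pi, Set.mem_univ, true_implies, Set.mem_prod]
    rw [← forall_and]
    refine forall_congr' fun i => ?_
    by_cases hi : i ∈ Q <;> simp [hi]
  rw [this, Measure.prod_prod, Measure.pi_pi, Measure.pi_pi, ← Finset.prod_mul_distrib]
  refine Finset.prod_congr rfl fun i _ => ?_
  by_cases hi : i ∈ Q <;> simp [hi]

theorem measurePreserving_update (l : ι) :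
    MeasurePreserving (fun p : (ι → S) × S => Function.update p.1 l p.2)
      ((Measure.pi fun _ : ι => μ).prod μ) (Measure.pi fun _ : ι => μ) := by
  have hmeas : Measurable (fun p : (ι → S) × S => Function.update p.1 l p.2) := by
    refine measurable_pi_lambda _ fun i => ?_
    by_cases hi : i = l
    · subst hi; simp only [Function.update_self]; fun_prop
    · simp only [Function.update_of_ne hi]; fun_prop
  refine ⟨hmeas, (Measure.pi_eq fun s hs => ?_).symm⟩
  rw [Measure.map_apply hmeas (MeasurableSet.univ_pi hs)]
  have : (fun p : (ι → S) × S => Function.update p.1 l p.2) ⁻¹' Set.univ.pi s =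
      (Set.univ.pi fun i => if i = l then Set.univ else s i) ×ˢ s l := by
    ext ⟨z, t⟩
    simp only [Set.mem_preimage, Set.mem_pi, Set.mem_univ, true_implies, Set.mem_prod]
    constructor
    · intro h
      refine ⟨fun i => ?_, by simpa using h l⟩
      by_cases hi : i = l
      · simp [hi]
      · simpa [hi] using h i
    · rintro ⟨h, h'⟩ i
      by_cases hi : i = l
      · subst hi; simpa using h'
      · simpa [hi] using h i
  rw [this, Measure.prod_prod, Measure.pi_pi, ← Finset.mul_prod_erase _ _ (Finset.mem_univ l),
    ← Finset.mul_prod_erase _ (fun i => μ (s i)) (Finset.mem_univ l)]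
  simp only [if_true, measure_univ, one_mul]
  rw [mul_comm]
  congr 1
  refine Finset.prod_congr rfl fun i hi => ?_
  rw [if_neg (Finset.ne_of_mem_erase hi)]

theorem measurePreserving_update_update {l m : ι} :
    MeasurePreserving
      (fun p : (ι → S) × (S × S) => Function.update (Function.update p.1 l p.2.1) m p.2.2)
      ((Measure.pi fun _ : ι => μ).prod (μ.prod μ)) (Measure.pi fun _ : ι => μ) := by
  have h1 := (measurePreserving_update μ l).prod (MeasurePreserving.id μ)
  have h2 := (measurePreserving_update μ m).comp h1
  exact h2.comp (measurePreserving_prodAssoc (Measure.pi fun _ : ι => μ) μ μ).symm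

/-- A function that does not depend on the coordinate `l` is integrated against a kernel in that
coordinate. -/
theorem lintegral_mul_kernel_le (l : ι) {H : (ι → S) → ENNReal} (hH : Measurable H)
    (hHl : ∀ z t, H (Function.update z l t) = H z) {K : (ι → S) → S → ENNReal}
    (hK : Measurable fun p : (ι → S) × S => K p.1 p.2)
    (hKl : ∀ z t, K (Function.update z l t) = K z) {κ : ENNReal}
    (hκ : ∀ z, ∫⁻ t, K z t ∂μ ≤ κ) :
    ∫⁻ z, H z * K z (z l) ∂(Measure.pi fun _ : ι => μ) ≤
      (∫⁻ z, H z ∂(Measure.pi fun _ : ι => μ)) * κ := by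
  have hm : Measurable fun z : ι → S => H z * K z (z l) :=
    hH.mul (hK.comp (measurable_id.prodMk (measurable_pi_apply l)))
  rw [← (measurePreserving_update μ l).lintegral_comp hm]
  simp only [hHl, hKl, Function.update_self]
  rw [lintegral_prod _ (by fun_prop), ← lintegral_mul_const _ hH]
  refine lintegral_mono fun z => ?_
  have hKz : Measurable (K z) := hK.comp (measurable_const.prodMk measurable_id)
  simp only
  rw [lintegral_const_mul _ hKz]
  exact mul_le_mul_right (hκ z) _

open Classical in
-- Markov's inequality for exp(−count), whose mean factorizes over the coordinates. A factor outside
-- `Q` is 1 − (1 − e⁻¹) μ(A), which is at most exp(−(1 − e⁻¹) q).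
theorem measureReal_count_lt_le {A : Set S} (hA : MeasurableSet A) {q : ℝ}
    (hqA : q ≤ μ.real A) (Q : Finset ι) {k : ℕ} :
    (Measure.pi fun _ : ι => μ).real
        {z | ({p | p ∉ Q ∧ z p ∈ A} : Finset ι).card < k} ≤
      Real.exp (k - (1 - Real.exp (-1)) * q * (Fintype.card ι - Q.card)) := by
  set P := Measure.pi fun _ : ι => μ
  let h : ι → S → ℝ := fun p s => if p ∉ Q ∧ s ∈ A then Real.exp (-1) else 1
  have hpos : ∀ p s, 0 < h p s := fun p s => by
    by_cases hp : p ∉ Q ∧ s ∈ A <;> simp [h, hp, Real.exp_pos]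
  have hle1 : ∀ p s, h p s ≤ 1 := fun p s => by
    by_cases hp : p ∉ Q ∧ s ∈ A <;> simp [h, hp]
  have hmeas : ∀ p, Measurable (h p) := fun p => by
    by_cases hp : p ∈ Q
    · simp [h, hp]
    · simp only [h, hp, not_false_eq_true, true_and]
      exact Measurable.ite hA measurable_const measurable_const
  have hprodm : Measurable fun z : ι → S => ∏ p, h p (z p) :=
    Finset.measurable_prod _ fun p _ => (hmeas p).comp (measurable_pi_apply p)
  have hint : Integrable (fun z : ι → S => ∏ p, h p (z p)) P := by
    refine Integrable.of_bound hprodm.aestronglyMeasurable 1 (Filter.Eventually.of_forall fun z => ?_)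
    rw [Real.norm_eq_abs, abs_of_nonneg (Finset.prod_nonneg fun p _ => (hpos _ _).le)]
    exact Finset.prod_le_one (fun p _ => (hpos _ _).le) fun p _ => hle1 _ _
  have hprod : ∀ z : ι → S, ∏ p, h p (z p) =
      Real.exp (-(({p | p ∉ Q ∧ z p ∈ A} : Finset ι).card : ℝ)) := fun z => by
    simp only [h]
    rw [Finset.prod_ite, Finset.prod_const, Finset.prod_const_one, mul_one, ← Real.exp_nat_mul]
    congr 1; ring
  have hmark : P.real {z | ({p | p ∉ Q ∧ z p ∈ A} : Finset ι).card < k} ≤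
      Real.exp k * ∫ z, ∏ p, h p (z p) ∂P := by
    have := mul_meas_ge_le_integral_of_nonneg (μ := P)
      (Filter.Eventually.of_forall fun z => Finset.prod_nonneg fun p _ => (hpos p (z p)).le)
      hint (Real.exp (-k))
    rw [Real.exp_neg, inv_mul_le_iff₀ (Real.exp_pos _)] at this
    refine le_trans (measureReal_mono ?_) this
    intro z hz
    show _ ≤ ∏ p, h p (z p)
    rw [hprod, ← Real.exp_neg, Real.exp_le_exp]
    have : ({p | p ∉ Q ∧ z p ∈ A} : Finset ι).card ≤ k := le_of_lt hz
    have : (({p | p ∉ Q ∧ z p ∈ A} : Finset ι).card : ℝ) ≤ k := by exact_mod_cast this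
    linarith
  have hone : ∀ p, ∫ s, h p s ∂μ ≤
      if p ∈ Q then 1 else Real.exp (-((1 - Real.exp (-1)) * q)) := fun p => by
    by_cases hp : p ∈ Q
    · simp [h, hp]
    · have e1 : h p = fun s => 1 - A.indicator (fun _ => 1 - Real.exp (-1)) s := by
        ext s
        by_cases hs : s ∈ A <;> simp [h, hp, hs]
      rw [if_neg hp, e1, integral_sub (integrable_const _)
        ((integrable_const _).indicator hA), integral_indicator hA]
      simp only [integral_const, probReal_univ, smul_eq_mul, one_mul, measureReal_restrict_apply_univ]
      have hexp : Real.exp (-1) ≤ 1 := by rw [Real.exp_le_one_iff]; norm_num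
      have := Real.add_one_le_exp (-((1 - Real.exp (-1)) * q))
      nlinarith
  refine hmark.trans ?_
  rw [show ∫ z, ∏ p, h p (z p) ∂P = ∏ p, ∫ s, h p s ∂μ from integral_fintype_prod_eq_prod h]
  have hcard : ∏ p : ι, (if p ∈ Q then 1 else Real.exp (-((1 - Real.exp (-1)) * q))) =
      Real.exp (-((1 - Real.exp (-1)) * q) * (Fintype.card ι - Q.card)) := by
    rw [Finset.prod_ite, Finset.prod_const_one, one_mul, Finset.prod_const, ← Real.exp_nat_mul]
    congr 1
    rw [Finset.filter_not, Finset.filter_mem_eq_inter, Finset.univ_inter,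
      Finset.card_sdiff_of_subset (Finset.subset_univ _), Finset.card_univ,
      Nat.cast_sub (Finset.card_le_univ _)]
    ring
  have hfin : ∏ p, ∫ s, h p s ∂μ ≤
      Real.exp (-((1 - Real.exp (-1)) * q) * (Fintype.card ι - Q.card)) := by
    rw [← hcard]
    exact Finset.prod_le_prod (fun p _ => integral_nonneg fun s => (hpos p s).le) fun p _ => hone p
  calc Real.exp k * ∏ p, ∫ s, h p s ∂μ ≤ Real.exp k *
      Real.exp (-((1 - Real.exp (-1)) * q) * (Fintype.card ι - Q.card)) := by gcongr
    _ = _ := by rw [← Real.exp_add]; congr 1; ring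

open Classical in
-- Replaces the exponent k − s by 1 − s/k, which depends on s/k alone. For s ≥ k the number k − s is
-- not positive, hence at most (k − s)/k; for s < k the right side is at least 1.
theorem measureReal_count_lt_le_div {A : Set S} (hA : MeasurableSet A) {q : ℝ}
    (hqA : q ≤ μ.real A) (Q : Finset ι) {k : ℕ} (hk : 1 ≤ k) :
    (Measure.pi fun _ : ι => μ).real
        {z | ({p | p ∉ Q ∧ z p ∈ A} : Finset ι).card < k} ≤
      Real.exp (1 - (1 - Real.exp (-1)) * q * (Fintype.card ι - Q.card) / k) := by
  set s := (1 - Real.exp (-1)) * q * (Fintype.card ι - Q.card) with hs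
  have hk1 : (1 : ℝ) ≤ k := by exact_mod_cast hk
  have hk0 : (0 : ℝ) < k := by linarith
  rcases le_or_gt (k : ℝ) s with h | h
  · refine (measureReal_count_lt_le μ hA hqA Q).trans (Real.exp_le_exp.mpr ?_)
    rw [← hs, show (1 : ℝ) - s / k = (k - s) / k by field_simp, le_div_iff₀ hk0]
    nlinarith
  · refine measureReal_le_one.trans (Real.one_le_exp ?_)
    rw [sub_nonneg, div_le_one hk0]
    exact h.le

end ProductMeasures

/-! ### Exponential kernels and their scaling -/

section Kernels

variable {d : ℕ}

/-- The kernel `|x - y| ^ p * exp (-θ (|x - y| / ε) ^ d)`. -/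
noncomputable def expKernel (θ ε : ℝ) (p : ℕ) (x y : EuclideanSpace ℝ (Fin d)) : ENNReal :=
  ENNReal.ofReal (dist x y ^ p * Real.exp (-(θ * (dist x y / ε) ^ d)))

theorem expKernel_comm (θ ε : ℝ) (p : ℕ) (x y : EuclideanSpace ℝ (Fin d)) :
    expKernel θ ε p x y = expKernel θ ε p y x := by
  unfold expKernel; rw [dist_comm]

theorem measurable_expKernel (θ ε : ℝ) (p : ℕ) :
    Measurable fun q : EuclideanSpace ℝ (Fin d) × EuclideanSpace ℝ (Fin d) =>
      expKernel θ ε p q.1 q.2 := by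
  unfold expKernel
  fun_prop

/-- Polar coordinates reduce this to a one-dimensional Gamma-type integral. -/
theorem integrable_norm_pow_mul_exp (hd : 1 ≤ d) {θ : ℝ} (hθ : 0 < θ) (p : ℕ) :
    Integrable (fun y : EuclideanSpace ℝ (Fin d) => ‖y‖ ^ p * Real.exp (-(θ * ‖y‖ ^ d))) := by
  have : Nonempty (Fin d) := ⟨⟨0, hd⟩⟩
  rw [integrable_fun_norm_addHaar volume (f := fun r : ℝ => r ^ p * Real.exp (-(θ * r ^ d)))]
  have h := integrableOn_rpow_mul_exp_neg_mul_rpow (p := (d : ℝ)) (s := ((d - 1 + p : ℕ) : ℝ))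
    (b := θ) (by have : (0 : ℝ) ≤ ((d - 1 + p : ℕ) : ℝ) := by positivity
                 linarith) (by exact_mod_cast hd) hθ
  refine h.congr_fun (fun r hr => ?_) measurableSet_Ioi
  simp only [Real.rpow_natCast, finrank_euclideanSpace, Fintype.card_fin, smul_eq_mul]
  rw [pow_add, neg_mul, mul_assoc]

/-- The substitution y = x − εu extracts ε^d from Lebesgue measure and ε^p from the power of the
distance. -/
theorem exists_lintegral_expKernel_le (hd : 1 ≤ d) {θ : ℝ} (hθ : 0 < θ) (p : ℕ) :
    ∃ C : ℝ, 0 < C ∧ ∀ ε : ℝ, 0 < ε → ∀ x : EuclideanSpace ℝ (Fin d),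
      ∫⁻ y, expKernel θ ε p x y ≤ ENNReal.ofReal (C * ε ^ (d + p)) := by
  set f : EuclideanSpace ℝ (Fin d) → ℝ := fun y => ‖y‖ ^ p * Real.exp (-(θ * ‖y‖ ^ d)) with hf
  have hf0 : ∀ y, 0 ≤ f y := fun y => by positivity
  have hfi : Integrable f := integrable_norm_pow_mul_exp hd hθ p
  have hI : 0 ≤ ∫ y, f y := integral_nonneg hf0
  -- The summand 1 only makes the constant strictly positive.
  refine ⟨(∫ y, f y) + 1, by linarith, fun ε hε x => ?_⟩
  have hk : ∀ y, expKernel θ ε p x y = ENNReal.ofReal (ε ^ p * f (ε⁻¹ • (x - y))) := fun y => by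
    unfold expKernel
    congr 1
    simp only [hf, norm_smul, norm_inv, Real.norm_eq_abs, abs_of_pos hε, ← dist_eq_norm]
    rw [inv_mul_eq_div, div_pow (dist x y) ε p]
    field_simp
  have hint : Integrable (fun y => ε ^ p * f (ε⁻¹ • (x - y))) :=
    ((hfi.comp_smul (inv_ne_zero hε.ne')).comp_sub_left x).const_mul _
  simp only [hk]
  rw [← ofReal_integral_eq_lintegral_ofReal hint
    (Filter.Eventually.of_forall fun y => mul_nonneg (by positivity) (hf0 _))]
  refine ENNReal.ofReal_le_ofReal ?_
  rw [integral_const_mul, integral_sub_left_eq_self (fun y => f (ε⁻¹ • y)) volume x,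
    Measure.integral_comp_inv_smul_of_nonneg _ _ hε.le]
  simp only [finrank_euclideanSpace, Fintype.card_fin, smul_eq_mul]
  rw [pow_add]
  have : 0 < ε ^ p * ε ^ d := by positivity
  nlinarith

end Kernels

/-! ### Measurability, and the counting event implied by a match -/

section Measurability

variable {d N : ℕ}

theorem measurable_card_filter {α ι : Type*} [MeasurableSpace α] [Fintype ι] {p : α → ι → Prop}
    [∀ a, DecidablePred (p a)] (h : ∀ i, MeasurableSet {a | p a i}) :
    Measurable fun a => ({i | p a i} : Finset ι).card := by
  classical
  simp only [Finset.card_filter]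
  refine Finset.measurable_sum _ fun i _ => ?_
  have : (fun a => if p a i then 1 else 0) = Set.indicator {a | p a i} (fun _ => (1 : ℕ)) := by
    ext a; simp [Set.indicator]
  rw [this]
  exact measurable_const.indicator (h i)

theorem measurable_one_sub_treatment (i : Fin N) :
    Measurable fun z : Fin N → Fin 2 × EuclideanSpace ℝ (Fin d) => 1 - (z i).1 :=
  (measurable_of_finite fun a : Fin 2 => 1 - a).comp (by fun_prop)

theorem measurableSet_isNeighbour (k : ℕ) (i l : Fin N) :
    MeasurableSet {z : Fin N → Fin 2 × EuclideanSpace ℝ (Fin d) | IsNeighbour k z i l} := by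
  have h1 : ∀ p : Fin N, MeasurableSet
      {z : Fin N → Fin 2 × EuclideanSpace ℝ (Fin d) | (z p).1 = 1 - (z i).1} := fun p =>
    measurableSet_eq_fun (by fun_prop) (measurable_one_sub_treatment i)
  refine (h1 l).inter (measurableSet_le (g := fun _ => k) ?_ measurable_const)
  unfold neighbourRank treatmentGroup
  simp only [Finset.filter_filter]
  refine measurable_card_filter fun p => (h1 p).inter (MeasurableSet.union ?_ ?_)
  · exact measurableSet_lt
      (f := fun z : Fin N → Fin 2 × EuclideanSpace ℝ (Fin d) => dist (z p).2 (z i).2)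
      (g := fun z => dist (z l).2 (z i).2) (by fun_prop) (by fun_prop)
  · exact (measurableSet_eq_fun
      (f := fun z : Fin N → Fin 2 × EuclideanSpace ℝ (Fin d) => dist (z p).2 (z i).2)
      (g := fun z => dist (z l).2 (z i).2) (by fun_prop) (by fun_prop)).inter (MeasurableSet.const _)

theorem measurable_regression {g : Fin 2 → EuclideanSpace ℝ (Fin d) → ℝ}
    (hg : ∀ a, Measurable (g a)) (i l : Fin N) :
    Measurable fun z : Fin N → Fin 2 × EuclideanSpace ℝ (Fin d) =>
      g (1 - (z i).1) (z l).2 := by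
  have h : Measurable fun q : Fin 2 × EuclideanSpace ℝ (Fin d) => g q.1 q.2 :=
    measurable_from_prod_countable_right fun a => hg a
  exact h.comp ((measurable_one_sub_treatment i).prodMk (by fun_prop))

theorem measurable_matchTerm {g : Fin 2 → EuclideanSpace ℝ (Fin d) → ℝ}
    (hg : ∀ a, Measurable (g a)) (k : ℕ) (i l : Fin N) : Measurable (matchTerm g k i l) := by
  classical
  unfold matchTerm
  refine Measurable.ite (measurableSet_isNeighbour k i l) (Measurable.mul ?_ ?_) measurable_const
  · exact (measurable_of_finite treatmentSign).comp (by fun_prop)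
  · exact (measurable_regression hg i i).sub (measurable_regression hg i l)

theorem measurable_pairBias {g : Fin 2 → EuclideanSpace ℝ (Fin d) → ℝ}
    (hg : ∀ a, Measurable (g a)) (k : ℕ) :
    Measurable (pairBias (N := N) g k) := by
  classical
  have : pairBias (N := N) g k = fun z => (1 / (N : ℝ)) * ∑ i, treatmentSign (z i).1 *
      (g (1 - (z i).1) (z i).2 -
        (1 / (k : ℝ)) * ∑ l, if IsNeighbour k z i l then g (1 - (z i).1) (z l).2 else 0) := by
    ext z; rw [pairBias_eq_sum]; simp only [Finset.sum_filter]
  rw [this]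
  refine (Finset.measurable_sum _ fun i _ => Measurable.mul ?_ ?_).const_mul _
  · exact (measurable_of_finite treatmentSign).comp (by fun_prop)
  · refine (measurable_regression hg i i).sub
      ((Finset.measurable_sum _ fun l _ => ?_).const_mul _)
    exact Measurable.ite (measurableSet_isNeighbour k i l) (measurable_regression hg i l)
      measurable_const

open Classical in
/-- Fewer than `k` units outside `Q` have treatment `a` and are at distance less than `r` of `x`. -/
def FewCloser (k : ℕ) (Q : Finset (Fin N)) (z : Fin N → Fin 2 × EuclideanSpace ℝ (Fin d))
    (a : Fin 2) (x : EuclideanSpace ℝ (Fin d)) (r : ℝ) : Prop :=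
  ({p | p ∉ Q ∧ z p ∈ ({a} : Set (Fin 2)) ×ˢ Metric.ball x r} : Finset (Fin N)).card < k

theorem measurableSet_fewCloser (k : ℕ) (Q : Finset (Fin N)) :
    MeasurableSet {q : (Fin N → Fin 2 × EuclideanSpace ℝ (Fin d)) ×
      (Fin 2 × EuclideanSpace ℝ (Fin d) × ℝ) |
        FewCloser k Q q.1 q.2.1 q.2.2.1 q.2.2.2} := by
  classical
  refine measurableSet_lt (g := fun _ => k) ?_ measurable_const
  refine measurable_card_filter fun p => (MeasurableSet.const _).inter (MeasurableSet.inter ?_ ?_)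
  · exact measurableSet_eq_fun
      (f := fun q : (Fin N → Fin 2 × EuclideanSpace ℝ (Fin d)) ×
        (Fin 2 × EuclideanSpace ℝ (Fin d) × ℝ) => (q.1 p).1)
      (g := fun q => q.2.1) (by fun_prop) (by fun_prop)
  · exact measurableSet_lt
      (f := fun q : (Fin N → Fin 2 × EuclideanSpace ℝ (Fin d)) ×
        (Fin 2 × EuclideanSpace ℝ (Fin d) × ℝ) => dist (q.1 p).2 q.2.2.1)
      (g := fun q => q.2.2.2) (by fun_prop) (by fun_prop)

/-- A match `l` counts in its own rank, which is at most `k`, so without `l` and the rest of `Q`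
fewer than `k` strictly closer units are left. The gain is that the positions inside `Q` now enter
only as centre and radius, so the remaining units can be resampled. -/
theorem IsNeighbour.fewCloser {k : ℕ} {z : Fin N → Fin 2 × EuclideanSpace ℝ (Fin d)}
    {i l : Fin N} (h : IsNeighbour k z i l) {Q : Finset (Fin N)} (hl : l ∈ Q) :
    FewCloser k Q z (1 - (z i).1) (z i).2 (dist (z i).2 (z l).2) := by
  refine lt_of_lt_of_le (Finset.card_lt_card
    (Finset.ssubset_iff_of_subset ?_ |>.mpr ⟨l, ?_, ?_⟩)) h.2
  · intro p
    simp only [Finset.mem_filter, Finset.mem_univ, true_and, Set.mem_prod, Set.mem_singleton_iff,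
      Metric.mem_ball, treatmentGroup]
    rintro ⟨_, h1, h2⟩
    exact ⟨h1, Or.inl (by rwa [dist_comm (z l).2])⟩
  · simp [treatmentGroup, h.1]
  · simp [hl]

open Classical in
theorem fewCloser_congr {k : ℕ} {Q : Finset (Fin N)}
    {z z' : Fin N → Fin 2 × EuclideanSpace ℝ (Fin d)} (h : ∀ p, p ∉ Q → z p = z' p)
    (a : Fin 2) (x : EuclideanSpace ℝ (Fin d)) (r : ℝ) :
    FewCloser k Q z a x r ↔ FewCloser k Q z' a x r := by
  unfold FewCloser
  rw [show ({p | p ∉ Q ∧ z p ∈ ({a} : Set (Fin 2)) ×ˢ Metric.ball x r} : Finset (Fin N)) =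
    ({p | p ∉ Q ∧ z' p ∈ ({a} : Set (Fin 2)) ×ˢ Metric.ball x r} : Finset (Fin N)) from ?_]
  refine Finset.filter_congr fun p _ => and_congr_right fun hp => ?_
  rw [h p hp]

end Measurability

/-! ### Designs with explicit constants and their tail bounds -/

section Design

variable {d : ℕ}

/-- The law on (treatment, covariate) pairs with subdensities `m a`. -/
noncomputable def designLaw (m : Fin 2 → EuclideanSpace ℝ (Fin d) → ℝ) :
    Measure (Fin 2 × EuclideanSpace ℝ (Fin d)) :=
  ∑ a, (volume.withDensity fun x => ENNReal.ofReal (m a x)).map (fun x => (a, x))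

/-- Quantitative regularity of the regression functions `g a` and of the subdensities `m a`
(density of the covariate on the event that the treatment is `a`) on the domain `𝒳`. -/
structure RegularDesign (𝒳 : Set (EuclideanSpace ℝ (Fin d))) (D A c : ℝ)
    (g m : Fin 2 → EuclideanSpace ℝ (Fin d) → ℝ) : Prop where
  D_pos : 0 < D
  A_pos : 0 < A
  c_pos : 0 < c
  measurableSet : MeasurableSet 𝒳
  dist_le : ∀ x ∈ 𝒳, ∀ y ∈ 𝒳, dist x y ≤ D
  measurable_g : ∀ a, Measurable (g a)
  abs_g_le : ∀ a x, |g a x| ≤ A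
  g_lipschitz : ∀ a, ∀ x ∈ 𝒳, ∀ y ∈ 𝒳, |g a x - g a y| ≤ A * dist x y
  g_taylor : ∀ a, ∀ x ∈ 𝒳, ∃ L : EuclideanSpace ℝ (Fin d) →L[ℝ] ℝ, ‖L‖ ≤ A ∧
    ∀ y ∈ 𝒳, |g a y - g a x - L (y - x)| ≤ A * dist x y ^ 2
  measurable_m : ∀ a, Measurable (m a)
  m_nonneg : ∀ a x, 0 ≤ m a x
  m_le : ∀ a x, m a x ≤ A
  m_eq_zero : ∀ a, ∀ x ∉ 𝒳, m a x = 0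
  m_lipschitz : ∀ a, ∀ x ∈ 𝒳, ∀ y ∈ 𝒳, |m a x - m a y| ≤ A * dist x y
  ball_mass : ∀ a, ∀ x ∈ 𝒳, ∀ r, 0 ≤ r → r ≤ D →
    ENNReal.ofReal (c * r ^ d) ≤ ∫⁻ y in Metric.ball x r, ENNReal.ofReal (m a y)
  total_mass : ∀ a, ENNReal.ofReal (c * D ^ d) ≤ ∫⁻ y, ENNReal.ofReal (m a y)
  boundary : ∀ a, ∀ ε, 0 < ε → ∫⁻ x, ENNReal.ofReal (m a x) *
    ENNReal.ofReal (Real.exp (-((Metric.infDist x 𝒳ᶜ / ε) ^ d))) ≤ ENNReal.ofReal (A * ε)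

variable {𝒳 : Set (EuclideanSpace ℝ (Fin d))} {D A c : ℝ}
  {g m : Fin 2 → EuclideanSpace ℝ (Fin d) → ℝ}

theorem RegularDesign.lintegral_designLaw (h : RegularDesign 𝒳 D A c g m)
    {F : Fin 2 × EuclideanSpace ℝ (Fin d) → ENNReal} (hF : Measurable F) :
    ∫⁻ s, F s ∂(designLaw m) = ∑ a, ∫⁻ x, ENNReal.ofReal (m a x) * F (a, x) := by
  unfold designLaw
  rw [lintegral_finsetSum_measure]
  refine Finset.sum_congr rfl fun a _ => ?_
  have hFa : Measurable fun x => F (a, x) := hF.comp (by fun_prop)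
  rw [lintegral_map hF (by fun_prop), lintegral_withDensity_eq_lintegral_mul _
    (h.measurable_m a).ennreal_ofReal hFa]
  rfl

/-- A match belongs to a prescribed group, so the integrands met later vanish at the other treatment
and a single subdensity survives. -/
theorem RegularDesign.integral_designLaw (h : RegularDesign 𝒳 D A c g m)
    [IsProbabilityMeasure (designLaw m)]
    {F : Fin 2 × EuclideanSpace ℝ (Fin d) → ℝ} (hF : Measurable F) {B : ℝ} (hB : ∀ s, |F s| ≤ B)
    (b : Fin 2) (hb : ∀ a x, a ≠ b → F (a, x) = 0) :
    ∫ s, F s ∂(designLaw m) = ∫ x, m b x * F (b, x) := by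
  have hint : ∀ a ∈ (Finset.univ : Finset (Fin 2)), Integrable F
      ((volume.withDensity fun x => ENNReal.ofReal (m a x)).map (fun x => (a, x))) := by
    intro a _
    have hle : (volume.withDensity fun x => ENNReal.ofReal (m a x)).map (fun x => (a, x)) ≤
        designLaw m := by
      unfold designLaw
      exact Finset.single_le_sum (f := fun a => (volume.withDensity fun x =>
        ENNReal.ofReal (m a x)).map (fun x => ((a, x) : Fin 2 × EuclideanSpace ℝ (Fin d))))
        (fun _ _ => Measure.zero_le _) (Finset.mem_univ a)
    exact (Integrable.of_bound hF.aestronglyMeasurable B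
      (Filter.Eventually.of_forall fun s => hB s) : Integrable F (designLaw m)).mono_measure hle
  unfold designLaw
  rw [integral_finsetSum_measure hint]
  have hval : ∀ a, ∫ s, F s ∂((volume.withDensity fun x => ENNReal.ofReal (m a x)).map
      (fun x => (a, x))) = ∫ x, m a x * F (a, x) := by
    intro a
    rw [integral_map (by fun_prop) hF.aestronglyMeasurable,
      integral_withDensity_eq_integral_toReal_smul (h.measurable_m a).ennreal_ofReal
        (Filter.Eventually.of_forall fun x => ENNReal.ofReal_lt_top)]
    simp only [ENNReal.toReal_ofReal (h.m_nonneg a _), smul_eq_mul]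
  simp only [hval]
  rw [Finset.sum_eq_single b]
  · intro a _ hab
    simp [hb a _ hab]
  · simp

theorem RegularDesign.designLaw_prod (h : RegularDesign 𝒳 D A c g m) (a : Fin 2)
    {B : Set (EuclideanSpace ℝ (Fin d))} (hB : MeasurableSet B) :
    designLaw m (({a} : Set (Fin 2)) ×ˢ B) = ∫⁻ x in B, ENNReal.ofReal (m a x) := by
  have hs : MeasurableSet (({a} : Set (Fin 2)) ×ˢ B) := (measurableSet_singleton a).prod hB
  rw [← lintegral_indicator_one hs, h.lintegral_designLaw (measurable_one.indicator hs),
    Finset.sum_eq_single a, ← lintegral_indicator hB]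
  · refine lintegral_congr fun x => ?_
    by_cases hx : x ∈ B <;> simp [hx]
  · intro b _ hb
    simp [Set.indicator, hb]
  · simp

theorem RegularDesign.ae_mem (h : RegularDesign 𝒳 D A c g m) :
    ∀ᵐ s ∂(designLaw m), s.2 ∈ 𝒳 := by
  rw [ae_iff]
  have hs : MeasurableSet {s : Fin 2 × EuclideanSpace ℝ (Fin d) | ¬ s.2 ∈ 𝒳} :=
    (measurable_snd h.measurableSet).compl
  rw [← lintegral_indicator_one hs, h.lintegral_designLaw (measurable_one.indicator hs)]
  refine Finset.sum_eq_zero fun a _ => ?_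
  rw [lintegral_eq_zero_iff (by
    exact (h.measurable_m a).ennreal_ofReal.mul
      ((measurable_one.indicator hs).comp (by fun_prop)))]
  refine Filter.Eventually.of_forall fun x => ?_
  by_cases hx : x ∈ 𝒳
  · simp [hx]
  · simp [h.m_eq_zero a x hx]

theorem RegularDesign.ae_pi_mem (h : RegularDesign 𝒳 D A c g m)
    [IsProbabilityMeasure (designLaw m)] (N : ℕ) :
    ∀ᵐ z ∂(Measure.pi fun _ : Fin N => designLaw m), ∀ p, (z p).2 ∈ 𝒳 := by
  rw [ae_all_iff]
  intro p
  exact (measurePreserving_eval (fun _ : Fin N => designLaw m) p).quasiMeasurePreserving.ae h.ae_mem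

theorem RegularDesign.lintegral_snd_le (h : RegularDesign 𝒳 D A c g m)
    {F : EuclideanSpace ℝ (Fin d) → ENNReal} (hF : Measurable F) :
    ∫⁻ s, F s.2 ∂(designLaw m) ≤ ENNReal.ofReal (2 * A) * ∫⁻ x, F x := by
  rw [h.lintegral_designLaw (F := fun s => F s.2) (hF.comp measurable_snd)]
  have : ∀ a ∈ (Finset.univ : Finset (Fin 2)), ∫⁻ x, ENNReal.ofReal (m a x) * F x ≤
      ENNReal.ofReal A * ∫⁻ x, F x := fun a _ => by
    rw [← lintegral_const_mul _ hF]
    exact lintegral_mono fun x => mul_le_mul_left (ENNReal.ofReal_le_ofReal (h.m_le a x)) _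
  refine (Finset.sum_le_card_nsmul _ _ _ this).trans (le_of_eq ?_)
  rw [Finset.card_univ, Fintype.card_fin, ENNReal.ofReal_mul (by norm_num), nsmul_eq_mul, mul_assoc]
  norm_num

/-- The exponential rate in the tail bounds of nearest neighbour distances. -/
noncomputable def tailRate (c : ℝ) : ℝ := (1 - Real.exp (-1)) * c / 4

theorem tailRate_pos (hc : 0 < c) : 0 < tailRate c := by
  have : Real.exp (-1) < 1 := by rw [Real.exp_lt_one_iff]; norm_num
  unfold tailRate
  have : 0 < 1 - Real.exp (-1) := by linarith
  positivity

open Classical in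
-- The Chernoff bound with mass c r^d per unit. At most four units are excluded and N ≥ 8, so at
-- least N/2 remain; with N/k = ε^(−d) the exponent becomes a multiple of (r/ε)^d. The rate is twice
-- `tailRate c` so that it can be shared between two events.
theorem RegularDesign.measure_count_le (h : RegularDesign 𝒳 D A c g m)
    [IsProbabilityMeasure (designLaw m)] {N k : ℕ} (hN : 8 ≤ N) (hk : 1 ≤ k) {ε : ℝ}
    (hεd : ε ^ d = k / N) (Q : Finset (Fin N)) (hQ : Q.card ≤ 4) (a : Fin 2)
    {B : Set (EuclideanSpace ℝ (Fin d))} (hB : MeasurableSet B) {r : ℝ} (hr : 0 ≤ r)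
    (hBr : ENNReal.ofReal (c * r ^ d) ≤ ∫⁻ x in B, ENNReal.ofReal (m a x)) :
    (Measure.pi fun _ : Fin N => designLaw m)
        {z | ({p | p ∉ Q ∧ z p ∈ ({a} : Set (Fin 2)) ×ˢ B} : Finset (Fin N)).card < k} ≤
      ENNReal.ofReal (Real.exp (1 - 2 * (tailRate c * (r / ε) ^ d))) := by
  have hc := h.c_pos
  have hq : c * r ^ d ≤ (designLaw m).real (({a} : Set (Fin 2)) ×ˢ B) := by
    rw [measureReal_def, ← ENNReal.ofReal_le_iff_le_toReal (measure_ne_top _ _),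
      h.designLaw_prod a hB]
    exact hBr
  have key : (Measure.pi fun _ : Fin N => designLaw m).real
      {z | ({p | p ∉ Q ∧ z p ∈ ({a} : Set (Fin 2)) ×ˢ B} : Finset (Fin N)).card < k} ≤
      Real.exp (1 - (1 - Real.exp (-1)) * (c * r ^ d) * (Fintype.card (Fin N) - Q.card) / k) := by
    convert measureReal_count_lt_le_div (designLaw m) ((measurableSet_singleton a).prod hB) hq Q hk
  rw [← ofReal_measureReal]
  refine ENNReal.ofReal_le_ofReal (key.trans (Real.exp_le_exp.mpr ?_))
  have hN' : (8 : ℝ) ≤ N := by exact_mod_cast hN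
  have hQ' : (Q.card : ℝ) ≤ 4 := by exact_mod_cast hQ
  have hk0 : (0 : ℝ) < k := by positivity
  have hexp : Real.exp (-1) < 1 := by rw [Real.exp_lt_one_iff]; norm_num
  have h1 : 0 ≤ (1 - Real.exp (-1)) * (c * r ^ d) :=
    mul_nonneg (by linarith) (by positivity)
  rw [Fintype.card_fin, div_pow, hεd]
  have e : 2 * (tailRate c * (r ^ d / (k / N))) =
      (1 - Real.exp (-1)) * (c * r ^ d) * (N / 2) / k := by
    unfold tailRate; field_simp; ring
  rw [e]
  gcongr
  linarith

/-- The two events need not be independent. Their intersection is bounded by the less likely one,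
and twice the larger exponent is at least the sum of both. -/
theorem RegularDesign.measure_fewCloser_le (h : RegularDesign 𝒳 D A c g m)
    [IsProbabilityMeasure (designLaw m)] {N k : ℕ} (hN : 8 ≤ N) (hk : 1 ≤ k) {ε : ℝ}
    (hεd : ε ^ d = k / N) (Q : Finset (Fin N)) (hQ : Q.card ≤ 4) (a a' : Fin 2)
    {x x' : EuclideanSpace ℝ (Fin d)} (hx : x ∈ 𝒳) (hx' : x' ∈ 𝒳) {r r' : ℝ} (hr : 0 ≤ r)
    (hr' : 0 ≤ r') (hrD : r ≤ D) (hrD' : r' ≤ D) :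
    (Measure.pi fun _ : Fin N => designLaw m)
        {z | FewCloser k Q z a x r ∧ FewCloser k Q z a' x' r'} ≤
      ENNReal.ofReal (Real.exp 1 * (Real.exp (-(tailRate c * (r / ε) ^ d)) *
        Real.exp (-(tailRate c * (r' / ε) ^ d)))) := by
  have h1 := h.measure_count_le hN hk hεd Q hQ a Metric.isOpen_ball.measurableSet hr
    (h.ball_mass a x hx r hr hrD)
  have h2 := h.measure_count_le hN hk hεd Q hQ a' Metric.isOpen_ball.measurableSet hr'
    (h.ball_mass a' x' hx' r' hr' hrD')
  rw [← Real.exp_add, ← Real.exp_add]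
  rcases le_total (tailRate c * (r / ε) ^ d) (tailRate c * (r' / ε) ^ d) with hle | hle
  · refine (measure_mono fun z hz => hz.2).trans (h2.trans (ENNReal.ofReal_le_ofReal
      (Real.exp_le_exp.mpr ?_)))
    linarith
  · refine (measure_mono fun z hz => hz.1).trans (h1.trans (ENNReal.ofReal_le_ofReal
      (Real.exp_le_exp.mpr ?_)))
    linarith

end Design

/-! ### Absolute moments of products of two match contributions -/

section FourPoints

variable {d N : ℕ} {𝒳 : Set (EuclideanSpace ℝ (Fin d))} {D A c : ℝ}
  {g m : Fin 2 → EuclideanSpace ℝ (Fin d) → ℝ}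

theorem RegularDesign.enorm_matchTerm_le (h : RegularDesign 𝒳 D A c g m) (k : ℕ) {i l : Fin N}
    {z : Fin N → Fin 2 × EuclideanSpace ℝ (Fin d)} (hi : (z i).2 ∈ 𝒳) (hl : (z l).2 ∈ 𝒳) :
    ‖matchTerm g k i l z‖ₑ ≤ ENNReal.ofReal (A * dist (z i).2 (z l).2) := by
  classical
  rw [← ofReal_norm]
  refine ENNReal.ofReal_le_ofReal ?_
  unfold matchTerm
  split_ifs with hn
  · rw [norm_mul, Real.norm_eq_abs, abs_treatmentSign, one_mul, Real.norm_eq_abs]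
    exact h.g_lipschitz _ _ hi _ hl
  · have := h.A_pos
    rw [norm_zero]; positivity

theorem matchTerm_eq_zero {k : ℕ} {i l : Fin N} {z : Fin N → Fin 2 × EuclideanSpace ℝ (Fin d)}
    (hn : ¬ IsNeighbour k z i l) : matchTerm g k i l z = 0 := by
  unfold matchTerm; rw [if_neg hn]

theorem measurableSet_fewCloser_and (k : ℕ) (Q : Finset (Fin N)) (a a' : Fin 2)
    (x x' : EuclideanSpace ℝ (Fin d)) (r r' : ℝ) :
    MeasurableSet {z : Fin N → Fin 2 × EuclideanSpace ℝ (Fin d) |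
      FewCloser k Q z a x r ∧ FewCloser k Q z a' x' r'} :=
  ((measurableSet_fewCloser k Q).preimage
      (f := fun z => (z, (a, x, r))) (by fun_prop)).inter
    ((measurableSet_fewCloser k Q).preimage (f := fun z => (z, (a', x', r'))) (by fun_prop))

/-- The four named units are kept and the others resampled. The product is then nonzero only on two
counting events for the resampled units, whose joint probability supplies the exponentials, while
the Lipschitz bound on `g` supplies the distances. The weight `H` passes through because it sees
only the four units. -/
theorem RegularDesign.lintegral_matchTerm_mul_le (h : RegularDesign 𝒳 D A c g m)
    [IsProbabilityMeasure (designLaw m)] {k : ℕ} (hN : 8 ≤ N) (hk : 1 ≤ k) {ε : ℝ}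
    (hεd : ε ^ d = k / N) (i l j q : Fin N)
    {H : (Fin N → Fin 2 × EuclideanSpace ℝ (Fin d)) → ENNReal} (hH : Measurable H)
    (hHQ : ∀ z z', H (({i, l, j, q} : Finset (Fin N)).piecewise z z') = H z) :
    ∫⁻ z, H z * ‖matchTerm g k i l z * matchTerm g k j q z‖ₑ
        ∂(Measure.pi fun _ : Fin N => designLaw m) ≤
      ENNReal.ofReal (A ^ 2 * Real.exp 1) * ∫⁻ z, H z *
        (expKernel (tailRate c) ε 1 (z i).2 (z l).2 * expKernel (tailRate c) ε 1 (z j).2 (z q).2)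
        ∂(Measure.pi fun _ : Fin N => designLaw m) := by
  classical
  set Q : Finset (Fin N) := {i, l, j, q} with hQ
  have hQc : Q.card ≤ 4 := Finset.card_le_four
  have hmeas : Measurable fun z => H z * ‖matchTerm g k i l z * matchTerm g k j q z‖ₑ :=
    hH.mul ((measurable_matchTerm h.measurable_g k i l).mul
      (measurable_matchTerm h.measurable_g k j q)).enorm
  have hiQ : i ∈ Q := by simp [hQ]
  have hlQ : l ∈ Q := by simp [hQ]
  have hjQ : j ∈ Q := by simp [hQ]
  have hqQ : q ∈ Q := by simp [hQ]
  have hpw := measurePreserving_piecewise (designLaw m) Q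
  rw [← hpw.lintegral_comp hmeas,
    lintegral_prod _ (by exact (hmeas.comp hpw.measurable).aemeasurable),
    ← lintegral_const_mul']
  swap
  · exact ENNReal.ofReal_ne_top
  refine lintegral_mono_ae ((h.ae_pi_mem N).mono fun z hz => ?_)
  set u := dist (z i).2 (z l).2 with hu
  set v := dist (z j).2 (z q).2 with hv
  have hA := h.A_pos
  set S : Set (Fin N → Fin 2 × EuclideanSpace ℝ (Fin d)) :=
    {z' | FewCloser k Q z' (1 - (z i).1) (z i).2 u ∧ FewCloser k Q z' (1 - (z j).1) (z j).2 v}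
    with hS
  have hSm : MeasurableSet S := measurableSet_fewCloser_and k Q _ _ _ _ _ _
  have hpt : ∀ z', H (Q.piecewise z z') *
      ‖matchTerm g k i l (Q.piecewise z z') * matchTerm g k j q (Q.piecewise z z')‖ₑ ≤
      (H z * ENNReal.ofReal (A * u * (A * v))) * S.indicator 1 z' := by
    intro z'
    have ei : Q.piecewise z z' i = z i := Finset.piecewise_eq_of_mem _ _ _ hiQ
    have el : Q.piecewise z z' l = z l := Finset.piecewise_eq_of_mem _ _ _ hlQ
    have ej : Q.piecewise z z' j = z j := Finset.piecewise_eq_of_mem _ _ _ hjQ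
    have eq : Q.piecewise z z' q = z q := Finset.piecewise_eq_of_mem _ _ _ hqQ
    have hout : ∀ p, p ∉ Q → Q.piecewise z z' p = z' p := fun p hp =>
      Finset.piecewise_eq_of_notMem _ _ _ hp
    rw [hHQ, mul_assoc]
    refine mul_le_mul_right ?_ _
    by_cases hz' : z' ∈ S
    · rw [Set.indicator_of_mem hz', Pi.one_apply, mul_one, enorm_mul,
        ENNReal.ofReal_mul (by positivity)]
      have b1 := h.enorm_matchTerm_le k (i := i) (l := l) (z := Q.piecewise z z')
        (by rw [ei]; exact hz i) (by rw [el]; exact hz l)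
      have b2 := h.enorm_matchTerm_le k (i := j) (l := q) (z := Q.piecewise z z')
        (by rw [ej]; exact hz j) (by rw [eq]; exact hz q)
      rw [ei, el] at b1
      rw [ej, eq] at b2
      exact mul_le_mul' b1 b2
    · rw [Set.indicator_of_notMem hz', mul_zero]
      have hzero : matchTerm g k i l (Q.piecewise z z') * matchTerm g k j q (Q.piecewise z z') = 0 := by
        by_contra hne
        apply hz'
        have n1 : IsNeighbour k (Q.piecewise z z') i l := by
          by_contra hn; exact hne (by rw [matchTerm_eq_zero hn, zero_mul])
        have n2 : IsNeighbour k (Q.piecewise z z') j q := by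
          by_contra hn; exact hne (by rw [matchTerm_eq_zero hn, mul_zero])
        have f1 := n1.fewCloser hlQ
        have f2 := n2.fewCloser hqQ
        rw [fewCloser_congr hout, ei, el] at f1
        rw [fewCloser_congr hout, ej, eq] at f2
        exact ⟨f1, f2⟩
      rw [hzero, enorm_zero]
  refine (lintegral_mono hpt).trans ?_
  rw [lintegral_const_mul _ (measurable_one.indicator hSm), lintegral_indicator_one hSm]
  refine (mul_le_mul_right (h.measure_fewCloser_le hN hk hεd Q hQc _ _ (hz i) (hz j)
    dist_nonneg dist_nonneg (h.dist_le _ (hz i) _ (hz l)) (h.dist_le _ (hz j) _ (hz q))) _).trans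
    (le_of_eq ?_)
  unfold expKernel
  rw [← hu, ← hv, mul_assoc, ← ENNReal.ofReal_mul (by positivity),
    ← ENNReal.ofReal_mul (by positivity),
    mul_left_comm (ENNReal.ofReal (A ^ 2 * Real.exp 1)), ← ENNReal.ofReal_mul (by positivity)]
  congr 2
  ring

/-- Integrates out the unit `l`, on which `H` does not depend. The factor 2A bounds the density of
the covariate, a sum of two subdensities. -/
theorem RegularDesign.lintegral_mul_expKernel_le (h : RegularDesign 𝒳 D A c g m)
    [IsProbabilityMeasure (designLaw m)] {i l : Fin N} (hil : i ≠ l)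
    {H : (Fin N → Fin 2 × EuclideanSpace ℝ (Fin d)) → ENNReal} (hH : Measurable H)
    (hHl : ∀ z t, H (Function.update z l t) = H z) {θ ε κ : ℝ} {p : ℕ}
    (hκ : ∀ x : EuclideanSpace ℝ (Fin d), ∫⁻ y, expKernel θ ε p x y ≤ ENNReal.ofReal κ) :
    ∫⁻ z, H z * expKernel θ ε p (z i).2 (z l).2 ∂(Measure.pi fun _ : Fin N => designLaw m) ≤
      (∫⁻ z, H z ∂(Measure.pi fun _ : Fin N => designLaw m)) * ENNReal.ofReal (2 * A * κ) := by
  have hA := h.A_pos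
  refine lintegral_mul_kernel_le (designLaw m) l hH hHl
    (K := fun z t => expKernel θ ε p (z i).2 t.2) ?_ ?_ ?_
  · exact (measurable_expKernel θ ε p).comp (f := fun q : (Fin N → Fin 2 × EuclideanSpace ℝ (Fin d)) ×
      (Fin 2 × EuclideanSpace ℝ (Fin d)) => ((q.1 i).2, q.2.2)) (by fun_prop)
  · intro z t
    rw [Function.update_of_ne hil]
  · intro z
    have hm : Measurable fun y => expKernel θ ε p (z i).2 y :=
      (measurable_expKernel θ ε p).comp (f := fun y => ((z i).2, y)) (by fun_prop)
    refine (h.lintegral_snd_le hm).trans ?_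
    rw [ENNReal.ofReal_mul (p := 2 * A) (by positivity)]
    exact mul_le_mul_right (hκ _) _

theorem measurable_expKernel_pair (θ ε : ℝ) (p : ℕ) (i l : Fin N) :
    Measurable fun z : Fin N → Fin 2 × EuclideanSpace ℝ (Fin d) =>
      expKernel θ ε p (z i).2 (z l).2 :=
  (measurable_expKernel θ ε p).comp (f := fun z : Fin N → Fin 2 × EuclideanSpace ℝ (Fin d) =>
    ((z i).2, (z l).2)) (by fun_prop)

theorem RegularDesign.lintegral_expKernel_le (h : RegularDesign 𝒳 D A c g m)
    [IsProbabilityMeasure (designLaw m)] {i l : Fin N} (hil : i ≠ l) {θ ε κ : ℝ} {p : ℕ}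
    (hκ : ∀ x : EuclideanSpace ℝ (Fin d), ∫⁻ y, expKernel θ ε p x y ≤ ENNReal.ofReal κ) :
    ∫⁻ z, expKernel θ ε p (z i).2 (z l).2 ∂(Measure.pi fun _ : Fin N => designLaw m) ≤
      ENNReal.ofReal (2 * A * κ) := by
  have := h.lintegral_mul_expKernel_le hil measurable_one (fun _ _ => rfl) hκ
  simpa using this

theorem RegularDesign.lintegral_expKernel_mul_le (h : RegularDesign 𝒳 D A c g m)
    [IsProbabilityMeasure (designLaw m)] {i l j q : Fin N} (hil : i ≠ l) (hjq : j ≠ q)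
    (hlj : l ≠ j) (hlq : l ≠ q) {θ ε κ : ℝ} {p : ℕ} (hκ0 : 0 ≤ κ)
    (hκ : ∀ x : EuclideanSpace ℝ (Fin d), ∫⁻ y, expKernel θ ε p x y ≤ ENNReal.ofReal κ) :
    ∫⁻ z, expKernel θ ε p (z i).2 (z l).2 * expKernel θ ε p (z j).2 (z q).2
        ∂(Measure.pi fun _ : Fin N => designLaw m) ≤ ENNReal.ofReal ((2 * A * κ) ^ 2) := by
  have hA := h.A_pos
  have h1 := h.lintegral_mul_expKernel_le hil (measurable_expKernel_pair θ ε p j q)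
    (fun z t => by rw [Function.update_of_ne hlj.symm, Function.update_of_ne hlq.symm]) hκ
  have e : ∀ z : Fin N → Fin 2 × EuclideanSpace ℝ (Fin d),
      expKernel θ ε p (z i).2 (z l).2 * expKernel θ ε p (z j).2 (z q).2 =
      expKernel θ ε p (z j).2 (z q).2 * expKernel θ ε p (z i).2 (z l).2 := fun z => mul_comm _ _
  simp only [e]
  refine h1.trans ?_
  rw [sq, ENNReal.ofReal_mul (p := 2 * A * κ) (by positivity)]
  exact mul_le_mul_left (h.lintegral_expKernel_le hjq hκ) _

/-- The unordered pairs {i,l} and {j,q} differ, so one of `i`, `l` lies outside {j,q} and occurs in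
one kernel only. It is integrated out first; the symmetry of the kernel makes it irrelevant which of
the two it is. -/
theorem exists_lintegral_matchTerm_mul_le (hd : 1 ≤ d) (hA : 0 < A) (hc : 0 < c) :
    ∃ C : ℝ, 0 < C ∧ ∀ (𝒳 : Set (EuclideanSpace ℝ (Fin d)))
      (g m : Fin 2 → EuclideanSpace ℝ (Fin d) → ℝ), RegularDesign 𝒳 D A c g m →
      ∀ [IsProbabilityMeasure (designLaw m)] (N k : ℕ), 8 ≤ N → 1 ≤ k → ∀ ε : ℝ, 0 < ε →
      ε ^ d = k / N → ∀ i l j q : Fin N, i ≠ l → j ≠ q → ¬ (i = j ∧ l = q) → ¬ (i = q ∧ l = j) →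
      ∫⁻ z, ‖matchTerm g k i l z * matchTerm g k j q z‖ₑ
        ∂(Measure.pi fun _ : Fin N => designLaw m) ≤ ENNReal.ofReal (C * (ε ^ (d + 1)) ^ 2) := by
  obtain ⟨C, hC, hCb⟩ := exists_lintegral_expKernel_le hd (tailRate_pos hc) 1
  refine ⟨A ^ 2 * Real.exp 1 * (2 * A * C) ^ 2, by positivity, ?_⟩
  intro 𝒳 g m h _ N k hN hk ε hε hεd i l j q hil hjq hne hne'
  have h1 := h.lintegral_matchTerm_mul_le hN hk hεd i l j q measurable_one (fun _ _ => rfl)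
  simp only [Pi.one_apply, one_mul] at h1
  have hκ0 : 0 ≤ C * ε ^ (d + 1) := by positivity
  have hκ : ∀ x : EuclideanSpace ℝ (Fin d), ∫⁻ y, expKernel (tailRate c) ε 1 x y ≤
    ENNReal.ofReal (C * ε ^ (d + 1)) := fun x => hCb ε hε x
  have h2 : ∫⁻ z, expKernel (tailRate c) ε 1 (z i).2 (z l).2 *
      expKernel (tailRate c) ε 1 (z j).2 (z q).2 ∂(Measure.pi fun _ : Fin N => designLaw m) ≤
      ENNReal.ofReal ((2 * A * (C * ε ^ (d + 1))) ^ 2) := by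
    by_cases hl : l ≠ j ∧ l ≠ q
    · exact h.lintegral_expKernel_mul_le hil hjq hl.1 hl.2 hκ0 hκ
    · have hi : i ≠ j ∧ i ≠ q := by
        constructor
        · rintro rfl
          by_cases hlq : l = q
          · exact hne ⟨rfl, hlq⟩
          · exact hl ⟨hil.symm, hlq⟩
        · rintro rfl
          by_cases hlj : l = j
          · exact hne' ⟨rfl, hlj⟩
          · exact hl ⟨hlj, hil.symm⟩
      have := h.lintegral_expKernel_mul_le hil.symm hjq hi.1 hi.2 hκ0 hκ
      refine le_trans (le_of_eq (lintegral_congr fun z => ?_)) this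
      rw [expKernel_comm _ _ _ (z i).2 (z l).2]
  refine h1.trans ((mul_le_mul_right h2 _).trans (le_of_eq ?_))
  rw [← ENNReal.ofReal_mul (by positivity)]
  congr 1
  ring

/-- For one and the same unordered pair the two kernels multiply to a single kernel with squared
distance and doubled rate, so there is only one integration and one factor ε^d. -/
theorem exists_lintegral_matchTerm_sq_le (hd : 1 ≤ d) (hA : 0 < A) (hc : 0 < c) :
    ∃ C : ℝ, 0 < C ∧ ∀ (𝒳 : Set (EuclideanSpace ℝ (Fin d)))
      (g m : Fin 2 → EuclideanSpace ℝ (Fin d) → ℝ), RegularDesign 𝒳 D A c g m →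
      ∀ [IsProbabilityMeasure (designLaw m)] (N k : ℕ), 8 ≤ N → 1 ≤ k → ∀ ε : ℝ, 0 < ε →
      ε ^ d = k / N → ∀ i l j q : Fin N, i ≠ l → (i = j ∧ l = q) ∨ (i = q ∧ l = j) →
      ∫⁻ z, ‖matchTerm g k i l z * matchTerm g k j q z‖ₑ
        ∂(Measure.pi fun _ : Fin N => designLaw m) ≤ ENNReal.ofReal (C * ε ^ (d + 2)) := by
  obtain ⟨C, hC, hCb⟩ := exists_lintegral_expKernel_le hd
    (mul_pos two_pos (tailRate_pos hc)) 2
  refine ⟨A ^ 2 * Real.exp 1 * (2 * A * C), by positivity, ?_⟩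
  intro 𝒳 g m h _ N k hN hk ε hε hεd i l j q hil heq
  have h1 := h.lintegral_matchTerm_mul_le hN hk hεd i l j q measurable_one (fun _ _ => rfl)
  simp only [Pi.one_apply, one_mul] at h1
  have e : ∀ z : Fin N → Fin 2 × EuclideanSpace ℝ (Fin d),
      expKernel (tailRate c) ε 1 (z i).2 (z l).2 * expKernel (tailRate c) ε 1 (z j).2 (z q).2 =
      expKernel (2 * tailRate c) ε 2 (z i).2 (z l).2 := by
    intro z
    have : expKernel (tailRate c) ε 1 (z j).2 (z q).2 = expKernel (tailRate c) ε 1 (z i).2 (z l).2 := by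
      rcases heq with ⟨rfl, rfl⟩ | ⟨rfl, rfl⟩
      · rfl
      · rw [expKernel_comm]
    rw [this]
    unfold expKernel
    rw [← ENNReal.ofReal_mul (by positivity)]
    congr 1
    rw [mul_mul_mul_comm, ← Real.exp_add]
    ring_nf
  simp only [e] at h1
  refine h1.trans ((mul_le_mul_right (h.lintegral_expKernel_le hil
    (fun x => hCb ε hε x)) _).trans (le_of_eq ?_))
  rw [← ENNReal.ofReal_mul (by positivity)]
  congr 1
  ring

/-- The matches `l` of `i` and `q` of `j` lie in disjoint balls around `i` and `j`. -/
def Separated (z : Fin N → Fin 2 × EuclideanSpace ℝ (Fin d)) (i l j q : Fin N) : Prop :=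
  2 * dist (z i).2 (z l).2 < dist (z i).2 (z j).2 ∧ 2 * dist (z j).2 (z q).2 < dist (z i).2 (z j).2

theorem measurableSet_separated (i l j q : Fin N) :
    MeasurableSet {z : Fin N → Fin 2 × EuclideanSpace ℝ (Fin d) | Separated z i l j q} :=
  (measurableSet_lt (f := fun z : Fin N → Fin 2 × EuclideanSpace ℝ (Fin d) =>
      2 * dist (z i).2 (z l).2) (g := fun z => dist (z i).2 (z j).2) (by fun_prop)
      (by fun_prop)).inter
    (measurableSet_lt (f := fun z : Fin N → Fin 2 × EuclideanSpace ℝ (Fin d) =>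
      2 * dist (z j).2 (z q).2) (g := fun z => dist (z i).2 (z j).2) (by fun_prop) (by fun_prop))

/-- Half of each exponent is kept. The other half, at whichever of `u`, `v` is at least w/2,
dominates the exponent at `w`; the factor 2^d is homogeneity. -/
theorem exp_mul_exp_le_of_le {θ ε u v w : ℝ} (hθ : 0 ≤ θ) (hε : 0 < ε) (hu : 0 ≤ u) (hv : 0 ≤ v)
    (hw : 0 ≤ w) (h : w ≤ 2 * u ∨ w ≤ 2 * v) :
    Real.exp (-(θ * (u / ε) ^ d)) * Real.exp (-(θ * (v / ε) ^ d)) ≤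
      Real.exp (-(θ / 2 * (u / ε) ^ d)) * Real.exp (-(θ / 2 * (v / ε) ^ d)) *
        Real.exp (-(θ / 2 / 2 ^ d * (w / ε) ^ d)) := by
  rw [← Real.exp_add, ← Real.exp_add, ← Real.exp_add, Real.exp_le_exp]
  have hu' : 0 ≤ θ / 2 * (u / ε) ^ d := by positivity
  have hv' : 0 ≤ θ / 2 * (v / ε) ^ d := by positivity
  have key : ∀ t : ℝ, w ≤ 2 * t → θ / 2 / 2 ^ d * (w / ε) ^ d ≤ θ / 2 * (t / ε) ^ d := by
    intro t ht
    rw [div_mul_eq_mul_div, div_le_iff₀ (by positivity), mul_assoc, ← mul_pow]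
    have : w / ε ≤ t / ε * 2 := by rw [div_mul_eq_mul_div]; gcongr; linarith
    gcongr
  rcases h with h | h
  · have := key u h; linarith
  · have := key v h; linarith

/-- Without separation |X_i − X_j| is at most twice one of the match distances, so part of the
exponential decay can be spent on confining X_j to distance of order ε from X_i. Integrating over
X_j then yields the extra factor ε^d. -/
theorem exists_lintegral_matchTerm_not_separated_le (hd : 1 ≤ d) (hA : 0 < A) (hc : 0 < c) :
    ∃ C : ℝ, 0 < C ∧ ∀ (𝒳 : Set (EuclideanSpace ℝ (Fin d)))
      (g m : Fin 2 → EuclideanSpace ℝ (Fin d) → ℝ), RegularDesign 𝒳 D A c g m →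
      ∀ [IsProbabilityMeasure (designLaw m)] (N k : ℕ), 8 ≤ N → 1 ≤ k → ∀ ε : ℝ, 0 < ε →
      ε ^ d = k / N → ∀ i l j q : Fin N, i ≠ l → j ≠ q → i ≠ j → i ≠ q → l ≠ j → l ≠ q →
      ∫⁻ z in {z | Separated z i l j q}ᶜ, ‖matchTerm g k i l z * matchTerm g k j q z‖ₑ
        ∂(Measure.pi fun _ : Fin N => designLaw m) ≤
        ENNReal.ofReal (C * (ε ^ (d + 1) * ε ^ (d + 1) * ε ^ d)) := by
  have hθ := tailRate_pos hc
  obtain ⟨C, hC, hCb⟩ := exists_lintegral_expKernel_le hd (half_pos hθ) 1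
  obtain ⟨C', hC', hCb'⟩ := exists_lintegral_expKernel_le hd
    (div_pos (half_pos hθ) (pow_pos two_pos d)) 0
  refine ⟨A ^ 2 * Real.exp 1 * ((2 * A * C) * (2 * A * C) * (2 * A * C')), by positivity, ?_⟩
  intro 𝒳 g m h _ N k hN hk ε hε hεd i l j q hil hjq hij hiq hlj hlq
  set P := Measure.pi fun _ : Fin N => designLaw m with hP
  have hSm : MeasurableSet {z : Fin N → Fin 2 × EuclideanSpace ℝ (Fin d) | Separated z i l j q}ᶜ :=
    (measurableSet_separated i l j q).compl
  set T := {z : Fin N → Fin 2 × EuclideanSpace ℝ (Fin d) | Separated z i l j q}ᶜ with hT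
  rw [← lintegral_indicator hSm]
  have e1 : ∀ z, T.indicator (fun z => ‖matchTerm g k i l z * matchTerm g k j q z‖ₑ) z =
      T.indicator 1 z * ‖matchTerm g k i l z * matchTerm g k j q z‖ₑ := fun z => by
    by_cases hz : z ∈ T <;> simp [hz]
  simp only [e1]
  have hHQ : ∀ z z', T.indicator (1 : (Fin N → Fin 2 × EuclideanSpace ℝ (Fin d)) → ENNReal)
      (({i, l, j, q} : Finset (Fin N)).piecewise z z') = T.indicator 1 z := by
    intro z z'
    have : ({i, l, j, q} : Finset (Fin N)).piecewise z z' ∈ T ↔ z ∈ T := by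
      simp [hT, Separated]
    by_cases hz : z ∈ T
    · rw [Set.indicator_of_mem hz, Set.indicator_of_mem (this.mpr hz)]; rfl
    · rw [Set.indicator_of_notMem hz, Set.indicator_of_notMem (fun h => hz (this.mp h))]
  refine (h.lintegral_matchTerm_mul_le hN hk hεd i l j q (measurable_one.indicator hSm)
    hHQ).trans ?_
  set θ := tailRate c with hθdef
  have hpt : ∀ z, T.indicator 1 z *
      (expKernel θ ε 1 (z i).2 (z l).2 * expKernel θ ε 1 (z j).2 (z q).2) ≤
      (expKernel (θ / 2 / 2 ^ d) ε 0 (z i).2 (z j).2 * expKernel (θ / 2) ε 1 (z j).2 (z q).2) *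
        expKernel (θ / 2) ε 1 (z i).2 (z l).2 := by
    intro z
    by_cases hz : z ∈ T
    · rw [Set.indicator_of_mem hz, Pi.one_apply, one_mul]
      unfold expKernel
      rw [← ENNReal.ofReal_mul (by positivity), ← ENNReal.ofReal_mul (by positivity),
        ← ENNReal.ofReal_mul (by positivity)]
      refine ENNReal.ofReal_le_ofReal ?_
      have hor : dist (z i).2 (z j).2 ≤ 2 * dist (z i).2 (z l).2 ∨
          dist (z i).2 (z j).2 ≤ 2 * dist (z j).2 (z q).2 := by
        by_contra hcon
        rw [not_or, not_le, not_le] at hcon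
        exact hz hcon
      have := exp_mul_exp_le_of_le (d := d) hθ.le hε (dist_nonneg (x := (z i).2) (y := (z l).2))
        (dist_nonneg (x := (z j).2) (y := (z q).2)) (dist_nonneg (x := (z i).2) (y := (z j).2)) hor
      have hm := mul_le_mul_of_nonneg_left this
        (mul_nonneg (dist_nonneg (x := (z i).2) (y := (z l).2))
          (dist_nonneg (x := (z j).2) (y := (z q).2)))
      calc _ = _ := by ring
        _ ≤ _ := hm
        _ = _ := by ring
    · rw [Set.indicator_of_notMem hz, zero_mul]; exact zero_le
  have hκ : ∀ x : EuclideanSpace ℝ (Fin d), ∫⁻ y, expKernel (θ / 2) ε 1 x y ≤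
    ENNReal.ofReal (C * ε ^ (d + 1)) := fun x => hCb ε hε x
  have hκ' : ∀ x : EuclideanSpace ℝ (Fin d), ∫⁻ y, expKernel (θ / 2 / 2 ^ d) ε 0 x y ≤
    ENNReal.ofReal (C' * ε ^ d) := fun x => hCb' ε hε x
  -- Units are integrated out in the order l, q, j, so that each occurs in exactly one of the
  -- kernels still present.
  have s1 := h.lintegral_mul_expKernel_le hil
    ((measurable_expKernel_pair (θ / 2 / 2 ^ d) ε 0 i j).mul
      (measurable_expKernel_pair (θ / 2) ε 1 j q))
    (fun z t => by
      simp only [Pi.mul_apply, Function.update_of_ne hil, Function.update_of_ne hlj.symm,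
        Function.update_of_ne hlq.symm]) hκ
  have s2 := h.lintegral_mul_expKernel_le hjq (measurable_expKernel_pair (θ / 2 / 2 ^ d) ε 0 i j)
    (fun z t => by
      simp only [Function.update_of_ne hiq, Function.update_of_ne hjq]) hκ
  have s3 := h.lintegral_expKernel_le hij hκ'
  calc _ ≤ ENNReal.ofReal (A ^ 2 * Real.exp 1) * (ENNReal.ofReal (2 * A * (C' * ε ^ d)) *
        ENNReal.ofReal (2 * A * (C * ε ^ (d + 1))) * ENNReal.ofReal (2 * A * (C * ε ^ (d + 1)))) := by
        refine mul_le_mul_right ((lintegral_mono hpt).trans (s1.trans ?_)) _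
        refine mul_le_mul_left (s2.trans ?_) _
        exact mul_le_mul_left s3 _
    _ = _ := by
        rw [← ENNReal.ofReal_mul (by positivity), ← ENNReal.ofReal_mul (by positivity),
          ← ENNReal.ofReal_mul (by positivity)]
        congr 1
        ring

end FourPoints

/-! ### Reflection symmetry of separated matches -/

section Reflection

variable {d N : ℕ}

theorem dist_reflection (x y : EuclideanSpace ℝ (Fin d)) : dist x (x + x - y) = dist x y := by
  rw [dist_comm x y, dist_eq_norm, dist_eq_norm]
  congr 1; abel

theorem integral_eq_zero_of_reflection {f : EuclideanSpace ℝ (Fin d) → ℝ}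
    (x : EuclideanSpace ℝ (Fin d)) (h : ∀ y, f (x + x - y) = -f y) : ∫ y, f y = 0 := by
  have h1 := integral_sub_left_eq_self f volume (x + x)
  simp only [h, integral_neg] at h1
  linarith

/-- An odd function integrates to zero against the even weight `χ`, so `D₂` may be replaced by `e₂`,
and then, after exchanging the integrals, `D₁` by `e₁`. -/
theorem integral_mul_integral_eq_of_reflection
    {χ : EuclideanSpace ℝ (Fin d) → EuclideanSpace ℝ (Fin d) → ℝ}
    (hχ : Measurable (Function.uncurry χ)) (hχ1 : ∀ y y', ‖χ y y'‖ ≤ 1)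
    {D₁ e₁ D₂ e₂ : EuclideanSpace ℝ (Fin d) → ℝ} (hD₁ : Integrable D₁) (he₁ : Integrable e₁)
    (hD₂ : Integrable D₂) (he₂ : Integrable e₂) {x x' : EuclideanSpace ℝ (Fin d)}
    (ho₁ : ∀ y, D₁ (x + x - y) - e₁ (x + x - y) = -(D₁ y - e₁ y))
    (ho₂ : ∀ y, D₂ (x' + x' - y) - e₂ (x' + x' - y) = -(D₂ y - e₂ y))
    (hs₁ : ∀ y y', χ (x + x - y) y' = χ y y') (hs₂ : ∀ y y', χ y (x' + x' - y') = χ y y') :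
    ∫ y, D₁ y * ∫ y', χ y y' * D₂ y' = ∫ y, e₁ y * ∫ y', χ y y' * e₂ y' := by
  have int2 : ∀ {F : EuclideanSpace ℝ (Fin d) → ℝ}, Integrable F → ∀ y,
      Integrable fun y' => χ y y' * F y' := fun hF y =>
    hF.bdd_mul (c := 1) (hχ.comp (measurable_const.prodMk measurable_id)).aestronglyMeasurable
      (Filter.Eventually.of_forall fun y' => hχ1 y y')
  have int1 : ∀ {F : EuclideanSpace ℝ (Fin d) → ℝ}, Integrable F → ∀ y',
      Integrable fun y => χ y y' * F y := fun hF y' =>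
    hF.bdd_mul (c := 1) (hχ.comp (measurable_id.prodMk measurable_const)).aestronglyMeasurable
      (Filter.Eventually.of_forall fun y => hχ1 y y')
  have A2 : ∀ y, ∫ y', χ y y' * D₂ y' = ∫ y', χ y y' * e₂ y' := fun y => by
    have h0 := integral_eq_zero_of_reflection (f := fun y' => χ y y' * D₂ y' - χ y y' * e₂ y') x'
      (fun y' => by rw [hs₂, ← mul_sub, ho₂]; ring)
    rw [integral_sub (int2 hD₂ y) (int2 he₂ y)] at h0
    linarith
  have A1 : ∀ y', ∫ y, χ y y' * D₁ y = ∫ y, χ y y' * e₁ y := fun y' => by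
    have h0 := integral_eq_zero_of_reflection (f := fun y => χ y y' * D₁ y - χ y y' * e₁ y) x
      (fun y => by rw [hs₁, ← mul_sub, ho₁]; ring)
    rw [integral_sub (int1 hD₁ y') (int1 he₁ y')] at h0
    linarith
  have swap : ∀ {F G : EuclideanSpace ℝ (Fin d) → ℝ}, Integrable F → Integrable G →
      ∫ y, F y * ∫ y', χ y y' * G y' = ∫ y', G y' * ∫ y, χ y y' * F y := by
    intro F G hF hG
    have hprod : Integrable (Function.uncurry fun y y' => χ y y' * (F y * G y'))
        (volume.prod volume) :=
      (hF.mul_prod hG).bdd_mul (c := 1) hχ.aestronglyMeasurable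
        (Filter.Eventually.of_forall fun p => hχ1 p.1 p.2)
    have hsw := integral_integral_swap hprod
    calc _ = ∫ y, ∫ y', χ y y' * (F y * G y') := by
          refine integral_congr_ae (Filter.Eventually.of_forall fun y => ?_)
          simp only
          rw [← integral_const_mul]
          exact integral_congr_ae (Filter.Eventually.of_forall fun y' => by simp only; ring)
      _ = _ := hsw
      _ = _ := by
          refine integral_congr_ae (Filter.Eventually.of_forall fun y' => ?_)
          simp only
          rw [← integral_const_mul]
          exact integral_congr_ae (Filter.Eventually.of_forall fun y => by simp only; ring)
  simp only [A2]
  rw [swap hD₁ he₂]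
  simp only [A1]
  rw [← swap he₁ he₂]

theorem isNeighbour_congr {k : ℕ} {z z' : Fin N → Fin 2 × EuclideanSpace ℝ (Fin d)} {i l : Fin N}
    (hw : ∀ p, (z p).1 = (z' p).1)
    (hd : ∀ p, (dist (z p).2 (z i).2 < dist (z l).2 (z i).2 ∨
        (dist (z p).2 (z i).2 = dist (z l).2 (z i).2 ∧ p ≤ l)) ↔
      (dist (z' p).2 (z' i).2 < dist (z' l).2 (z' i).2 ∨
        (dist (z' p).2 (z' i).2 = dist (z' l).2 (z' i).2 ∧ p ≤ l))) :
    IsNeighbour k z i l ↔ IsNeighbour k z' i l := by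
  unfold IsNeighbour neighbourRank
  simp only [hd, hw]

/-- `l` is a match of `i`, `q` is a match of `j`, and the balls around `i` and `j` reaching to these
matches are disjoint. -/
def SeparatedMatches (k : ℕ) (z : Fin N → Fin 2 × EuclideanSpace ℝ (Fin d)) (i l j q : Fin N) :
    Prop :=
  IsNeighbour k z i l ∧ IsNeighbour k z j q ∧ Separated z i l j q

theorem separatedMatches_comm {k : ℕ} {z : Fin N → Fin 2 × EuclideanSpace ℝ (Fin d)}
    {i l j q : Fin N} : SeparatedMatches k z i l j q ↔ SeparatedMatches k z j q i l := by
  unfold SeparatedMatches Separated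
  rw [dist_comm (z j).2 (z i).2]
  tauto

theorem measurableSet_separatedMatches (k : ℕ) (i l j q : Fin N) :
    MeasurableSet {z : Fin N → Fin 2 × EuclideanSpace ℝ (Fin d) |
      SeparatedMatches k z i l j q} :=
  (measurableSet_isNeighbour k i l).inter
    ((measurableSet_isNeighbour k j q).inter (measurableSet_separated i l j q))

/-- Moving X_l on a sphere around X_i leaves every comparison in the list of `i` unchanged. Before
and after the move X_l is farther than half of |X_i − X_j| from X_j, hence farther than the match
`q`, so it never counts in the rank of `q`. -/
theorem SeparatedMatches.update {k : ℕ} {z : Fin N → Fin 2 × EuclideanSpace ℝ (Fin d)}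
    {i l j q : Fin N} (hil : i ≠ l) (hjl : j ≠ l) (hql : q ≠ l) {w : Fin 2}
    {y y' : EuclideanSpace ℝ (Fin d)} (hy : dist (z i).2 y' = dist (z i).2 y)
    (h : SeparatedMatches k (Function.update z l (w, y)) i l j q) :
    SeparatedMatches k (Function.update z l (w, y')) i l j q := by
  obtain ⟨h1, h2, h3, h4⟩ := h
  simp only [Function.update_self, Function.update_of_ne hil, Function.update_of_ne hjl,
    Function.update_of_ne hql] at h3 h4
  have hw : ∀ p, (Function.update z l (w, y) p).1 = (Function.update z l (w, y') p).1 := by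
    intro p
    by_cases hp : p = l
    · subst hp; simp
    · simp [hp]
  refine ⟨(isNeighbour_congr hw ?_).mp h1, (isNeighbour_congr hw ?_).mp h2, ?_, ?_⟩
  · intro p
    by_cases hp : p = l
    · subst hp; simp
    · simp only [Function.update_self, Function.update_of_ne hil, Function.update_of_ne hp]
      rw [dist_comm y, dist_comm y', hy]
  · intro p
    by_cases hp : p = l
    · subst hp
      simp only [Function.update_self, Function.update_of_ne hjl, Function.update_of_ne hql]
      -- The inequalities obtained are strict, so no tie with `q` can arise and the index order
      -- plays no role.
      have t1 := dist_triangle (z i).2 y (z j).2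
      have t2 := dist_triangle (z i).2 y' (z j).2
      rw [dist_comm (z q).2]
      have a1 : dist (z j).2 (z q).2 < dist y (z j).2 := by linarith
      have a2 : dist (z j).2 (z q).2 < dist y' (z j).2 := by linarith
      simp [a1.not_gt, a2.not_gt, a1.ne', a2.ne']
    · simp only [Function.update_of_ne hjl, Function.update_of_ne hql, Function.update_of_ne hp]
  · simpa only [Function.update_self, Function.update_of_ne hil, Function.update_of_ne hjl, hy]
      using h3
  · simpa only [Function.update_of_ne hil, Function.update_of_ne hjl,
      Function.update_of_ne hql] using h4

theorem separatedMatches_reflection {k : ℕ} {z : Fin N → Fin 2 × EuclideanSpace ℝ (Fin d)}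
    {i l j q : Fin N} (hil : i ≠ l) (hjl : j ≠ l) (hql : q ≠ l) {w : Fin 2}
    (y : EuclideanSpace ℝ (Fin d)) :
    SeparatedMatches k (Function.update z l (w, (z i).2 + (z i).2 - y)) i l j q ↔
      SeparatedMatches k (Function.update z l (w, y)) i l j q := by
  have hy := dist_reflection (z i).2 y
  exact ⟨SeparatedMatches.update hil hjl hql hy.symm, SeparatedMatches.update hil hjl hql hy⟩

end Reflection

/-! ### Cancellation of the first-order terms -/

section SeparatedPairs

variable {d N : ℕ} {𝒳 : Set (EuclideanSpace ℝ (Fin d))} {D A c : ℝ}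
  {g m : Fin 2 → EuclideanSpace ℝ (Fin d) → ℝ}

/-- The order of the even part of `(g x - g y) * m y` under the reflection of `y` in `x`. -/
noncomputable def evenError (𝒳 : Set (EuclideanSpace ℝ (Fin d))) (x y : EuclideanSpace ℝ (Fin d)) :
    ℝ :=
  dist x y ^ 2 + {y | Metric.infDist x 𝒳ᶜ ≤ dist x y}.indicator (fun y => dist x y) y

theorem evenError_nonneg (x y : EuclideanSpace ℝ (Fin d)) : 0 ≤ evenError 𝒳 x y := by
  unfold evenError
  have : 0 ≤ {y | Metric.infDist x 𝒳ᶜ ≤ dist x y}.indicator (fun y => dist x y) y :=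
    Set.indicator_nonneg (fun _ _ => dist_nonneg) _
  positivity

theorem measurable_evenError (𝒳 : Set (EuclideanSpace ℝ (Fin d))) :
    Measurable fun p : EuclideanSpace ℝ (Fin d) × EuclideanSpace ℝ (Fin d) =>
      evenError 𝒳 p.1 p.2 := by
  have hs : MeasurableSet {p : EuclideanSpace ℝ (Fin d) × EuclideanSpace ℝ (Fin d) |
      Metric.infDist p.1 𝒳ᶜ ≤ dist p.1 p.2} :=
    measurableSet_le ((Metric.continuous_infDist_pt _).measurable.comp measurable_fst)
      (by fun_prop)
  unfold evenError
  refine Measurable.add (by fun_prop) ?_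
  exact Measurable.indicator (f := fun p : EuclideanSpace ℝ (Fin d) × EuclideanSpace ℝ (Fin d) =>
    dist p.1 p.2) (by fun_prop) hs

theorem measurable_evenError_right (𝒳 : Set (EuclideanSpace ℝ (Fin d)))
    (x : EuclideanSpace ℝ (Fin d)) : Measurable (evenError 𝒳 x) := by
  have h : Measurable fun y : EuclideanSpace ℝ (Fin d) => dist x y := by fun_prop
  exact (h.pow_const 2).add (h.indicator (measurableSet_le measurable_const h))

/-- For `y` in 𝒳 this is the Taylor remainder plus the linear term times an increment of the
Lipschitz density, both quadratic. For `y` outside, the density vanishes and the linear term is left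
alone, but then `y` is at least as far from `x` as the complement of 𝒳. -/
theorem RegularDesign.abs_add_le_evenError (h : RegularDesign 𝒳 D A c g m) (a : Fin 2)
    {x : EuclideanSpace ℝ (Fin d)} (hx : x ∈ 𝒳) {L : EuclideanSpace ℝ (Fin d) →L[ℝ] ℝ}
    (hL : ‖L‖ ≤ A) (hLt : ∀ y ∈ 𝒳, |g a y - g a x - L (y - x)| ≤ A * dist x y ^ 2)
    (y : EuclideanSpace ℝ (Fin d)) :
    |m a y * (g a x - g a y) + L (y - x) * m a x| ≤ 2 * A ^ 2 * evenError 𝒳 x y := by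
  have hA := h.A_pos
  have hLy : |L (y - x)| ≤ A * dist x y := by
    rw [dist_comm, dist_eq_norm]
    exact (L.le_opNorm _).trans (by gcongr)
  have hind : 0 ≤ {y | Metric.infDist x 𝒳ᶜ ≤ dist x y}.indicator (fun y => dist x y) y :=
    Set.indicator_nonneg (fun _ _ => dist_nonneg) _
  have hmx : |m a x| ≤ A := by rw [abs_of_nonneg (h.m_nonneg _ _)]; exact h.m_le _ _
  have hmy : |m a y| ≤ A := by rw [abs_of_nonneg (h.m_nonneg _ _)]; exact h.m_le _ _
  by_cases hy : y ∈ 𝒳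
  · have e : m a y * (g a x - g a y) + L (y - x) * m a x =
        -(m a y * (g a y - g a x - L (y - x))) + L (y - x) * (m a x - m a y) := by ring
    rw [e]
    have h1 : |m a y * (g a y - g a x - L (y - x))| ≤ A * (A * dist x y ^ 2) := by
      rw [abs_mul]
      exact mul_le_mul hmy (hLt y hy) (abs_nonneg _) hA.le
    have h2 : |L (y - x) * (m a x - m a y)| ≤ (A * dist x y) * (A * dist x y) := by
      rw [abs_mul]
      exact mul_le_mul hLy (h.m_lipschitz a x hx y hy) (abs_nonneg _) (by positivity)
    refine (abs_add_le _ _).trans ?_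
    rw [abs_neg]
    unfold evenError
    have h3 : 0 ≤ A ^ 2 *
      {y | Metric.infDist x 𝒳ᶜ ≤ dist x y}.indicator (fun y => dist x y) y := by positivity
    linarith
  · rw [h.m_eq_zero a y hy, zero_mul, zero_add, abs_mul]
    have hmem : Metric.infDist x 𝒳ᶜ ≤ dist x y := Metric.infDist_le_dist_of_mem hy
    unfold evenError
    rw [Set.indicator_of_mem (by exact hmem)]
    have h1 : |L (y - x)| * |m a x| ≤ A * dist x y * A :=
      mul_le_mul hLy hmx (abs_nonneg _) (by positivity)
    have h2 : 0 ≤ A ^ 2 * dist x y ^ 2 := by positivity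
    have h3 : 0 ≤ A ^ 2 * dist x y := by positivity
    linarith

theorem RegularDesign.abs_matchTerm_le (h : RegularDesign 𝒳 D A c g m) (k : ℕ) (i l : Fin N)
    (z : Fin N → Fin 2 × EuclideanSpace ℝ (Fin d)) : |matchTerm g k i l z| ≤ 2 * A := by
  unfold matchTerm
  have hA := h.A_pos
  split_ifs
  · rw [abs_mul, abs_treatmentSign, one_mul]
    have := abs_sub (g (1 - (z i).1) (z i).2) (g (1 - (z i).1) (z l).2)
    linarith [h.abs_g_le (1 - (z i).1) (z i).2, h.abs_g_le (1 - (z i).1) (z l).2]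
  · rw [abs_zero]; positivity

/-- The product of the contributions of two separated matches. -/
noncomputable def separatedTerm (g : Fin 2 → EuclideanSpace ℝ (Fin d) → ℝ) (k : ℕ)
    (i l j q : Fin N) (z : Fin N → Fin 2 × EuclideanSpace ℝ (Fin d)) : ℝ :=
  {z | Separated z i l j q}.indicator (fun z => matchTerm g k i l z * matchTerm g k j q z) z

theorem measurable_separatedTerm (h : RegularDesign 𝒳 D A c g m) (k : ℕ) (i l j q : Fin N) :
    Measurable (separatedTerm g k i l j q) :=
  ((measurable_matchTerm h.measurable_g k i l).mul
    (measurable_matchTerm h.measurable_g k j q)).indicator (measurableSet_separated i l j q)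

theorem RegularDesign.abs_separatedTerm_le (h : RegularDesign 𝒳 D A c g m) (k : ℕ)
    (i l j q : Fin N) (z : Fin N → Fin 2 × EuclideanSpace ℝ (Fin d)) :
    |separatedTerm g k i l j q z| ≤ (2 * A) ^ 2 := by
  have hA := h.A_pos
  unfold separatedTerm
  by_cases hz : z ∈ {z | Separated z i l j q}
  · rw [Set.indicator_of_mem hz, abs_mul, sq]
    exact mul_le_mul (h.abs_matchTerm_le k i l z) (h.abs_matchTerm_le k j q z) (abs_nonneg _)
      (by positivity)
  · rw [Set.indicator_of_notMem hz, abs_zero]; positivity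

theorem separatedTerm_eq_zero {k : ℕ} {i l j q : Fin N}
    {z : Fin N → Fin 2 × EuclideanSpace ℝ (Fin d)} (hz : ¬ SeparatedMatches k z i l j q) :
    separatedTerm g k i l j q z = 0 := by
  unfold separatedTerm
  by_cases hs : z ∈ {z | Separated z i l j q}
  · rw [Set.indicator_of_mem hs]
    by_contra hne
    refine hz ⟨?_, ?_, hs⟩
    · by_contra hn; exact hne (by rw [matchTerm_eq_zero hn, zero_mul])
    · by_contra hn; exact hne (by rw [matchTerm_eq_zero hn, mul_zero])
  · rw [Set.indicator_of_notMem hs]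

theorem separatedTerm_eq {k : ℕ} {i l j q : Fin N}
    {z : Fin N → Fin 2 × EuclideanSpace ℝ (Fin d)} (hz : SeparatedMatches k z i l j q) :
    separatedTerm g k i l j q z =
      (treatmentSign (z i).1 * (g (1 - (z i).1) (z i).2 - g (1 - (z i).1) (z l).2)) *
      (treatmentSign (z j).1 * (g (1 - (z j).1) (z j).2 - g (1 - (z j).1) (z q).2)) := by
  unfold separatedTerm
  rw [Set.indicator_of_mem (by exact hz.2.2)]
  unfold matchTerm
  rw [if_pos hz.1, if_pos hz.2.1]

/-- The possible positions of separated matches of `i` and `j`, given the other units. -/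
def matchPositions (k : ℕ) (Q : Finset (Fin N)) (z : Fin N → Fin 2 × EuclideanSpace ℝ (Fin d))
    (i j : Fin N) : Set (EuclideanSpace ℝ (Fin d) × EuclideanSpace ℝ (Fin d)) :=
  {p | (FewCloser k Q z (1 - (z i).1) (z i).2 (dist (z i).2 p.1) ∧
      FewCloser k Q z (1 - (z j).1) (z j).2 (dist (z j).2 p.2)) ∧
    (2 * dist (z i).2 p.1 < dist (z i).2 (z j).2 ∧ 2 * dist (z j).2 p.2 < dist (z i).2 (z j).2)}

theorem measurableSet_matchPositions (k : ℕ) (Q : Finset (Fin N)) (i j : Fin N) :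
    MeasurableSet {r : (Fin N → Fin 2 × EuclideanSpace ℝ (Fin d)) ×
      (EuclideanSpace ℝ (Fin d) × EuclideanSpace ℝ (Fin d)) |
        r.2 ∈ matchPositions k Q r.1 i j} := by
  refine MeasurableSet.inter (MeasurableSet.inter ?_ ?_) (MeasurableSet.inter ?_ ?_)
  · exact (measurableSet_fewCloser k Q).preimage
      (f := fun r : (Fin N → Fin 2 × EuclideanSpace ℝ (Fin d)) ×
        (EuclideanSpace ℝ (Fin d) × EuclideanSpace ℝ (Fin d)) =>
          (r.1, (1 - (r.1 i).1, (r.1 i).2, dist (r.1 i).2 r.2.1)))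
      (measurable_fst.prodMk (((measurable_one_sub_treatment i).comp measurable_fst).prodMk
        (by fun_prop)))
  · exact (measurableSet_fewCloser k Q).preimage
      (f := fun r : (Fin N → Fin 2 × EuclideanSpace ℝ (Fin d)) ×
        (EuclideanSpace ℝ (Fin d) × EuclideanSpace ℝ (Fin d)) =>
          (r.1, (1 - (r.1 j).1, (r.1 j).2, dist (r.1 j).2 r.2.2)))
      (measurable_fst.prodMk (((measurable_one_sub_treatment j).comp measurable_fst).prodMk
        (by fun_prop)))
  · exact measurableSet_lt (f := fun r : (Fin N → Fin 2 × EuclideanSpace ℝ (Fin d)) ×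
        (EuclideanSpace ℝ (Fin d) × EuclideanSpace ℝ (Fin d)) => 2 * dist (r.1 i).2 r.2.1)
      (g := fun r => dist (r.1 i).2 (r.1 j).2) (by fun_prop) (by fun_prop)
  · exact measurableSet_lt (f := fun r : (Fin N → Fin 2 × EuclideanSpace ℝ (Fin d)) ×
        (EuclideanSpace ℝ (Fin d) × EuclideanSpace ℝ (Fin d)) => 2 * dist (r.1 j).2 r.2.2)
      (g := fun r => dist (r.1 i).2 (r.1 j).2) (by fun_prop) (by fun_prop)

theorem integrable_indicator_of_bound {s : Set (EuclideanSpace ℝ (Fin d))} (hs : MeasurableSet s)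
    (hfin : volume s ≠ ⊤) {f : EuclideanSpace ℝ (Fin d) → ℝ} (hf : Measurable f) {B : ℝ}
    (hB : ∀ y ∈ s, ‖f y‖ ≤ B) : Integrable (s.indicator f) := by
  rw [integrable_indicator_iff hs]
  exact Measure.integrableOn_of_bounded hfin hf.aestronglyMeasurable
    ((ae_restrict_iff' hs).mpr (Filter.Eventually.of_forall hB))

theorem indicator_one_congr {α : Type*} {s : Set α} {a b : α} (h : a ∈ s ↔ b ∈ s) :
    s.indicator (1 : α → ℝ) a = s.indicator 1 b := by
  by_cases hb : b ∈ s
  · rw [Set.indicator_of_mem hb, Set.indicator_of_mem (h.mpr hb)]; rfl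
  · rw [Set.indicator_of_notMem hb, Set.indicator_of_notMem (fun ha => hb (h.mp ha))]

/-- The difference of the regression function weighted by the density, near `x`. -/
noncomputable def diffTerm (g m : Fin 2 → EuclideanSpace ℝ (Fin d) → ℝ) (a : Fin 2)
    (x : EuclideanSpace ℝ (Fin d)) (R : ℝ) : EuclideanSpace ℝ (Fin d) → ℝ :=
  {y | 2 * dist x y < R}.indicator fun y => m a y * (g a x - g a y)

/-- `diffTerm` without its odd first order part. -/
noncomputable def evenTerm (g m : Fin 2 → EuclideanSpace ℝ (Fin d) → ℝ) (a : Fin 2)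
    (x : EuclideanSpace ℝ (Fin d)) (R : ℝ) (L : EuclideanSpace ℝ (Fin d) →L[ℝ] ℝ) :
    EuclideanSpace ℝ (Fin d) → ℝ :=
  {y | 2 * dist x y < R}.indicator fun y => m a y * (g a x - g a y) + L (y - x) * m a x

theorem measurableSet_two_mul_dist_lt (x : EuclideanSpace ℝ (Fin d)) (R : ℝ) :
    MeasurableSet {y | 2 * dist x y < R} :=
  measurableSet_lt (by fun_prop) (by fun_prop)

theorem volume_two_mul_dist_lt_ne_top (x : EuclideanSpace ℝ (Fin d)) (R : ℝ) :
    volume {y : EuclideanSpace ℝ (Fin d) | 2 * dist x y < R} ≠ ⊤ := by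
  refine ((measure_mono fun y hy => ?_).trans_lt (measure_ball_lt_top (x := x) (r := R))).ne
  have hy' : 2 * dist x y < R := hy
  rw [Metric.mem_ball, dist_comm]
  linarith [dist_nonneg (x := x) (y := y)]

theorem RegularDesign.norm_m_le (h : RegularDesign 𝒳 D A c g m) (a : Fin 2)
    (y : EuclideanSpace ℝ (Fin d)) : ‖m a y‖ ≤ A := by
  rw [Real.norm_eq_abs, abs_of_nonneg (h.m_nonneg _ _)]; exact h.m_le _ _

theorem RegularDesign.norm_mul_sub_le (h : RegularDesign 𝒳 D A c g m) (a : Fin 2)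
    (x y : EuclideanSpace ℝ (Fin d)) : ‖m a y * (g a x - g a y)‖ ≤ A * (2 * A) := by
  rw [norm_mul]
  refine mul_le_mul (h.norm_m_le a y) ?_ (norm_nonneg _) h.A_pos.le
  rw [Real.norm_eq_abs]
  have := abs_sub (g a x) (g a y)
  linarith [h.abs_g_le a x, h.abs_g_le a y]

theorem RegularDesign.measurable_mul_sub (h : RegularDesign 𝒳 D A c g m) (a : Fin 2)
    (x : EuclideanSpace ℝ (Fin d)) : Measurable fun y => m a y * (g a x - g a y) :=
  (h.measurable_m a).mul (measurable_const.sub (h.measurable_g a))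

theorem RegularDesign.integrable_diffTerm (h : RegularDesign 𝒳 D A c g m) (a : Fin 2)
    (x : EuclideanSpace ℝ (Fin d)) (R : ℝ) : Integrable (diffTerm g m a x R) :=
  integrable_indicator_of_bound (measurableSet_two_mul_dist_lt x R)
    (volume_two_mul_dist_lt_ne_top x R) (h.measurable_mul_sub a x)
    fun y _ => h.norm_mul_sub_le a x y

theorem RegularDesign.integrable_evenTerm (h : RegularDesign 𝒳 D A c g m) (a : Fin 2)
    (x : EuclideanSpace ℝ (Fin d)) (R : ℝ) (L : EuclideanSpace ℝ (Fin d) →L[ℝ] ℝ) :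
    Integrable (evenTerm g m a x R L) := by
  refine integrable_indicator_of_bound (measurableSet_two_mul_dist_lt x R)
    (volume_two_mul_dist_lt_ne_top x R) ((h.measurable_mul_sub a x).add (by fun_prop))
    (B := A * (2 * A) + ‖L‖ * R * A) fun y hy => ?_
  refine (norm_add_le _ _).trans (add_le_add (h.norm_mul_sub_le a x y) ?_)
  have hy' : 2 * dist x y < R := hy
  have hd0 := dist_nonneg (x := x) (y := y)
  rw [norm_mul]
  refine mul_le_mul ((L.le_opNorm _).trans ?_) (h.norm_m_le a x) (norm_nonneg _)
    (mul_nonneg (norm_nonneg _) (by linarith))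
  refine mul_le_mul_of_nonneg_left ?_ (norm_nonneg _)
  rw [← dist_eq_norm, dist_comm]
  linarith

theorem diffTerm_sub_evenTerm_reflection (a : Fin 2) (x : EuclideanSpace ℝ (Fin d)) (R : ℝ)
    (L : EuclideanSpace ℝ (Fin d) →L[ℝ] ℝ) (y : EuclideanSpace ℝ (Fin d)) :
    diffTerm g m a x R (x + x - y) - evenTerm g m a x R L (x + x - y) =
      -(diffTerm g m a x R y - evenTerm g m a x R L y) := by
  have hL : L (x + x - y - x) = -L (y - x) := by rw [← map_neg]; congr 1; abel
  unfold diffTerm evenTerm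
  have hiff : x + x - y ∈ {y | 2 * dist x y < R} ↔ y ∈ {y | 2 * dist x y < R} := by
    simp only [Set.mem_ofPred_eq, dist_reflection]
  by_cases hy : y ∈ {y | 2 * dist x y < R}
  · rw [Set.indicator_of_mem hy, Set.indicator_of_mem hy, Set.indicator_of_mem (hiff.mpr hy),
      Set.indicator_of_mem (hiff.mpr hy), hL]
    ring
  · have hy' := fun hh => hy (hiff.mp hh)
    rw [Set.indicator_of_notMem hy, Set.indicator_of_notMem hy, Set.indicator_of_notMem hy',
      Set.indicator_of_notMem hy']
    ring

/-- The indicator of separated matches, as a function of the positions of the matches. -/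
noncomputable def matchIndicator (k : ℕ) (z : Fin N → Fin 2 × EuclideanSpace ℝ (Fin d))
    (i l j q : Fin N) (y y' : EuclideanSpace ℝ (Fin d)) : ℝ :=
  {z | SeparatedMatches k z i l j q}.indicator 1
    (Function.update (Function.update z l (1 - (z i).1, y)) q (1 - (z j).1, y'))

theorem measurable_update_update (z : Fin N → Fin 2 × EuclideanSpace ℝ (Fin d)) (l q : Fin N) :
    Measurable fun t : (Fin 2 × EuclideanSpace ℝ (Fin d)) × (Fin 2 × EuclideanSpace ℝ (Fin d)) =>
      Function.update (Function.update z l t.1) q t.2 := by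
  refine measurable_pi_lambda _ fun p => ?_
  by_cases hq : p = q
  · subst hq; simp only [Function.update_self]; fun_prop
  · by_cases hl : p = l
    · subst hl; simp only [Function.update_of_ne hq, Function.update_self]; fun_prop
    · simp only [Function.update_of_ne hq, Function.update_of_ne hl]; fun_prop

theorem measurable_matchIndicator (k : ℕ) (z : Fin N → Fin 2 × EuclideanSpace ℝ (Fin d))
    (i l j q : Fin N) : Measurable (Function.uncurry (matchIndicator k z i l j q)) :=
  (measurable_one.indicator (measurableSet_separatedMatches k i l j q)).comp
    ((measurable_update_update z l q).comp
      (f := fun p : EuclideanSpace ℝ (Fin d) × EuclideanSpace ℝ (Fin d) =>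
        ((1 - (z i).1, p.1), (1 - (z j).1, p.2))) (by fun_prop))

theorem norm_matchIndicator_le (k : ℕ) (z : Fin N → Fin 2 × EuclideanSpace ℝ (Fin d))
    (i l j q : Fin N) (y y' : EuclideanSpace ℝ (Fin d)) :
    ‖matchIndicator k z i l j q y y'‖ ≤ 1 := by
  unfold matchIndicator Set.indicator
  split_ifs <;> simp

/-- Being matches of `i` and `j` determines the treatments of `l` and `q`, so each integral over the
design law reduces to one against a single subdensity. -/
theorem RegularDesign.integral_separatedTerm_update (h : RegularDesign 𝒳 D A c g m)
    [IsProbabilityMeasure (designLaw m)] (k : ℕ) {i l j q : Fin N} (hil : i ≠ l) (hjq : j ≠ q)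
    (hiq : i ≠ q) (hlj : l ≠ j) (hlq : l ≠ q)
    (z : Fin N → Fin 2 × EuclideanSpace ℝ (Fin d)) :
    ∫ t, separatedTerm g k i l j q (Function.update (Function.update z l t.1) q t.2)
        ∂((designLaw m).prod (designLaw m)) =
      ∫ y, m (1 - (z i).1) y * ∫ y', m (1 - (z j).1) y' * separatedTerm g k i l j q
        (Function.update (Function.update z l (1 - (z i).1, y)) q (1 - (z j).1, y')) := by
  have hΨb := h.abs_separatedTerm_le k i l j q
  have hF2 : Measurable fun t : (Fin 2 × EuclideanSpace ℝ (Fin d)) ×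
      (Fin 2 × EuclideanSpace ℝ (Fin d)) =>
      separatedTerm g k i l j q (Function.update (Function.update z l t.1) q t.2) :=
    (measurable_separatedTerm h k i l j q).comp (measurable_update_update z l q)
  rw [integral_prod _ (Integrable.of_bound hF2.aestronglyMeasurable _
    (Filter.Eventually.of_forall fun t => hΨb _))]
  have inner : ∀ t, ∫ s, separatedTerm g k i l j q
      (Function.update (Function.update z l t) q s) ∂(designLaw m) =
      ∫ y', m (1 - (z j).1) y' * separatedTerm g k i l j q
        (Function.update (Function.update z l t) q (1 - (z j).1, y')) := fun t => by
    refine h.integral_designLaw (hF2.comp (measurable_const.prodMk measurable_id))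
      (fun s => hΨb _) _ fun b y' hb => separatedTerm_eq_zero fun hsm => hb ?_
    have := hsm.2.1.1
    rwa [Function.update_self, Function.update_of_ne hjq, Function.update_of_ne hlj.symm] at this
  have houter := h.integral_designLaw (F := fun t => ∫ s, separatedTerm g k i l j q
      (Function.update (Function.update z l t) q s) ∂(designLaw m))
    (hF2.stronglyMeasurable.integral_prod_right').measurable (B := (2 * A) ^ 2)
    (fun t => by
      have := norm_integral_le_of_norm_le_const (μ := designLaw m)
        (f := fun s => separatedTerm g k i l j q
          (Function.update (Function.update z l t) q s)) (C := (2 * A) ^ 2)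
        (Filter.Eventually.of_forall fun s => hΨb (Function.update (Function.update z l t) q s))
      rw [probReal_univ, mul_one] at this
      exact this) (1 - (z i).1)
    (fun b y hb => by
      have : ∀ s, separatedTerm g k i l j q
          (Function.update (Function.update z l (b, y)) q s) = 0 := fun s =>
        separatedTerm_eq_zero fun hsm => hb (by
          have := hsm.1.1
          rwa [Function.update_of_ne hlq, Function.update_self, Function.update_of_ne hiq,
            Function.update_of_ne hil] at this)
      simp only [this, integral_zero])
  refine houter.trans (integral_congr_ae (Filter.Eventually.of_forall fun y => ?_))
  simp only [inner]

/-- On separated matches the cutoffs built into `diffTerm` equal 1, and elsewhere both sides vanish.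
The cutoffs are symmetric about their centres, so they respect the reflection, and they keep the
linear parts integrable over the whole space. -/
theorem mul_separatedTerm_update (k : ℕ) {i l j q : Fin N} (hil : i ≠ l)
    (hjq : j ≠ q) (hiq : i ≠ q) (hlj : l ≠ j) (hlq : l ≠ q)
    (z : Fin N → Fin 2 × EuclideanSpace ℝ (Fin d)) (y y' : EuclideanSpace ℝ (Fin d)) :
    m (1 - (z i).1) y * (m (1 - (z j).1) y' * separatedTerm g k i l j q
        (Function.update (Function.update z l (1 - (z i).1, y)) q (1 - (z j).1, y'))) =
      treatmentSign (z i).1 * treatmentSign (z j).1 *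
        (diffTerm g m (1 - (z i).1) (z i).2 (dist (z i).2 (z j).2) y *
          (matchIndicator k z i l j q y y' *
            diffTerm g m (1 - (z j).1) (z j).2 (dist (z i).2 (z j).2) y')) := by
  unfold matchIndicator
  set z' := Function.update (Function.update z l (1 - (z i).1, y)) q (1 - (z j).1, y') with hz'
  have vi : z' i = z i := by
    rw [hz', Function.update_of_ne hiq, Function.update_of_ne hil]
  have vj : z' j = z j := by
    rw [hz', Function.update_of_ne hjq, Function.update_of_ne hlj.symm]
  have vl : z' l = (1 - (z i).1, y) := by
    rw [hz', Function.update_of_ne hlq, Function.update_self]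
  have vq : z' q = (1 - (z j).1, y') := by rw [hz', Function.update_self]
  by_cases hsm : SeparatedMatches k z' i l j q
  · have hb1 := hsm.2.2.1
    rw [vi, vl, vj] at hb1
    have hb2 := hsm.2.2.2
    rw [vi, vq, vj] at hb2
    rw [separatedTerm_eq hsm, Set.indicator_of_mem (by exact hsm)]
    unfold diffTerm
    rw [Set.indicator_of_mem (by exact hb1), Set.indicator_of_mem (by exact hb2), vi, vj, vl, vq,
      Pi.one_apply]
    ring
  · rw [separatedTerm_eq_zero hsm, Set.indicator_of_notMem (by exact hsm)]
    ring

/-- The match indicator is even in `y` about X_i and in `y'` about X_j, so the linear parts at both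
units drop out. This has to happen before absolute values are taken. -/
theorem integral_diffTerm_eq_integral_evenTerm (h : RegularDesign 𝒳 D A c g m) (k : ℕ)
    {i l j q : Fin N} (hil : i ≠ l) (hjq : j ≠ q) (hiq : i ≠ q) (hlj : l ≠ j) (hlq : l ≠ q)
    (z : Fin N → Fin 2 × EuclideanSpace ℝ (Fin d)) (a a' : Fin 2) (R : ℝ)
    (L L' : EuclideanSpace ℝ (Fin d) →L[ℝ] ℝ) :
    ∫ y, diffTerm g m a (z i).2 R y *
        ∫ y', matchIndicator k z i l j q y y' * diffTerm g m a' (z j).2 R y' =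
      ∫ y, evenTerm g m a (z i).2 R L y *
        ∫ y', matchIndicator k z i l j q y y' * evenTerm g m a' (z j).2 R L' y' := by
  refine integral_mul_integral_eq_of_reflection (measurable_matchIndicator k z i l j q)
    (norm_matchIndicator_le k z i l j q) (h.integrable_diffTerm _ _ _)
    (h.integrable_evenTerm _ _ _ _) (h.integrable_diffTerm _ _ _) (h.integrable_evenTerm _ _ _ _)
    (diffTerm_sub_evenTerm_reflection _ _ _ _) (diffTerm_sub_evenTerm_reflection _ _ _ _)
    (fun y y' => indicator_one_congr ?_) (fun y y' => indicator_one_congr ?_)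
  · show SeparatedMatches k _ i l j q ↔ SeparatedMatches k _ i l j q
    rw [Function.update_comm hlq, Function.update_comm hlq]
    have := separatedMatches_reflection (k := k) (z := Function.update z q (1 - (z j).1, y')) hil
      hlj.symm hlq.symm (w := 1 - (z i).1) y
    rwa [Function.update_of_ne hiq] at this
  · show SeparatedMatches k _ i l j q ↔ SeparatedMatches k _ i l j q
    rw [separatedMatches_comm, separatedMatches_comm (i := i)]
    have := separatedMatches_reflection (k := k) (z := Function.update z l (1 - (z i).1, y)) hjq hiq
      hlq (w := 1 - (z j).1) y'
    rwa [Function.update_of_ne hlj.symm] at this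

/-- With the cancellation done, the exact match indicator can be relaxed to counting events for the
units outside `Q`, which are ready for resampling. -/
theorem RegularDesign.enorm_evenTerm_mul_le (h : RegularDesign 𝒳 D A c g m)
    (k : ℕ) {i l j q : Fin N} (hil : i ≠ l) (hjq : j ≠ q)
    (hiq : i ≠ q) (hlj : l ≠ j) (hlq : l ≠ q) {Q : Finset (Fin N)} (hl : l ∈ Q) (hq : q ∈ Q)
    {z : Fin N → Fin 2 × EuclideanSpace ℝ (Fin d)} (hi : (z i).2 ∈ 𝒳) (hj : (z j).2 ∈ 𝒳)
    {L L' : EuclideanSpace ℝ (Fin d) →L[ℝ] ℝ} (hL : ‖L‖ ≤ A) (hL' : ‖L'‖ ≤ A)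
    (hLt : ∀ y ∈ 𝒳, |g (1 - (z i).1) y - g (1 - (z i).1) (z i).2 - L (y - (z i).2)| ≤
      A * dist (z i).2 y ^ 2)
    (hLt' : ∀ y ∈ 𝒳, |g (1 - (z j).1) y - g (1 - (z j).1) (z j).2 - L' (y - (z j).2)| ≤
      A * dist (z j).2 y ^ 2) (y y' : EuclideanSpace ℝ (Fin d)) :
    ‖evenTerm g m (1 - (z i).1) (z i).2 (dist (z i).2 (z j).2) L y *
      (matchIndicator k z i l j q y y' *
        evenTerm g m (1 - (z j).1) (z j).2 (dist (z i).2 (z j).2) L' y')‖ₑ ≤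
      ENNReal.ofReal (4 * A ^ 4 * (evenError 𝒳 (z i).2 y * evenError 𝒳 (z j).2 y')) *
        (matchPositions k Q z i j).indicator 1 (y, y') := by
  unfold matchIndicator
  set z' := Function.update (Function.update z l (1 - (z i).1, y)) q (1 - (z j).1, y') with hz'
  have vi : z' i = z i := by
    rw [hz', Function.update_of_ne hiq, Function.update_of_ne hil]
  have vj : z' j = z j := by
    rw [hz', Function.update_of_ne hjq, Function.update_of_ne hlj.symm]
  have vl : z' l = (1 - (z i).1, y) := by
    rw [hz', Function.update_of_ne hlq, Function.update_self]
  have vq : z' q = (1 - (z j).1, y') := by rw [hz', Function.update_self]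
  by_cases hsm : SeparatedMatches k z' i l j q
  · have hb1 := hsm.2.2.1
    rw [vi, vl, vj] at hb1
    have hb2 := hsm.2.2.2
    rw [vi, vq, vj] at hb2
    have hout : ∀ p, p ∉ Q → z' p = z p := by
      intro p hp
      have hpq : p ≠ q := fun hh => hp (hh ▸ hq)
      have hpl : p ≠ l := fun hh => hp (hh ▸ hl)
      rw [hz', Function.update_of_ne hpq, Function.update_of_ne hpl]
    have f1 := hsm.1.fewCloser hl
    have f2 := hsm.2.1.fewCloser hq
    rw [fewCloser_congr hout, vi, vl] at f1
    rw [fewCloser_congr hout, vj, vq] at f2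
    have hmem : (y, y') ∈ matchPositions k Q z i j := ⟨⟨f1, f2⟩, hb1, hb2⟩
    rw [Set.indicator_of_mem hmem, Set.indicator_of_mem (by exact hsm), Pi.one_apply, Pi.one_apply,
      mul_one, one_mul]
    unfold evenTerm
    rw [Set.indicator_of_mem (by exact hb1), Set.indicator_of_mem (by exact hb2), ← ofReal_norm]
    refine ENNReal.ofReal_le_ofReal ?_
    rw [norm_mul]
    have b1 := h.abs_add_le_evenError _ hi hL hLt y
    have b2 := h.abs_add_le_evenError _ hj hL' hLt' y'
    have n1 := evenError_nonneg (𝒳 := 𝒳) (z i).2 y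
    refine (mul_le_mul b1 b2 (abs_nonneg _) (by positivity)).trans (le_of_eq ?_)
    ring
  · rw [Set.indicator_of_notMem (by exact hsm), zero_mul, mul_zero, enorm_zero]
    exact zero_le

theorem RegularDesign.enorm_integral_separatedTerm_le (h : RegularDesign 𝒳 D A c g m)
    [IsProbabilityMeasure (designLaw m)] (k : ℕ) {i l j q : Fin N} (hil : i ≠ l) (hjq : j ≠ q)
    (hiq : i ≠ q) (hlj : l ≠ j) (hlq : l ≠ q) {Q : Finset (Fin N)} (hl : l ∈ Q) (hq : q ∈ Q)
    {z : Fin N → Fin 2 × EuclideanSpace ℝ (Fin d)} (hi : (z i).2 ∈ 𝒳) (hj : (z j).2 ∈ 𝒳) :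
    ‖∫ t, separatedTerm g k i l j q (Function.update (Function.update z l t.1) q t.2)
        ∂((designLaw m).prod (designLaw m))‖ₑ ≤
      ∫⁻ p, ENNReal.ofReal (4 * A ^ 4 * (evenError 𝒳 (z i).2 p.1 * evenError 𝒳 (z j).2 p.2)) *
        (matchPositions k Q z i j).indicator 1 p ∂(volume.prod volume) := by
  obtain ⟨L, hL, hLt⟩ := h.g_taylor (1 - (z i).1) (z i).2 hi
  obtain ⟨L', hL', hLt'⟩ := h.g_taylor (1 - (z j).1) (z j).2 hj
  have step : ∫ t, separatedTerm g k i l j q (Function.update (Function.update z l t.1) q t.2)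
        ∂((designLaw m).prod (designLaw m)) = treatmentSign (z i).1 * treatmentSign (z j).1 *
      ∫ y, evenTerm g m (1 - (z i).1) (z i).2 (dist (z i).2 (z j).2) L y *
        ∫ y', matchIndicator k z i l j q y y' *
          evenTerm g m (1 - (z j).1) (z j).2 (dist (z i).2 (z j).2) L' y' := by
    rw [h.integral_separatedTerm_update k hil hjq hiq hlj hlq z,
      ← integral_diffTerm_eq_integral_evenTerm h k hil hjq hiq hlj hlq, ← integral_const_mul]
    refine integral_congr_ae (Filter.Eventually.of_forall fun y => ?_)
    simp only
    rw [← integral_const_mul, ← integral_const_mul, ← integral_const_mul]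
    exact integral_congr_ae (Filter.Eventually.of_forall fun y' =>
      mul_separatedTerm_update k hil hjq hiq hlj hlq z y y')
  have hσ1 : ‖treatmentSign (z i).1 * treatmentSign (z j).1‖ₑ = 1 := by
    rw [← ofReal_norm, Real.norm_eq_abs, abs_mul, abs_treatmentSign, abs_treatmentSign, one_mul,
      ENNReal.ofReal_one]
  rw [step, enorm_mul, hσ1, one_mul]
  have hpos : MeasurableSet (matchPositions k Q z i j) :=
    measurable_prodMk_left (x := z) (measurableSet_matchPositions k Q i j)
  have hint : Measurable fun p : EuclideanSpace ℝ (Fin d) × EuclideanSpace ℝ (Fin d) =>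
      ENNReal.ofReal (4 * A ^ 4 * (evenError 𝒳 (z i).2 p.1 * evenError 𝒳 (z j).2 p.2)) *
        (matchPositions k Q z i j).indicator 1 p :=
    Measurable.mul (Measurable.ennreal_ofReal ((((measurable_evenError_right 𝒳 (z i).2).comp measurable_fst).mul
      ((measurable_evenError_right 𝒳 (z j).2).comp measurable_snd)).const_mul _)) (measurable_one.indicator hpos)
  rw [lintegral_prod _ hint.aemeasurable]
  refine (enorm_integral_le_lintegral_enorm _).trans (lintegral_mono fun y => ?_)
  rw [← integral_const_mul]
  exact (enorm_integral_le_lintegral_enorm _).trans (lintegral_mono fun y' =>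
    h.enorm_evenTerm_mul_le k hil hjq hiq hlj hlq hl hq hi hj hL hL' hLt hLt' y y')

end SeparatedPairs

/-! ### Separated pairs contribute at second order -/

section SeparatedIntegral

variable {d : ℕ} {𝒳 : Set (EuclideanSpace ℝ (Fin d))} {D A c : ℝ}
  {g m : Fin 2 → EuclideanSpace ℝ (Fin d) → ℝ}

/-- The even error integrated against the exponential weight. -/
noncomputable def evenMass (𝒳 : Set (EuclideanSpace ℝ (Fin d))) (θ ε : ℝ)
    (x : EuclideanSpace ℝ (Fin d)) : ENNReal :=
  ∫⁻ y, ENNReal.ofReal (evenError 𝒳 x y * Real.exp (-(θ * (dist x y / ε) ^ d)))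

theorem measurable_evenMass (𝒳 : Set (EuclideanSpace ℝ (Fin d))) (θ ε : ℝ) :
    Measurable (evenMass 𝒳 θ ε) := by
  refine Measurable.lintegral_prod_right' (f := fun p : EuclideanSpace ℝ (Fin d) ×
    EuclideanSpace ℝ (Fin d) => ENNReal.ofReal
      (evenError 𝒳 p.1 p.2 * Real.exp (-(θ * (dist p.1 p.2 / ε) ^ d)))) ?_
  exact ((measurable_evenError 𝒳).mul (by fun_prop)).ennreal_ofReal

/-- The boundary part lives on |x − y| ≥ δ(x). There half of the exponent is at least its value at
δ(x) and can be taken out of the integral. -/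
theorem exists_evenMass_le (hd : 1 ≤ d) {θ : ℝ} (hθ : 0 < θ) :
    ∃ C : ℝ, 0 < C ∧ ∀ (𝒳 : Set (EuclideanSpace ℝ (Fin d))) (ε : ℝ), 0 < ε → ∀ x,
      evenMass 𝒳 θ ε x ≤ ENNReal.ofReal (C * ε ^ (d + 2)) + ENNReal.ofReal (C * ε ^ (d + 1)) *
        ENNReal.ofReal (Real.exp (-(θ / 2 * (Metric.infDist x 𝒳ᶜ / ε) ^ d))) := by
  obtain ⟨C₁, hC₁, h₁⟩ := exists_lintegral_expKernel_le hd hθ 2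
  obtain ⟨C₂, hC₂, h₂⟩ := exists_lintegral_expKernel_le hd (half_pos hθ) 1
  refine ⟨C₁ + C₂, by positivity, fun 𝒳 ε hε x => ?_⟩
  set δ := Metric.infDist x 𝒳ᶜ with hδ
  have hδ0 : 0 ≤ δ := Metric.infDist_nonneg
  set w := ENNReal.ofReal (Real.exp (-(θ / 2 * (δ / ε) ^ d))) with hw
  have hpt : ∀ y, ENNReal.ofReal (evenError 𝒳 x y * Real.exp (-(θ * (dist x y / ε) ^ d))) ≤
      expKernel θ ε 2 x y + w * expKernel (θ / 2) ε 1 x y := by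
    intro y
    unfold evenError expKernel
    rw [hw, ← ENNReal.ofReal_mul (by positivity), ← ENNReal.ofReal_add (by positivity)
      (by positivity), add_mul]
    refine ENNReal.ofReal_le_ofReal (add_le_add le_rfl ?_)
    by_cases hy : y ∈ {y | Metric.infDist x 𝒳ᶜ ≤ dist x y}
    · rw [Set.indicator_of_mem hy, pow_one, mul_left_comm, ← Real.exp_add]
      refine mul_le_mul_of_nonneg_left (Real.exp_le_exp.mpr ?_) dist_nonneg
      have hy' : δ ≤ dist x y := hy
      have : (δ / ε) ^ d ≤ (dist x y / ε) ^ d := by gcongr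
      have : θ / 2 * (δ / ε) ^ d ≤ θ / 2 * (dist x y / ε) ^ d := by gcongr
      linarith
    · rw [Set.indicator_of_notMem hy, zero_mul]; positivity
  have m₁ : Measurable (expKernel θ ε 2 x) := by unfold expKernel; fun_prop
  have m₂ : Measurable (expKernel (θ / 2) ε 1 x) := by unfold expKernel; fun_prop
  refine (lintegral_mono hpt).trans ?_
  rw [lintegral_add_left m₁, lintegral_const_mul _ m₂, mul_comm w]
  have e₁ : C₁ * ε ^ (d + 2) ≤ (C₁ + C₂) * ε ^ (d + 2) := by gcongr; linarith
  have e₂ : C₂ * ε ^ (d + 1) ≤ (C₁ + C₂) * ε ^ (d + 1) := by gcongr; linarith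
  exact add_le_add ((h₁ ε hε x).trans (ENNReal.ofReal_le_ofReal e₁))
    (mul_le_mul_left ((h₂ ε hε x).trans (ENNReal.ofReal_le_ofReal e₂)) _)

/-- By the boundary condition the exponential factor in δ(x) has mean of order ε, which is the power
missing from the boundary part. -/
theorem exists_lintegral_evenMass_le (hd : 1 ≤ d) (hA : 0 < A) {θ : ℝ} (hθ : 0 < θ) :
    ∃ C : ℝ, 0 < C ∧ ∀ (𝒳 : Set (EuclideanSpace ℝ (Fin d)))
      (g m : Fin 2 → EuclideanSpace ℝ (Fin d) → ℝ), RegularDesign 𝒳 D A c g m →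
      ∀ [IsProbabilityMeasure (designLaw m)] (ε : ℝ), 0 < ε →
      ∫⁻ s, evenMass 𝒳 θ ε s.2 ∂(designLaw m) ≤ ENNReal.ofReal (C * ε ^ (d + 2)) := by
  obtain ⟨C, hC, hCb⟩ := exists_evenMass_le hd hθ
  -- With this `r`, (θ/2)(δ/ε)^d = (δ/(ε/r))^d, so the boundary condition applies at scale ε/r.
  set r : ℝ := (θ / 2) ^ ((d : ℝ)⁻¹) with hr
  have hr0 : 0 < r := Real.rpow_pos_of_pos (half_pos hθ) _
  have hrd : r ^ d = θ / 2 := Real.rpow_inv_natCast_pow (half_pos hθ).le (by omega)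
  refine ⟨C + C * (2 * (A / r)), by positivity, fun 𝒳 g m h _ ε hε => ?_⟩
  have hme : Measurable fun x : EuclideanSpace ℝ (Fin d) =>
      ENNReal.ofReal (Real.exp (-(θ / 2 * (Metric.infDist x 𝒳ᶜ / ε) ^ d))) := by
    have := (Metric.continuous_infDist_pt (𝒳ᶜ)).measurable
    fun_prop
  have hb : ∫⁻ s, ENNReal.ofReal (Real.exp (-(θ / 2 * (Metric.infDist s.2 𝒳ᶜ / ε) ^ d)))
      ∂(designLaw m) ≤ ENNReal.ofReal (2 * (A / r) * ε) := by
    rw [h.lintegral_designLaw (F := fun s => ENNReal.ofReal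
      (Real.exp (-(θ / 2 * (Metric.infDist s.2 𝒳ᶜ / ε) ^ d)))) (hme.comp measurable_snd)]
    have : ∀ a ∈ (Finset.univ : Finset (Fin 2)), ∫⁻ x, ENNReal.ofReal (m a x) * ENNReal.ofReal
        (Real.exp (-(θ / 2 * (Metric.infDist x 𝒳ᶜ / ε) ^ d))) ≤
        ENNReal.ofReal (A * (ε / r)) := fun a _ => by
      refine le_trans (le_of_eq (lintegral_congr fun x => ?_)) (h.boundary a (ε / r) (by positivity))
      rw [← hrd, ← mul_pow]
      congr 4
      field_simp
    refine (Finset.sum_le_card_nsmul _ _ _ this).trans (le_of_eq ?_)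
    rw [Finset.card_univ, Fintype.card_fin, nsmul_eq_mul,
      show 2 * (A / r) * ε = 2 * (A * (ε / r)) by ring, ENNReal.ofReal_mul (p := 2) (by norm_num)]
    norm_num
  have hmono : ∀ s : Fin 2 × EuclideanSpace ℝ (Fin d), evenMass 𝒳 θ ε s.2 ≤ _ := fun s =>
    hCb 𝒳 ε hε s.2
  refine (lintegral_mono hmono).trans ?_
  rw [lintegral_add_left measurable_const, lintegral_const, measure_univ, mul_one,
    lintegral_const_mul' _ _ ENNReal.ofReal_ne_top]
  refine (add_le_add le_rfl (mul_le_mul_right hb _)).trans (le_of_eq ?_)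
  rw [← ENNReal.ofReal_mul (by positivity), ← ENNReal.ofReal_add (by positivity) (by positivity)]
  congr 1
  ring

/-- By Fubini the average over the resampled units is taken first and becomes a tail probability. It
is bounded by a product of functions of the two positions, so the remaining double integral
factorizes. -/
theorem RegularDesign.lintegral_matchPositions_le (h : RegularDesign 𝒳 D A c g m)
    [IsProbabilityMeasure (designLaw m)] {N k : ℕ} (hN : 8 ≤ N) (hk : 1 ≤ k) {ε : ℝ}
    (hεd : ε ^ d = k / N) {Q : Finset (Fin N)} (hQ : Q.card ≤ 4) {i j : Fin N} (hi : i ∈ Q)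
    (hj : j ∈ Q) {z : Fin N → Fin 2 × EuclideanSpace ℝ (Fin d)} (hzi : (z i).2 ∈ 𝒳)
    (hzj : (z j).2 ∈ 𝒳) :
    ∫⁻ z', ∫⁻ p, ENNReal.ofReal (4 * A ^ 4 *
        (evenError 𝒳 (Q.piecewise z z' i).2 p.1 * evenError 𝒳 (Q.piecewise z z' j).2 p.2)) *
        (matchPositions k Q (Q.piecewise z z') i j).indicator 1 p ∂(volume.prod volume)
        ∂(Measure.pi fun _ : Fin N => designLaw m) ≤
      ENNReal.ofReal (4 * A ^ 4 * Real.exp 1) *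
        (evenMass 𝒳 (tailRate c) ε (z i).2 * evenMass 𝒳 (tailRate c) ε (z j).2) := by
  have hA := h.A_pos
  have ei : ∀ z', Q.piecewise z z' i = z i := fun z' => Finset.piecewise_eq_of_mem _ _ _ hi
  have ej : ∀ z', Q.piecewise z z' j = z j := fun z' => Finset.piecewise_eq_of_mem _ _ _ hj
  simp only [ei, ej]
  set x := (z i).2 with hx
  set x' := (z j).2 with hx'
  have mE : ∀ w : EuclideanSpace ℝ (Fin d), Measurable (evenError 𝒳 w) :=
    measurable_evenError_right 𝒳
  have mEE : Measurable fun p : EuclideanSpace ℝ (Fin d) × EuclideanSpace ℝ (Fin d) =>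
      ENNReal.ofReal (4 * A ^ 4 * (evenError 𝒳 x p.1 * evenError 𝒳 x' p.2)) :=
    ((((mE x).comp measurable_fst).mul ((mE x').comp measurable_snd)).const_mul _).ennreal_ofReal
  have mpw : Measurable fun z' : Fin N → Fin 2 × EuclideanSpace ℝ (Fin d) => Q.piecewise z z' :=
    (measurePreserving_piecewise (designLaw m) Q).measurable.comp measurable_prodMk_left
  set T : Set ((Fin N → Fin 2 × EuclideanSpace ℝ (Fin d)) ×
      (EuclideanSpace ℝ (Fin d) × EuclideanSpace ℝ (Fin d))) :=
    {r | r.2 ∈ matchPositions k Q (Q.piecewise z r.1) i j} with hT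
  have hTm : MeasurableSet T :=
    ((mpw.comp measurable_fst).prodMk measurable_snd) (measurableSet_matchPositions k Q i j)
  have hjoint : Measurable fun r : (Fin N → Fin 2 × EuclideanSpace ℝ (Fin d)) ×
      (EuclideanSpace ℝ (Fin d) × EuclideanSpace ℝ (Fin d)) =>
      ENNReal.ofReal (4 * A ^ 4 * (evenError 𝒳 x r.2.1 * evenError 𝒳 x' r.2.2)) *
        (matchPositions k Q (Q.piecewise z r.1) i j).indicator 1 r.2 :=
    (mEE.comp measurable_snd).mul (measurable_one.indicator hTm)
  rw [lintegral_lintegral_swap hjoint.aemeasurable]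
  have hp : ∀ p : EuclideanSpace ℝ (Fin d) × EuclideanSpace ℝ (Fin d),
      ∫⁻ z', ENNReal.ofReal (4 * A ^ 4 * (evenError 𝒳 x p.1 * evenError 𝒳 x' p.2)) *
        (matchPositions k Q (Q.piecewise z z') i j).indicator 1 p
        ∂(Measure.pi fun _ : Fin N => designLaw m) ≤
      ENNReal.ofReal (4 * A ^ 4 * Real.exp 1) *
        (ENNReal.ofReal (evenError 𝒳 x p.1 * Real.exp (-(tailRate c * (dist x p.1 / ε) ^ d))) *
          ENNReal.ofReal (evenError 𝒳 x' p.2 *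
            Real.exp (-(tailRate c * (dist x' p.2 / ε) ^ d)))) := by
    intro p
    have hS : MeasurableSet {z' | p ∈ matchPositions k Q (Q.piecewise z z') i j} :=
      measurable_prodMk_right (y := p) hTm
    have hprob : (Measure.pi fun _ : Fin N => designLaw m)
        {z' | p ∈ matchPositions k Q (Q.piecewise z z') i j} ≤
        ENNReal.ofReal (Real.exp 1 * (Real.exp (-(tailRate c * (dist x p.1 / ε) ^ d)) *
          Real.exp (-(tailRate c * (dist x' p.2 / ε) ^ d)))) := by
      -- The positions range over the whole space. The separation cutoff keeps both radii below `D`,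
      -- the range in which ball masses are controlled.
      by_cases hsep : 2 * dist x p.1 < dist x x' ∧ 2 * dist x' p.2 < dist x x'
      · have hD := h.dist_le x hzi x' hzj
        have d1 := dist_nonneg (x := x) (y := p.1)
        have d2 := dist_nonneg (x := x') (y := p.2)
        refine le_trans (measure_mono fun z' hz' => ?_) (h.measure_fewCloser_le hN hk hεd Q hQ
          (1 - (z i).1) (1 - (z j).1) hzi hzj d1 d2 (by linarith) (by linarith))
        have hf := hz'.1
        have hout : ∀ q, q ∉ Q → Q.piecewise z z' q = z' q := fun q hq =>
          Finset.piecewise_eq_of_notMem _ _ _ hq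
        rw [fewCloser_congr hout, fewCloser_congr hout, ei, ej] at hf
        exact hf
      · have : {z' | p ∈ matchPositions k Q (Q.piecewise z z') i j} = ∅ := by
          ext z'
          simp only [Set.mem_ofPred_eq, Set.mem_empty_iff_false, iff_false]
          intro hz'
          have := hz'.2
          rw [ei, ej] at this
          exact hsep this
        rw [this, measure_empty]
        exact zero_le
    have hind : ∀ z', (matchPositions k Q (Q.piecewise z z') i j).indicator (1 : _ × _ → ENNReal) p =
        {z' | p ∈ matchPositions k Q (Q.piecewise z z') i j}.indicator 1 z' := fun z' => rfl
    simp only [hind]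
    rw [lintegral_const_mul _ (measurable_one.indicator hS), lintegral_indicator_one hS]
    refine (mul_le_mul_right hprob _).trans (le_of_eq ?_)
    have n1 := evenError_nonneg (𝒳 := 𝒳) x p.1
    have n2 := evenError_nonneg (𝒳 := 𝒳) x' p.2
    rw [← ENNReal.ofReal_mul (by positivity), ← ENNReal.ofReal_mul (by positivity),
      ← ENNReal.ofReal_mul (by positivity)]
    congr 1
    ring
  refine (lintegral_mono hp).trans (le_of_eq ?_)
  have mw : ∀ w : EuclideanSpace ℝ (Fin d), Measurable fun y => ENNReal.ofReal
      (evenError 𝒳 w y * Real.exp (-(tailRate c * (dist w y / ε) ^ d))) := fun w =>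
    ((mE w).mul (by fun_prop)).ennreal_ofReal
  rw [lintegral_const_mul' _ _ ENNReal.ofReal_ne_top,
    lintegral_prod_mul (mw x).aemeasurable (mw x').aemeasurable]
  rfl

/-- Redrawing `l` and `q` exposes the cancellation, redrawing the units outside `Q` produces the
exponential weights, and finally the independent positions X_i and X_j are integrated, each giving a
factor of order ε^(d+2). -/
theorem exists_integral_separatedTerm_le (hd : 1 ≤ d) (hA : 0 < A) (hc : 0 < c) :
    ∃ C : ℝ, 0 < C ∧ ∀ (𝒳 : Set (EuclideanSpace ℝ (Fin d)))
      (g m : Fin 2 → EuclideanSpace ℝ (Fin d) → ℝ), RegularDesign 𝒳 D A c g m →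
      ∀ [IsProbabilityMeasure (designLaw m)] (N k : ℕ), 8 ≤ N → 1 ≤ k → ∀ ε : ℝ, 0 < ε →
      ε ^ d = k / N → ∀ i l j q : Fin N, i ≠ l → j ≠ q → i ≠ j → i ≠ q → l ≠ j → l ≠ q →
      ‖∫ z, separatedTerm g k i l j q z ∂(Measure.pi fun _ : Fin N => designLaw m)‖ₑ ≤
        ENNReal.ofReal (C * (ε ^ (d + 2)) ^ 2) := by
  obtain ⟨C, hC, hCb⟩ := exists_lintegral_evenMass_le (D := D) (c := c) hd hA (tailRate_pos hc)
  refine ⟨4 * A ^ 4 * Real.exp 1 * C ^ 2, by positivity, ?_⟩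
  intro 𝒳 g m h _ N k hN hk ε hε hεd i l j q hil hjq hij hiq hlj hlq
  have hΨm := measurable_separatedTerm h k i l j q
  have hΨb := h.abs_separatedTerm_le k i l j q
  have hup := measurePreserving_update_update (designLaw m) (l := l) (m := q)
  set Q : Finset (Fin N) := {i, l, j, q} with hQ
  have hQc : Q.card ≤ 4 := Finset.card_le_four
  have hiQ : i ∈ Q := by simp [hQ]
  have hlQ : l ∈ Q := by simp [hQ]
  have hjQ : j ∈ Q := by simp [hQ]
  have hqQ : q ∈ Q := by simp [hQ]
  have e1 : ∫ z, separatedTerm g k i l j q z ∂(Measure.pi fun _ : Fin N => designLaw m) =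
      ∫ z, ∫ t, separatedTerm g k i l j q (Function.update (Function.update z l t.1) q t.2)
        ∂((designLaw m).prod (designLaw m)) ∂(Measure.pi fun _ : Fin N => designLaw m) := by
    have hint : Integrable (fun p : (Fin N → Fin 2 × EuclideanSpace ℝ (Fin d)) ×
        ((Fin 2 × EuclideanSpace ℝ (Fin d)) × (Fin 2 × EuclideanSpace ℝ (Fin d))) =>
        separatedTerm g k i l j q (Function.update (Function.update p.1 l p.2.1) q p.2.2))
        ((Measure.pi fun _ : Fin N => designLaw m).prod ((designLaw m).prod (designLaw m))) :=
      Integrable.of_bound (hΨm.comp hup.measurable).aestronglyMeasurable _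
        (Filter.Eventually.of_forall fun t => hΨb _)
    have hmap := integral_map hup.measurable.aemeasurable (hΨm.aestronglyMeasurable (μ :=
      Measure.map (fun p : (Fin N → Fin 2 × EuclideanSpace ℝ (Fin d)) ×
        ((Fin 2 × EuclideanSpace ℝ (Fin d)) × (Fin 2 × EuclideanSpace ℝ (Fin d))) =>
          Function.update (Function.update p.1 l p.2.1) q p.2.2)
        ((Measure.pi fun _ : Fin N => designLaw m).prod ((designLaw m).prod (designLaw m)))))
    rw [hup.map_eq] at hmap
    rw [hmap, integral_prod _ hint]
  rw [e1]
  refine (enorm_integral_le_lintegral_enorm _).trans ?_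
  refine (lintegral_mono_ae ((h.ae_pi_mem N).mono fun z hz =>
    h.enorm_integral_separatedTerm_le k hil hjq hiq hlj hlq hlQ hqQ (hz i) (hz j))).trans ?_
  have hRm : Measurable fun z : Fin N → Fin 2 × EuclideanSpace ℝ (Fin d) =>
      ∫⁻ p, ENNReal.ofReal (4 * A ^ 4 * (evenError 𝒳 (z i).2 p.1 * evenError 𝒳 (z j).2 p.2)) *
        (matchPositions k Q z i j).indicator 1 p ∂(volume.prod volume) := by
    refine Measurable.lintegral_prod_right' (f := fun r : (Fin N → Fin 2 ×
      EuclideanSpace ℝ (Fin d)) × (EuclideanSpace ℝ (Fin d) × EuclideanSpace ℝ (Fin d)) =>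
      ENNReal.ofReal (4 * A ^ 4 * (evenError 𝒳 (r.1 i).2 r.2.1 * evenError 𝒳 (r.1 j).2 r.2.2)) *
        (matchPositions k Q r.1 i j).indicator 1 r.2) ?_
    have m1 : Measurable fun r : (Fin N → Fin 2 × EuclideanSpace ℝ (Fin d)) ×
        (EuclideanSpace ℝ (Fin d) × EuclideanSpace ℝ (Fin d)) => ((r.1 i).2, r.2.1) := by fun_prop
    have m2 : Measurable fun r : (Fin N → Fin 2 × EuclideanSpace ℝ (Fin d)) ×
        (EuclideanSpace ℝ (Fin d) × EuclideanSpace ℝ (Fin d)) => ((r.1 j).2, r.2.2) := by fun_prop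
    exact ((((measurable_evenError 𝒳).comp m1).mul ((measurable_evenError 𝒳).comp m2)).const_mul
      _).ennreal_ofReal.mul (measurable_one.indicator (measurableSet_matchPositions k Q i j))
  have hpw := measurePreserving_piecewise (designLaw m) Q
  rw [← hpw.lintegral_comp hRm, lintegral_prod _ (by exact (hRm.comp hpw.measurable).aemeasurable)]
  refine (lintegral_mono_ae ((h.ae_pi_mem N).mono fun z hz =>
    h.lintegral_matchPositions_le hN hk hεd hQc hiQ hjQ (hz i) (hz j))).trans ?_
  rw [lintegral_const_mul' _ _ ENNReal.ofReal_ne_top]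
  have mM := measurable_evenMass 𝒳 (tailRate c) ε
  have mMi : ∀ p : Fin N, Measurable fun z : Fin N → Fin 2 × EuclideanSpace ℝ (Fin d) =>
      evenMass 𝒳 (tailRate c) ε (z p).2 := fun p => mM.comp (by fun_prop)
  have hb := hCb 𝒳 g m h ε hε
  have k1 := lintegral_mul_kernel_le (designLaw m) j (mMi i)
    (fun z t => by rw [Function.update_of_ne hij])
    (K := fun _ t => evenMass 𝒳 (tailRate c) ε t.2) (mM.comp (by fun_prop)) (fun _ _ => rfl)
    (fun _ => hb)
  have k2 := lintegral_mul_kernel_le (designLaw m) i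
    (measurable_one : Measurable (1 : (Fin N → Fin 2 × EuclideanSpace ℝ (Fin d)) → ENNReal))
    (fun z t => rfl)
    (K := fun _ t => evenMass 𝒳 (tailRate c) ε t.2) (mM.comp (by fun_prop)) (fun _ _ => rfl)
    (fun _ => hb)
  simp only [Pi.one_apply, one_mul, lintegral_const, measure_univ] at k2
  refine (mul_le_mul_right (k1.trans (mul_le_mul_left k2 _)) _).trans (le_of_eq ?_)
  rw [← ENNReal.ofReal_mul (by positivity), ← ENNReal.ofReal_mul (by positivity)]
  congr 1
  ring

end SeparatedIntegral

/-! ### The second moment of the bias -/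

section SecondMoment

variable {d : ℕ} {𝒳 : Set (EuclideanSpace ℝ (Fin d))} {D A c : ℝ}
  {g m : Fin 2 → EuclideanSpace ℝ (Fin d) → ℝ}

theorem abs_le_of_enorm_le {x C : ℝ} (hC : 0 ≤ C) (h : ‖x‖ₑ ≤ ENNReal.ofReal C) : |x| ≤ C := by
  rw [← ofReal_norm, ENNReal.ofReal_le_ofReal_iff hC] at h
  exact h

theorem matchTerm_self {N : ℕ} (k : ℕ) (i : Fin N)
    (z : Fin N → Fin 2 × EuclideanSpace ℝ (Fin d)) : matchTerm g k i i z = 0 := by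
  refine matchTerm_eq_zero fun h => ?_
  have h1 := h.1
  revert h1
  generalize (z i).1 = a
  fin_cases a <;> decide

/-- One bound for all quadruples. The indicators switch on the larger orders when indices coincide,
so that summing it amounts to counting coincidences. -/
theorem exists_abs_integral_matchTerm_mul_le (hd : 1 ≤ d) (hA : 0 < A) (hc : 0 < c) :
    ∃ C : ℝ, 0 < C ∧ ∀ (𝒳 : Set (EuclideanSpace ℝ (Fin d)))
      (g m : Fin 2 → EuclideanSpace ℝ (Fin d) → ℝ), RegularDesign 𝒳 D A c g m →
      ∀ [IsProbabilityMeasure (designLaw m)] (N k : ℕ), 8 ≤ N → 1 ≤ k → ∀ ε : ℝ, 0 < ε →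
      ε ^ d = k / N → ∀ i l j q : Fin N,
      |∫ z, matchTerm g k i l z * matchTerm g k j q z ∂(Measure.pi fun _ : Fin N => designLaw m)| ≤
        C * ((ε ^ d) ^ 2 * (ε ^ 4 + ε ^ (d + 2)) + (ε ^ (d + 1)) ^ 2 *
          ((if i = j then 1 else 0) + (if i = q then 1 else 0) + (if l = j then 1 else 0) +
            (if l = q then 1 else 0)) + ε ^ (d + 2) *
          ((if i = j then 1 else 0) * (if l = q then 1 else 0) +
            (if i = q then 1 else 0) * (if l = j then 1 else 0))) := by
  obtain ⟨C₁, hC₁, h₁⟩ := exists_integral_separatedTerm_le (D := D) hd hA hc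
  obtain ⟨C₂, hC₂, h₂⟩ := exists_lintegral_matchTerm_not_separated_le (D := D) hd hA hc
  obtain ⟨C₃, hC₃, h₃⟩ := exists_lintegral_matchTerm_mul_le (D := D) hd hA hc
  obtain ⟨C₄, hC₄, h₄⟩ := exists_lintegral_matchTerm_sq_le (D := D) hd hA hc
  refine ⟨C₁ + C₂ + C₃ + C₄, by positivity, ?_⟩
  intro 𝒳 g m h _ N k hN hk ε hε hεd i l j q
  set C := C₁ + C₂ + C₃ + C₄ with hC
  set I₁ : ℝ := (if i = j then 1 else 0) + (if i = q then 1 else 0) + (if l = j then 1 else 0) +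
    (if l = q then 1 else 0) with hI₁
  set I₂ : ℝ := (if i = j then 1 else 0) * (if l = q then 1 else 0) +
    (if i = q then 1 else 0) * (if l = j then 1 else 0) with hI₂
  have hI₁0 : 0 ≤ I₁ := by positivity
  have hI₂0 : 0 ≤ I₂ := by positivity
  have hC0 : 0 < C := by positivity
  have hA0 : 0 ≤ (ε ^ d) ^ 2 * (ε ^ 4 + ε ^ (d + 2)) := by positivity
  by_cases hil : i = l
  · subst hil
    simp only [matchTerm_self, zero_mul, integral_zero, abs_zero]
    positivity
  by_cases hjq : j = q
  · subst hjq
    simp only [matchTerm_self, mul_zero, integral_zero, abs_zero]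
    positivity
  by_cases hsame : (i = j ∧ l = q) ∨ (i = q ∧ l = j)
  · have hb := abs_le_of_enorm_le (by positivity) ((enorm_integral_le_lintegral_enorm _).trans
      (h₄ 𝒳 g m h N k hN hk ε hε hεd i l j q hil hsame))
    have h1 : 1 ≤ I₂ := by
      rcases hsame with ⟨e1, e2⟩ | ⟨e1, e2⟩
      · have : (0 : ℝ) ≤ (if i = q then 1 else 0) * (if l = j then 1 else 0) := by positivity
        rw [hI₂, if_pos e1, if_pos e2]; linarith
      · have : (0 : ℝ) ≤ (if i = j then 1 else 0) * (if l = q then 1 else 0) := by positivity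
        rw [hI₂, if_pos e1, if_pos e2]; linarith
    refine hb.trans ?_
    have hε2 : 0 ≤ ε ^ (d + 2) := by positivity
    calc C₄ * ε ^ (d + 2) ≤ C * (0 + 0 + ε ^ (d + 2) * 1) := by
          rw [zero_add, zero_add, mul_one]; gcongr; linarith
      _ ≤ _ := by gcongr; positivity
  by_cases hshare : i = j ∨ i = q ∨ l = j ∨ l = q
  · have hb := abs_le_of_enorm_le (by positivity) ((enorm_integral_le_lintegral_enorm _).trans
      (h₃ 𝒳 g m h N k hN hk ε hε hεd i l j q hil hjq (fun hh => hsame (Or.inl hh))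
        (fun hh => hsame (Or.inr hh))))
    have n1 : (0 : ℝ) ≤ if i = j then 1 else 0 := by positivity
    have n2 : (0 : ℝ) ≤ if i = q then 1 else 0 := by positivity
    have n3 : (0 : ℝ) ≤ if l = j then 1 else 0 := by positivity
    have n4 : (0 : ℝ) ≤ if l = q then 1 else 0 := by positivity
    have h1 : 1 ≤ I₁ := by
      rcases hshare with e | e | e | e <;> rw [hI₁, if_pos e] <;> linarith
    refine hb.trans ?_
    calc C₃ * (ε ^ (d + 1)) ^ 2 ≤ C * (0 + (ε ^ (d + 1)) ^ 2 * 1 + 0) := by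
          rw [zero_add, add_zero, mul_one]; gcongr; linarith
      _ ≤ _ := by gcongr; positivity
  · simp only [not_or] at hshare
    obtain ⟨hij, hiq, hlj, hlq⟩ := hshare
    have hS := measurableSet_separated (d := d) i l j q
    have b1 := abs_le_of_enorm_le (by positivity)
      (h₁ 𝒳 g m h N k hN hk ε hε hεd i l j q hil hjq hij hiq hlj hlq)
    have b2 := abs_le_of_enorm_le (by positivity) ((enorm_integral_le_lintegral_enorm _).trans
      (h₂ 𝒳 g m h N k hN hk ε hε hεd i l j q hil hjq hij hiq hlj hlq))
    have hint : Integrable (fun z => matchTerm g k i l z * matchTerm g k j q z)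
        (Measure.pi fun _ : Fin N => designLaw m) := by
      refine Integrable.of_bound ((measurable_matchTerm h.measurable_g k i l).mul
        (measurable_matchTerm h.measurable_g k j q)).aestronglyMeasurable (2 * A * (2 * A))
        (Filter.Eventually.of_forall fun z => ?_)
      rw [norm_mul]
      exact mul_le_mul (h.abs_matchTerm_le k i l z) (h.abs_matchTerm_le k j q z) (abs_nonneg _)
        (by positivity)
    have hsplit := integral_add_compl hS hint
    unfold separatedTerm at b1
    rw [integral_indicator hS] at b1
    rw [← hsplit]
    refine (abs_add_le _ _).trans ((add_le_add b1 b2).trans ?_)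
    have e1 : (ε ^ (d + 2)) ^ 2 = (ε ^ d) ^ 2 * ε ^ 4 := by ring
    have e2 : ε ^ (d + 1) * ε ^ (d + 1) * ε ^ d = (ε ^ d) ^ 2 * ε ^ (d + 2) := by ring
    rw [e1, e2]
    have p1 : 0 ≤ (ε ^ d) ^ 2 * ε ^ 4 := by positivity
    have p2 : 0 ≤ (ε ^ d) ^ 2 * ε ^ (d + 2) := by positivity
    calc C₁ * ((ε ^ d) ^ 2 * ε ^ 4) + C₂ * ((ε ^ d) ^ 2 * ε ^ (d + 2)) ≤
          C * ((ε ^ d) ^ 2 * ε ^ 4) + C * ((ε ^ d) ^ 2 * ε ^ (d + 2)) := by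
            gcongr <;> linarith
      _ = C * ((ε ^ d) ^ 2 * (ε ^ 4 + ε ^ (d + 2)) + 0 + 0) := by ring
      _ ≤ _ := by gcongr <;> positivity

/-- The normalized sum of all contributions of matches. -/
noncomputable def matchSum (g : Fin 2 → EuclideanSpace ℝ (Fin d) → ℝ) {N : ℕ} (k : ℕ)
    (z : Fin N → Fin 2 × EuclideanSpace ℝ (Fin d)) : ℝ :=
  (1 / ((N : ℝ) * k)) * ∑ i, ∑ l, matchTerm g k i l z

/-- The three kinds of terms have total weights N⁴, 4N³ and 2N². Dividing by (Nk)² with k = N ε^d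
turns them into ε⁴ + ε^(d+2), 4ε²/N and 2ε^(d+2)/k²; as k ≥ 1, both ε²/N and ε^(d+2)/k² are at most
ε^(d+2). -/
theorem exists_integral_matchSum_sq_le (hd : 1 ≤ d) (hA : 0 < A) (hc : 0 < c) :
    ∃ C : ℝ, 0 < C ∧ ∀ (𝒳 : Set (EuclideanSpace ℝ (Fin d)))
      (g m : Fin 2 → EuclideanSpace ℝ (Fin d) → ℝ), RegularDesign 𝒳 D A c g m →
      ∀ [IsProbabilityMeasure (designLaw m)] (N k : ℕ), 8 ≤ N → 1 ≤ k → ∀ ε : ℝ, 0 < ε →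
      ε ^ d = k / N →
      Integrable (fun z => matchSum g k z ^ 2) (Measure.pi fun _ : Fin N => designLaw m) ∧
      ∫ z, matchSum g k z ^ 2 ∂(Measure.pi fun _ : Fin N => designLaw m) ≤
        C * (ε ^ 4 + ε ^ (d + 2)) := by
  obtain ⟨C, hC, hCb⟩ := exists_abs_integral_matchTerm_mul_le (D := D) hd hA hc
  -- 7 = 1 + 4 + 2, for generic quadruples, those sharing a unit and those with equal pairs.
  refine ⟨7 * C, by positivity, ?_⟩
  intro 𝒳 g m h _ N k hN hk ε hε hεd
  set P := Measure.pi fun _ : Fin N => designLaw m with hP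
  have hint : ∀ i l j q : Fin N, Integrable (fun z => matchTerm g k i l z * matchTerm g k j q z) P := by
    intro i l j q
    refine Integrable.of_bound ((measurable_matchTerm h.measurable_g k i l).mul
      (measurable_matchTerm h.measurable_g k j q)).aestronglyMeasurable (2 * A * (2 * A))
      (Filter.Eventually.of_forall fun z => ?_)
    rw [norm_mul]
    exact mul_le_mul (h.abs_matchTerm_le k i l z) (h.abs_matchTerm_le k j q z) (abs_nonneg _)
      (by positivity)
  have hsq : ∀ z : Fin N → Fin 2 × EuclideanSpace ℝ (Fin d), matchSum g k z ^ 2 =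
      (1 / ((N : ℝ) * k)) ^ 2 *
        ∑ i, ∑ j, ∑ l, ∑ q, matchTerm g k i l z * matchTerm g k j q z := by
    intro z
    unfold matchSum
    rw [mul_pow, sq (∑ i, ∑ l, matchTerm g k i l z), Finset.sum_mul_sum]
    simp only [Finset.sum_mul_sum]
  have hint4 : Integrable (fun z => ∑ i, ∑ j, ∑ l, ∑ q,
      matchTerm g k i l z * matchTerm g k j q z) P :=
    integrable_finsetSum _ fun i _ => integrable_finsetSum _ fun j _ =>
      integrable_finsetSum _ fun l _ => integrable_finsetSum _ fun q _ => hint i l j q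
  simp only [hsq]
  refine ⟨hint4.const_mul _, ?_⟩
  rw [integral_const_mul, integral_finsetSum _ fun i _ => integrable_finsetSum _ fun j _ =>
    integrable_finsetSum _ fun l _ => integrable_finsetSum _ fun q _ => hint i l j q]
  have hsum : ∑ i, ∫ z, ∑ j, ∑ l, ∑ q, matchTerm g k i l z * matchTerm g k j q z ∂P =
      ∑ i, ∑ j, ∑ l, ∑ q, ∫ z, matchTerm g k i l z * matchTerm g k j q z ∂P := by
    refine Finset.sum_congr rfl fun i _ => ?_
    rw [integral_finsetSum _ fun j _ => integrable_finsetSum _ fun l _ =>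
      integrable_finsetSum _ fun q _ => hint i l j q]
    refine Finset.sum_congr rfl fun j _ => ?_
    rw [integral_finsetSum _ fun l _ => integrable_finsetSum _ fun q _ => hint i l j q]
    refine Finset.sum_congr rfl fun l _ => ?_
    rw [integral_finsetSum _ fun q _ => hint i l j q]
  have hle : ∑ i, ∑ j, ∑ l, ∑ q, ∫ z, matchTerm g k i l z * matchTerm g k j q z ∂P ≤
      C * ((N : ℝ) ^ 4 * ((ε ^ d) ^ 2 * (ε ^ 4 + ε ^ (d + 2))) +
        4 * (N : ℝ) ^ 3 * (ε ^ (d + 1)) ^ 2 + 2 * (N : ℝ) ^ 2 * ε ^ (d + 2)) := by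
    refine (Finset.sum_le_sum fun i _ => Finset.sum_le_sum fun j _ => Finset.sum_le_sum fun l _ =>
      Finset.sum_le_sum fun q _ => (le_abs_self _).trans
        (hCb 𝒳 g m h N k hN hk ε hε hεd i l j q)).trans (le_of_eq ?_)
    simp only [← Finset.mul_sum, Finset.sum_add_distrib, Finset.sum_const, Finset.card_univ,
      Fintype.card_fin, nsmul_eq_mul, Finset.sum_ite_eq, Finset.mem_univ, if_true, mul_one]
    simp only [← Finset.sum_mul, Finset.sum_ite_eq, Finset.mem_univ, if_true, one_mul]
    simp only [Finset.sum_ite_eq', Finset.sum_const, Finset.mem_univ, if_true,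
      Finset.card_univ, Fintype.card_fin, nsmul_eq_mul, mul_one]
    ring
  rw [hsum]
  have hN0 : (0 : ℝ) < N := by positivity
  have hk0 : (0 : ℝ) < k := by positivity
  have hk1 : (1 : ℝ) ≤ k := by exact_mod_cast hk
  have hkN : (k : ℝ) = N * ε ^ d := by rw [hεd]; field_simp
  refine (mul_le_mul_of_nonneg_left hle (by positivity)).trans ?_
  have hεd0 : 0 < ε ^ d := by positivity
  have e : (1 / ((N : ℝ) * k)) ^ 2 * (C * ((N : ℝ) ^ 4 * ((ε ^ d) ^ 2 * (ε ^ 4 + ε ^ (d + 2))) +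
        4 * (N : ℝ) ^ 3 * (ε ^ (d + 1)) ^ 2 + 2 * (N : ℝ) ^ 2 * ε ^ (d + 2))) =
      C * ((ε ^ 4 + ε ^ (d + 2)) + 4 * (ε ^ 2 / N) + 2 * (ε ^ (d + 2) / k ^ 2)) := by
    have h1 : (1 / ((N : ℝ) * k)) ^ 2 * ((N : ℝ) ^ 4 * ((ε ^ d) ^ 2 * (ε ^ 4 + ε ^ (d + 2)))) =
        ε ^ 4 + ε ^ (d + 2) := by
      rw [hkN]; field_simp
    have h2 : (1 / ((N : ℝ) * k)) ^ 2 * (4 * (N : ℝ) ^ 3 * (ε ^ (d + 1)) ^ 2) = 4 * (ε ^ 2 / N) := by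
      rw [hkN, pow_succ ε d]; field_simp
    have h3 : (1 / ((N : ℝ) * k)) ^ 2 * (2 * (N : ℝ) ^ 2 * ε ^ (d + 2)) =
        2 * (ε ^ (d + 2) / k ^ 2) := by
      field_simp
    linear_combination C * h1 + C * h2 + C * h3
  rw [e]
  have t1 : ε ^ 2 / N ≤ ε ^ (d + 2) := by
    rw [pow_add, hεd, div_mul_eq_mul_div, mul_comm]
    gcongr
    nlinarith [sq_nonneg ε]
  have t2 : ε ^ (d + 2) / k ^ 2 ≤ ε ^ (d + 2) :=
    div_le_self (by positivity) (by nlinarith)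
  have t3 : 0 ≤ ε ^ 4 := by positivity
  have : (ε ^ 4 + ε ^ (d + 2)) + 4 * (ε ^ 2 / N) + 2 * (ε ^ (d + 2) / k ^ 2) ≤
      7 * (ε ^ 4 + ε ^ (d + 2)) := by linarith
  nlinarith

/-- The tail bound at radius `D`, with the whole space in place of a ball, decays exponentially in
ε^(−d). Only a fourth power of this decay is needed. -/
theorem RegularDesign.measure_card_lt_le (h : RegularDesign 𝒳 D A c g m) (hd : 1 ≤ d)
    [IsProbabilityMeasure (designLaw m)] {N k : ℕ} (hN : 8 ≤ N) (hk : 1 ≤ k) {ε : ℝ} (hε : 0 < ε)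
    (hε1 : ε ≤ 1) (hεd : ε ^ d = k / N) (a : Fin 2) :
    (Measure.pi fun _ : Fin N => designLaw m).real
        {z | (treatmentGroup (fun p => (z p).1) a).card < k} ≤
      Real.exp 1 * (16 / (tailRate c * D ^ d) ^ 4) * ε ^ 4 := by
  classical
  have hD := h.D_pos
  have hθ := tailRate_pos h.c_pos
  have h1 := h.measure_count_le hN hk hεd ∅ (by simp) a MeasurableSet.univ hD.le
    (by rw [setLIntegral_univ]; exact h.total_mass a)
  have hset : {z : Fin N → Fin 2 × EuclideanSpace ℝ (Fin d) |
      (treatmentGroup (fun p => (z p).1) a).card < k} =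
      {z | ({p | p ∉ (∅ : Finset (Fin N)) ∧
        z p ∈ ({a} : Set (Fin 2)) ×ˢ Set.univ} : Finset (Fin N)).card < k} := by
    ext z
    simp [treatmentGroup]
  have h2 : (Measure.pi fun _ : Fin N => designLaw m)
      {z | (treatmentGroup (fun p => (z p).1) a).card < k} ≤
      ENNReal.ofReal (Real.exp (1 - 2 * (tailRate c * (D / ε) ^ d))) := by
    rw [hset]; convert h1
  rw [measureReal_def]
  refine (ENNReal.toReal_le_of_le_ofReal (Real.exp_pos _).le h2).trans ?_
  set y := tailRate c * (D / ε) ^ d with hy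
  have hy0 : 0 < y := by positivity
  -- From exp(2y) = exp(y/2)⁴ ≥ (y/2)⁴.
  have hexp : Real.exp (-(2 * y)) ≤ 16 / y ^ 4 := by
    have e1 : Real.exp (2 * y) = Real.exp (y / 2) ^ 4 := by
      rw [← Real.exp_nat_mul]; congr 1; push_cast; ring
    have e2 : y / 2 ≤ Real.exp (y / 2) := by linarith [Real.add_one_le_exp (y / 2)]
    have e3 : (y / 2) ^ 4 ≤ Real.exp (2 * y) := by rw [e1]; gcongr
    rw [Real.exp_neg, inv_eq_one_div, div_le_div_iff₀ (Real.exp_pos _) (by positivity)]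
    have : (y / 2) ^ 4 = y ^ 4 / 16 := by ring
    linarith
  rw [sub_eq_add_neg, Real.exp_add, mul_assoc]
  refine mul_le_mul_of_nonneg_left (hexp.trans ?_) (Real.exp_pos _).le
  have e4 : 16 / y ^ 4 = 16 / (tailRate c * D ^ d) ^ 4 * (ε ^ d) ^ 4 := by
    rw [hy, div_pow]; field_simp
  rw [e4]
  have e5 : ε ^ d ≤ ε := pow_le_of_le_one hε.le hε1 (by omega)
  gcongr

theorem exists_integral_pairBias_sq_le (hd : 1 ≤ d) (hD : 0 < D) (hA : 0 < A) (hc : 0 < c) :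
    ∃ C : ℝ, 0 < C ∧ ∀ (𝒳 : Set (EuclideanSpace ℝ (Fin d)))
      (g m : Fin 2 → EuclideanSpace ℝ (Fin d) → ℝ), RegularDesign 𝒳 D A c g m →
      ∀ [IsProbabilityMeasure (designLaw m)] (N k : ℕ), 1 ≤ k → k ≤ N →
      ∫ z, pairBias g k z ^ 2 ∂(Measure.pi fun _ : Fin N => designLaw m) ≤
        C * ((k : ℝ) / (N : ℝ)) ^ (min (3 : ℝ) (4 / (d : ℝ))) := by
  obtain ⟨C, hC, hCb⟩ := exists_integral_matchSum_sq_le (D := D) hd hA hc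
  have hθ := tailRate_pos hc
  set K := Real.exp 1 * (16 / (tailRate c * D ^ d) ^ 4) with hK
  have hK0 : 0 < K := by positivity
  -- The summands serve, in order, the match sum, the samples with a group of fewer than `k` units
  -- (one `K` for each treatment), and N < 8.
  refine ⟨2 * C + (2 * A) ^ 2 * (2 * K) + (2 * A) ^ 2 * 512, by positivity, ?_⟩
  intro 𝒳 g m h _ N k hk hkN
  set P := Measure.pi fun _ : Fin N => designLaw m with hP
  set t : ℝ := (k : ℝ) / (N : ℝ) with ht
  have hN0 : (0 : ℝ) < N := by have : 0 < N := by omega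
                               exact_mod_cast this
  have hk1 : (1 : ℝ) ≤ k := by exact_mod_cast hk
  have hkN' : (k : ℝ) ≤ N := by exact_mod_cast hkN
  have ht0 : 0 < t := by positivity
  have ht1 : t ≤ 1 := by rw [ht, div_le_one hN0]; exact hkN'
  have hbound : ∀ z : Fin N → Fin 2 × EuclideanSpace ℝ (Fin d),
      pairBias g k z ^ 2 ≤ (2 * A) ^ 2 := fun z =>
    sq_le_sq' (abs_le.mp (abs_pairBias_le g hk hA.le h.abs_g_le z)).1
      (abs_le.mp (abs_pairBias_le g hk hA.le h.abs_g_le z)).2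
  have hintB : Integrable (fun z => pairBias g k z ^ 2) P := by
    refine Integrable.of_bound ((measurable_pairBias h.measurable_g k).pow_const
      2).aestronglyMeasurable ((2 * A) ^ 2) (Filter.Eventually.of_forall fun z => ?_)
    rw [Real.norm_eq_abs, abs_of_nonneg (sq_nonneg _)]
    exact hbound z
  set e := min (3 : ℝ) (4 / (d : ℝ)) with he
  have hte : 0 ≤ t ^ e := by positivity
  by_cases hN : 8 ≤ N
  · set ε : ℝ := t ^ ((d : ℝ)⁻¹) with hε
    have hε0 : 0 < ε := Real.rpow_pos_of_pos ht0 _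
    have hε1 : ε ≤ 1 := Real.rpow_le_one ht0.le ht1 (by positivity)
    have hεd : ε ^ d = t := Real.rpow_inv_natCast_pow ht0.le (by omega)
    have hpow : ∀ n : ℕ, ε ^ n = t ^ ((n : ℝ) / d) := fun n => by
      rw [hε, ← Real.rpow_natCast, ← Real.rpow_mul ht0.le]
      congr 1
      rw [inv_mul_eq_div]
    have hd0 : (0 : ℝ) < d := by exact_mod_cast hd
    have hp4 : ε ^ 4 ≤ t ^ e := by
      rw [hpow]
      exact Real.rpow_le_rpow_of_exponent_ge ht0 ht1 (by exact_mod_cast min_le_right _ _)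
    have hpd : ε ^ (d + 2) ≤ t ^ e := by
      rw [hpow]
      refine Real.rpow_le_rpow_of_exponent_ge ht0 ht1 ?_
      rw [le_div_iff₀ hd0]
      push_cast
      -- 1 + 2/d ≥ 4/d holds for d ≥ 2. For d = 1 it fails, and 1 + 2/d = 3 is the other entry of
      -- the minimum.
      rcases hd.lt_or_eq with h2 | h2
      · have h2' : (2 : ℝ) ≤ d := by exact_mod_cast h2
        have : e * d ≤ 4 / d * d := by gcongr; exact min_le_right _ _
        rw [div_mul_cancel₀ _ hd0.ne'] at this
        linarith
      · have : (d : ℝ) = 1 := by rw [← h2]; norm_num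
        rw [this]
        linarith [min_le_left (3 : ℝ) (4 / (d : ℝ))]
    obtain ⟨hintS, hS⟩ := hCb 𝒳 g m h N k hN hk ε hε0 hεd
    set M : Set (Fin N → Fin 2 × EuclideanSpace ℝ (Fin d)) :=
      ⋃ a, {z | (treatmentGroup (fun p => (z p).1) a).card < k} with hM
    have hMm : MeasurableSet M := by
      refine MeasurableSet.iUnion fun a => measurableSet_lt (g := fun _ => k) ?_ measurable_const
      unfold treatmentGroup
      exact measurable_card_filter fun p => measurableSet_eq_fun (by fun_prop) measurable_const
    have hMP : P.real M ≤ 2 * K * ε ^ 4 := by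
      refine (measureReal_iUnion_fintype_le _).trans ?_
      refine (Finset.sum_le_card_nsmul _ _ _ fun a _ =>
        h.measure_card_lt_le hd hN hk hε0 hε1 hεd a).trans (le_of_eq ?_)
      rw [Finset.card_univ, Fintype.card_fin, nsmul_eq_mul, hK]
      push_cast
      ring
    have hpt : ∀ z, pairBias g k z ^ 2 ≤ matchSum g k z ^ 2 +
        M.indicator (fun _ => (2 * A) ^ 2) z := by
      intro z
      by_cases hz : z ∈ M
      · rw [Set.indicator_of_mem hz]
        linarith [hbound z, sq_nonneg (matchSum g k z)]
      · rw [Set.indicator_of_notMem hz, add_zero]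
        have hz' : ∀ a, k ≤ (treatmentGroup (fun p => (z p).1) a).card := fun a => by
          by_contra hcon
          exact hz (Set.mem_iUnion.mpr ⟨a, not_le.mp hcon⟩)
        rw [pairBias_eq_sum_matchTerm g hk z hz']
        rfl
    have hintM : Integrable (M.indicator fun _ => (2 * A) ^ 2) P :=
      (integrable_const _).indicator hMm
    have hfin := integral_mono hintB (hintS.add hintM) hpt
    simp only [Pi.add_apply] at hfin
    rw [integral_add hintS hintM, integral_indicator hMm, setIntegral_const, smul_eq_mul] at hfin
    refine hfin.trans ?_
    have s1 : C * (ε ^ 4 + ε ^ (d + 2)) ≤ C * (t ^ e + t ^ e) := by gcongr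
    have s2 : P.real M * (2 * A) ^ 2 ≤ 2 * K * t ^ e * (2 * A) ^ 2 := by
      refine mul_le_mul_of_nonneg_right (hMP.trans ?_) (by positivity)
      gcongr
    have s3 : 0 ≤ (2 * A) ^ 2 * 512 * t ^ e := by positivity
    linarith
  -- For N < 8 the ratio t is at least 1/8 and the exponent at most 3, so t^e ≥ 1/512 and the
  -- trivial bound is enough.
  · have h1 : ∫ z, pairBias g k z ^ 2 ∂P ≤ (2 * A) ^ 2 := by
      have := integral_mono hintB (integrable_const ((2 * A) ^ 2)) hbound
      rwa [integral_const, probReal_univ, one_smul] at this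
    have hN8 : (N : ℝ) ≤ 8 := by have : N ≤ 8 := by omega
                                 exact_mod_cast this
    have ht8 : 1 / 8 ≤ t := by
      rw [ht, div_le_div_iff₀ (by norm_num) hN0]; linarith
    have h2 : (1 : ℝ) / 512 ≤ t ^ e := by
      have : t ^ (3 : ℝ) ≤ t ^ e := Real.rpow_le_rpow_of_exponent_ge ht0 ht1 (min_le_left _ _)
      refine le_trans ?_ this
      rw [show (3 : ℝ) = ((3 : ℕ) : ℝ) by norm_num, Real.rpow_natCast]
      calc (1 : ℝ) / 512 = (1 / 8) ^ 3 := by norm_num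
        _ ≤ t ^ 3 := by gcongr
    have s1 : (2 * A) ^ 2 ≤ (2 * A) ^ 2 * 512 * t ^ e := by
      have : 0 ≤ (2 * A) ^ 2 := by positivity
      nlinarith
    have s2 : 0 ≤ (2 * C + (2 * A) ^ 2 * (2 * K)) * t ^ e := by positivity
    linarith

end SecondMoment

/-! ### Uniform Taylor bounds on compact sets -/

section Smooth

/-- The mean value inequality needs segments, and `K` need not be convex. Finitely many polytopes
inside `U` cover `K`; the hull of all their vertices is compact, being the hull of a finite set, and
lies in `U` by convexity. -/
theorem IsCompact.exists_convex_between {E : Type*} [NormedAddCommGroup E] [NormedSpace ℝ E]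
    [FiniteDimensional ℝ E] {K U : Set E} (hK : IsCompact K) (hU : IsOpen U)
    (hUc : Convex ℝ U) (hKU : K ⊆ U) : ∃ S, IsCompact S ∧ Convex ℝ S ∧ K ⊆ S ∧ S ⊆ U := by
  classical
  have hb : ∀ x ∈ K, ∃ b : Set E, b.Finite ∧ x ∈ interior (convexHull ℝ b) ∧
      convexHull ℝ b ⊆ U := fun x hx => by
    obtain ⟨b, hxb, hbU⟩ := exists_mem_interior_convexHull_affineBasis (hU.mem_nhds (hKU hx))
    exact ⟨_, Set.finite_range b, hxb, hbU⟩
  choose! b hbf hxb hbU using hb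
  obtain ⟨t, htK, ht⟩ := hK.elim_nhds_subcover (fun x => interior (convexHull ℝ (b x)))
    fun x hx => isOpen_interior.mem_nhds (hxb x hx)
  refine ⟨convexHull ℝ (⋃ x ∈ t, b x),
    (t.finite_toSet.biUnion fun x hx => hbf x (htK x hx)).isCompact_convexHull ℝ,
    convex_convexHull ℝ _, ht.trans (Set.iUnion₂_subset fun x hx => interior_subset.trans
      (convexHull_mono (Set.subset_biUnion_of_mem (u := b) hx))), ?_⟩
  exact convexHull_min (Set.iUnion₂_subset fun x hx =>
    (subset_convexHull ℝ _).trans (hbU x (htK x hx))) hUc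

theorem exists_taylor_bound {E : Type*} [NormedAddCommGroup E] [NormedSpace ℝ E]
    [FiniteDimensional ℝ E] {K U : Set E} {G : E → ℝ} (hK : IsCompact K) (hU : IsOpen U)
    (hUc : Convex ℝ U) (hKU : K ⊆ U) (hG : ContDiffOn ℝ 2 G U) :
    ∃ B : ℝ, 0 < B ∧ (∀ x ∈ K, |G x| ≤ B) ∧ (∀ x ∈ K, ‖fderiv ℝ G x‖ ≤ B) ∧
      (∀ x ∈ K, ∀ y ∈ K, |G x - G y| ≤ B * dist x y) ∧
      ∀ x ∈ K, ∀ y ∈ K, |G y - G x - fderiv ℝ G x (y - x)| ≤ B * dist x y ^ 2 := by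
  obtain ⟨S, hS, hSc, hKS, hbU⟩ := hK.exists_convex_between hU hUc hKU
  have hG' : ContDiffOn ℝ 1 (fderiv ℝ G) U := hG.fderiv_of_isOpen hU (by norm_num)
  have hdG : ∀ x ∈ S, DifferentiableAt ℝ G x := fun x hx =>
    (hG.differentiableOn (by norm_num)).differentiableAt (hU.mem_nhds (hbU hx))
  have hdG' : ∀ x ∈ S, DifferentiableAt ℝ (fderiv ℝ G) x := fun x hx =>
    (hG'.differentiableOn (by norm_num)).differentiableAt (hU.mem_nhds (hbU hx))
  obtain ⟨B₀, h₀⟩ := hS.exists_bound_of_continuousOn (hG.continuousOn.mono hbU)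
  obtain ⟨B₁, h₁⟩ := hS.exists_bound_of_continuousOn (hG'.continuousOn.mono hbU)
  obtain ⟨B₂, h₂⟩ := hS.exists_bound_of_continuousOn
    ((hG'.continuousOn_fderiv_of_isOpen hU le_rfl).mono hbU)
  have k₀ : B₀ ≤ 1 + |B₀| + |B₁| + |B₂| := by
    linarith [le_abs_self B₀, abs_nonneg B₁, abs_nonneg B₂]
  have k₁ : B₁ ≤ 1 + |B₀| + |B₁| + |B₂| := by
    linarith [le_abs_self B₁, abs_nonneg B₀, abs_nonneg B₂]
  have k₂ : B₂ ≤ 1 + |B₀| + |B₁| + |B₂| := by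
    linarith [le_abs_self B₂, abs_nonneg B₁, abs_nonneg B₀]
  refine ⟨1 + |B₀| + |B₁| + |B₂|, by positivity, fun x hx => (h₀ x (hKS hx)).trans k₀,
    fun x hx => (h₁ x (hKS hx)).trans k₁, fun x hx y hy => ?_, fun x hx y hy => ?_⟩
  · rw [dist_eq_norm, ← Real.norm_eq_abs]
    exact hSc.norm_image_sub_le_of_norm_fderiv_le hdG (fun z hz => (h₁ z hz).trans k₁)
      (hKS hy) (hKS hx)
  -- On the ball of radius |x − y| the derivative varies by at most a constant times |x − y|; the
  -- mean value inequality there gives the quadratic remainder.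
  · have hb : ∀ z ∈ S ∩ Metric.closedBall x (dist x y),
        ‖fderiv ℝ G z - fderiv ℝ G x‖ ≤ (1 + |B₀| + |B₁| + |B₂|) * dist x y := fun z hz => by
      refine (hSc.norm_image_sub_le_of_norm_fderiv_le hdG' (fun z hz => (h₂ z hz).trans k₂)
        (hKS hx) hz.1).trans ?_
      rw [← dist_eq_norm]
      exact mul_le_mul_of_nonneg_left (Metric.mem_closedBall.1 hz.2) (by positivity)
    have := (hSc.inter (convex_closedBall x _)).norm_image_sub_le_of_norm_fderiv_le'
      (fun z hz => hdG z hz.1) hb (x := x) (y := y) ⟨hKS hx, by simp⟩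
      ⟨hKS hy, by simp [dist_comm]⟩
    rwa [← dist_eq_norm y x, dist_comm y x, mul_assoc, ← sq] at this

end Smooth

/-! ### The joint law of treatment and covariate under the assumptions -/

section Model

variable {d : ℕ} {𝒳 : Set (EuclideanSpace ℝ (Fin d))} {η : ℝ}
  {g f : Fin 2 → EuclideanSpace ℝ (Fin d) → ℝ} {Ω : Type*} [MeasurableSpace Ω]
  {P : Measure Ω} {W : Ω → Fin 2}
  {X : Ω → EuclideanSpace ℝ (Fin d)} {Y : Fin 2 → Ω → ℝ}

namespace MatchingAssumptions

theorem ae_mem_support (h : MatchingAssumptions 𝒳 η g f P W X Y) : ∀ᵐ ω ∂P, X ω ∈ 𝒳 := by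
  have : ∀ᵐ x ∂(P.map X), x ∈ 𝒳 := h.support_eq ▸ Measure.support_mem_ae
  exact ae_of_ae_map h.measurable_covariate.aemeasurable this

theorem measurableSet_treatment (h : MatchingAssumptions 𝒳 η g f P W X Y) (a : Fin 2) :
    MeasurableSet (W ⁻¹' {a}) := h.measurable_treatment (measurableSet_singleton a)

theorem exists_volume_le (h : MatchingAssumptions 𝒳 η g f P W X Y) :
    ∃ lo : ℝ, 0 < lo ∧ ∀ A, MeasurableSet A →
      ENNReal.ofReal lo * volume (A ∩ 𝒳) ≤ P (X ⁻¹' A) := by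
  obtain ⟨p, hp, lo, hi, hlo, -, hb⟩ := h.density_bounds
  refine ⟨lo, hlo, fun A hA => ?_⟩
  have hX : MeasurableSet 𝒳 := h.compact_support.measurableSet
  rw [← Measure.map_apply h.measurable_covariate hA, hp.2.2, withDensity_apply _ hA]
  calc ENNReal.ofReal lo * volume (A ∩ 𝒳) = ∫⁻ _ in A ∩ 𝒳, ENNReal.ofReal lo := by
        rw [setLIntegral_const]
    _ ≤ ∫⁻ x in A ∩ 𝒳, ENNReal.ofReal (p x) := by
        refine lintegral_mono_ae ?_
        filter_upwards [ae_mono (Measure.restrict_mono_set volume Set.inter_subset_right) hb]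
          with x hx
        exact ENNReal.ofReal_le_ofReal hx.1
    _ ≤ _ := lintegral_mono_set Set.inter_subset_left

theorem measure_preimage_inter_support (h : MatchingAssumptions 𝒳 η g f P W X Y) (B : Set Ω)
    (A : Set (EuclideanSpace ℝ (Fin d))) : P (B ∩ X ⁻¹' (A ∩ 𝒳)) = P (B ∩ X ⁻¹' A) := by
  refine measure_congr ?_
  filter_upwards [h.ae_mem_support] with ω hω
  refine propext ?_
  change (ω ∈ B ∧ X ω ∈ A ∧ X ω ∈ 𝒳) ↔ (ω ∈ B ∧ X ω ∈ A)
  tauto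

variable [IsProbabilityMeasure P]

theorem measure_treatment_inter (h : MatchingAssumptions 𝒳 η g f P W X Y) (a : Fin 2)
    {A : Set (EuclideanSpace ℝ (Fin d))} (hA : MeasurableSet A) :
    P (W ⁻¹' {a} ∩ X ⁻¹' A) = P (W ⁻¹' {a}) * ∫⁻ x in A, ENNReal.ofReal (f a x) := by
  have h1 := congrArg (fun ν => ν A) (h.group_density a).2.2
  simp only [withDensity_apply _ hA, Measure.map_apply h.measurable_covariate hA,
    cond_apply (h.measurableSet_treatment a)] at h1
  rw [← h1]
  rcases eq_or_ne (P (W ⁻¹' {a})) 0 with h0 | h0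
  · rw [h0, zero_mul]
    exact measure_mono_null Set.inter_subset_left h0
  · rw [← mul_assoc, ENNReal.mul_inv_cancel h0 (measure_ne_top _ _), one_mul]

/-- The bounds on the conditional treatment probability are integrated over {X ∈ A}; the controls
are handled through the complement. -/
theorem overlap_le (h : MatchingAssumptions 𝒳 η g f P W X Y) (a : Fin 2)
    {A : Set (EuclideanSpace ℝ (Fin d))} (hA : MeasurableSet A) :
    η * P.real (X ⁻¹' A) ≤ P.real (W ⁻¹' {a} ∩ X ⁻¹' A) := by
  have hm := h.measurable_covariate.comap_le
  have hAm : MeasurableSet[MeasurableSpace.comap X inferInstance] (X ⁻¹' A) := ⟨A, hA, rfl⟩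
  have hW := h.measurableSet_treatment 1
  have hint : Integrable ((W ⁻¹' {1}).indicator fun _ => (1 : ℝ)) P :=
    (integrable_const 1).indicator hW
  have heq := setIntegral_condExp hm hint hAm
  rw [setIntegral_indicator hW, setIntegral_const, smul_eq_mul, mul_one, Set.inter_comm] at heq
  have hc {r : ℝ} : ∫ _ω in X ⁻¹' A, r ∂P = r * P.real (X ⁻¹' A) := by
    rw [setIntegral_const, smul_eq_mul, mul_comm]
  fin_cases a
  · have hle : P.real (W ⁻¹' {1} ∩ X ⁻¹' A) ≤ (1 - η) * P.real (X ⁻¹' A) := by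
      rw [← heq, ← hc]
      exact setIntegral_mono_ae integrable_condExp.integrableOn
        (integrable_const _) (h.overlap.mono fun ω hω => hω.2.le)
    have hcompl : W ⁻¹' {0} ∩ X ⁻¹' A = X ⁻¹' A \ W ⁻¹' {1} := by
      ext ω
      simp only [Set.mem_inter_iff, Set.mem_preimage, Set.mem_singleton_iff, Set.mem_sdiff]
      constructor
      · rintro ⟨h0, h1⟩; exact ⟨h1, by rw [h0]; decide⟩
      · rintro ⟨h0, h1⟩; exact ⟨by omega, h0⟩
    have hsum := measureReal_inter_add_sdiff (μ := P) (s := X ⁻¹' A) hW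
    rw [Set.inter_comm] at hsum
    change _ ≤ P.real (W ⁻¹' {0} ∩ X ⁻¹' A)
    rw [hcompl]
    linarith
  · change _ ≤ P.real (W ⁻¹' {1} ∩ X ⁻¹' A)
    rw [← heq, ← hc]
    exact setIntegral_mono_ae (integrable_const _) integrable_condExp.integrableOn
      (h.overlap.mono fun ω hω => hω.1.le)

theorem overlap_le_treatment (h : MatchingAssumptions 𝒳 η g f P W X Y) (a : Fin 2) :
    η ≤ P.real (W ⁻¹' {a}) := by
  simpa using h.overlap_le a MeasurableSet.univ

/-- The Lebesgue density of the sub-probability `P(W = a, X ∈ ·)`. -/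
noncomputable def _root_.subgroupDensity (𝒳 : Set (EuclideanSpace ℝ (Fin d)))
    (f : Fin 2 → EuclideanSpace ℝ (Fin d) → ℝ) (P : Measure Ω) (W : Ω → Fin 2) (a : Fin 2) :
    EuclideanSpace ℝ (Fin d) → ℝ :=
  𝒳.indicator fun x => P.real (W ⁻¹' {a}) * f a x

theorem lintegral_subgroupDensity (h : MatchingAssumptions 𝒳 η g f P W X Y) (a : Fin 2)
    {A : Set (EuclideanSpace ℝ (Fin d))} (hA : MeasurableSet A) :
    ∫⁻ x in A, ENNReal.ofReal (subgroupDensity 𝒳 f P W a x) = P (W ⁻¹' {a} ∩ X ⁻¹' A) := by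
  have hX : MeasurableSet 𝒳 := h.compact_support.measurableSet
  rw [← h.measure_preimage_inter_support, h.measure_treatment_inter a (hA.inter hX)]
  have : (fun x => ENNReal.ofReal (subgroupDensity 𝒳 f P W a x)) =
      𝒳.indicator fun x => P (W ⁻¹' {a}) * ENNReal.ofReal (f a x) := by
    ext x
    by_cases hx : x ∈ 𝒳
    · simp [subgroupDensity, hx, ENNReal.ofReal_mul, measureReal_nonneg]
    · simp [subgroupDensity, hx]
  rw [this, setLIntegral_indicator hX, lintegral_const_mul' _ _ (measure_ne_top _ _),
    Set.inter_comm]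

theorem map_eq_designLaw (h : MatchingAssumptions 𝒳 η g f P W X Y) :
    P.map (fun ω => (W ω, X ω)) = designLaw (subgroupDensity 𝒳 f P W) := by
  have hWX : Measurable fun ω => (W ω, X ω) :=
    h.measurable_treatment.prodMk h.measurable_covariate
  ext S hS
  have hS' : ∀ a : Fin 2, MeasurableSet ((fun x => (a, x)) ⁻¹' S) := fun a =>
    measurable_prodMk_left hS
  rw [designLaw, Measure.finsetSum_apply, Measure.map_apply hWX hS]
  have : ∀ a : Fin 2, Measure.map (fun x => (a, x)) (volume.withDensity fun x =>
      ENNReal.ofReal (subgroupDensity 𝒳 f P W a x)) S =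
      P (W ⁻¹' {a} ∩ X ⁻¹' ((fun x => (a, x)) ⁻¹' S)) := fun a => by
    rw [Measure.map_apply measurable_prodMk_left hS, withDensity_apply _ (hS' a),
      h.lintegral_subgroupDensity a (hS' a)]
  simp only [this, Fin.sum_univ_two]
  rw [← measure_inter_add_sdiff ((fun ω => (W ω, X ω)) ⁻¹' S) (h.measurableSet_treatment 0)]
  congr 2
  · ext ω
    simp only [Set.mem_inter_iff, Set.mem_preimage, Set.mem_singleton_iff]
    constructor
    · rintro ⟨h0, h1⟩; exact ⟨h1, h1 ▸ h0⟩
    · rintro ⟨h0, h1⟩; exact ⟨h0.symm ▸ h1, h0⟩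
  · ext ω
    simp only [Set.mem_inter_iff, Set.mem_preimage, Set.mem_singleton_iff, Set.mem_sdiff]
    constructor
    · rintro ⟨h0, h1⟩
      have h1 : W ω = 1 := by omega
      exact ⟨h1, h1 ▸ h0⟩
    · rintro ⟨h0, h1⟩; exact ⟨h0.symm ▸ h1, by rw [h0]; decide⟩

/-- P(W = a, X ∈ A) is at least η times P(X ∈ A), and P(W = a) ≤ 1. The inequality obtained mentions
only `f` and 𝒳, so a constant found for one law serves every law satisfying the assumptions. -/
theorem exists_volume_le_lintegral (h : MatchingAssumptions 𝒳 η g f P W X Y) :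
    ∃ lo : ℝ, 0 < lo ∧ ∀ a A, MeasurableSet A →
      ENNReal.ofReal lo * volume (A ∩ 𝒳) ≤ ∫⁻ x in A ∩ 𝒳, ENNReal.ofReal (f a x) := by
  obtain ⟨lo, hlo, hA⟩ := h.exists_volume_le
  have hX : MeasurableSet 𝒳 := h.compact_support.measurableSet
  refine ⟨η * lo, mul_pos h.overlap_pos hlo, fun a A hAm => ?_⟩
  calc ENNReal.ofReal (η * lo) * volume (A ∩ 𝒳)
      = ENNReal.ofReal η * (ENNReal.ofReal lo * volume (A ∩ 𝒳 ∩ 𝒳)) := by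
        rw [ENNReal.ofReal_mul h.overlap_pos.le, mul_assoc, Set.inter_assoc, Set.inter_self]
    _ ≤ ENNReal.ofReal η * P (X ⁻¹' (A ∩ 𝒳)) := by gcongr; exact hA _ (hAm.inter hX)
    _ = ENNReal.ofReal (η * P.real (X ⁻¹' (A ∩ 𝒳))) := by
        rw [ENNReal.ofReal_mul h.overlap_pos.le, ofReal_measureReal]
    _ ≤ ENNReal.ofReal (P.real (W ⁻¹' {a} ∩ X ⁻¹' (A ∩ 𝒳))) :=
        ENNReal.ofReal_le_ofReal (h.overlap_le a (hAm.inter hX))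
    _ = P (W ⁻¹' {a}) * ∫⁻ x in A ∩ 𝒳, ENNReal.ofReal (f a x) := by
        rw [ofReal_measureReal, h.measure_treatment_inter a (hAm.inter hX)]
    _ ≤ 1 * ∫⁻ x in A ∩ 𝒳, ENNReal.ofReal (f a x) := by gcongr; exact prob_le_one
    _ = _ := one_mul _

theorem volume_support_pos (h : MatchingAssumptions 𝒳 η g f P W X Y) : 0 < volume 𝒳 := by
  obtain ⟨p, hp, -⟩ := h.density_bounds
  refine pos_iff_ne_zero.2 fun h0 => ?_
  have h1 : P.map X 𝒳 = 0 := by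
    rw [hp.2.2]; exact withDensity_absolutelyContinuous _ _ h0
  rw [Measure.map_apply h.measurable_covariate h.compact_support.measurableSet] at h1
  have h2 : P (X ⁻¹' 𝒳) = 1 := (mem_ae_iff_prob_eq_one
    (h.measurable_covariate h.compact_support.measurableSet)).1 h.ae_mem_support
  rw [h1] at h2
  exact zero_ne_one h2

theorem diam_pos (hd : 1 ≤ d) (h : MatchingAssumptions 𝒳 η g f P W X Y) :
    0 < Metric.diam 𝒳 := by
  have : Nonempty (Fin d) := ⟨⟨0, hd⟩⟩
  refine Metric.diam_pos ?_ h.compact_support.isBounded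
  by_contra hs
  exact h.volume_support_pos.ne' ((Set.not_nontrivial_iff.1 hs).measure_zero _)

end MatchingAssumptions

end Model

/-! ### Constants independent of the law, and the reduction to a regular design -/

section Reduction

variable {d : ℕ} {𝒳 : Set (EuclideanSpace ℝ (Fin d))} {η : ℝ}
  {g f : Fin 2 → EuclideanSpace ℝ (Fin d) → ℝ}

namespace MatchingAssumptions

theorem exists_regression_bound {Ω : Type*} [MeasurableSpace Ω] {P : Measure Ω} {W : Ω → Fin 2}
    {X : Ω → EuclideanSpace ℝ (Fin d)} {Y : Fin 2 → Ω → ℝ}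
    (h : MatchingAssumptions 𝒳 η g f P W X Y) (a : Fin 2) :
    ContinuousOn (g a) 𝒳 ∧ ∃ B : ℝ, 0 < B ∧ (∀ x ∈ 𝒳, |g a x| ≤ B) ∧
      (∀ x ∈ 𝒳, ∀ y ∈ 𝒳, |g a x - g a y| ≤ B * dist x y) ∧
      ∀ x ∈ 𝒳, ∃ L : EuclideanSpace ℝ (Fin d) →L[ℝ] ℝ, ‖L‖ ≤ B ∧
        ∀ y ∈ 𝒳, |g a y - g a x - L (y - x)| ≤ B * dist x y ^ 2 := by
  obtain ⟨U, G, hU, hUc, hXU, hG, hgG⟩ := h.regression_smooth a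
  obtain ⟨B, hB, h1, h2, h3, h4⟩ := exists_taylor_bound h.compact_support hU hUc hXU hG
  refine ⟨(hG.continuousOn.mono hXU).congr hgG, B, hB, fun x hx => hgG hx ▸ h1 x hx,
    fun x hx y hy => ?_, fun x hx => ⟨fderiv ℝ G x, h2 x hx, fun y hy => ?_⟩⟩
  · rw [hgG hx, hgG hy]; exact h3 x hx y hy
  · rw [hgG hx, hgG hy]; exact h4 x hx y hy

theorem exists_density_bound {Ω : Type*} [MeasurableSpace Ω] {P : Measure Ω} {W : Ω → Fin 2}
    {X : Ω → EuclideanSpace ℝ (Fin d)} {Y : Fin 2 → Ω → ℝ}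
    (h : MatchingAssumptions 𝒳 η g f P W X Y) (a : Fin 2) :
    ∃ B : ℝ, 0 < B ∧ (∀ x ∈ 𝒳, f a x ≤ B) ∧
      ∀ x ∈ 𝒳, ∀ y ∈ 𝒳, |f a x - f a y| ≤ B * dist x y := by
  obtain ⟨K, hK⟩ := h.group_density_lipschitz a
  obtain ⟨B, hB⟩ := h.compact_support.exists_bound_of_continuousOn hK.continuousOn
  refine ⟨1 + |B| + K, by positivity, fun x hx => ?_, fun x hx y hy => ?_⟩
  · have := (le_abs_self _).trans (hB x hx)
    linarith [le_abs_self B, K.coe_nonneg]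
  · rw [← Real.dist_eq]
    refine (hK.dist_le_mul x hx y hy).trans (mul_le_mul_of_nonneg_right ?_ dist_nonneg)
    linarith [abs_nonneg B]

/-- Spheres are null sets, so closed balls may be replaced by open ones; the volume of the unit ball
is absorbed into the constant. -/
theorem exists_volume_ball_le (hd : 1 ≤ d) {Ω : Type*} [MeasurableSpace Ω] {P : Measure Ω}
    {W : Ω → Fin 2} {X : Ω → EuclideanSpace ℝ (Fin d)} {Y : Fin 2 → Ω → ℝ}
    (h : MatchingAssumptions 𝒳 η g f P W X Y) :
    ∃ c : ℝ, 0 < c ∧ ∀ x ∈ 𝒳, ∀ r : ℝ, 0 ≤ r → r ≤ Metric.diam 𝒳 →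
      ENNReal.ofReal (c * r ^ d) ≤ volume (Metric.ball x r ∩ 𝒳) := by
  have : Nonempty (Fin d) := ⟨⟨0, hd⟩⟩
  obtain ⟨c, hc, hb⟩ := h.ball_volume
  set v := volume (Metric.ball (0 : EuclideanSpace ℝ (Fin d)) 1)
  have hv0 : v ≠ 0 := (Metric.measure_ball_pos volume _ one_pos).ne'
  have hvt : v ≠ ⊤ := measure_ball_lt_top.ne
  refine ⟨c * v.toReal, mul_pos hc (ENNReal.toReal_pos hv0 hvt), fun x hx r hr hrD => ?_⟩
  calc ENNReal.ofReal (c * v.toReal * r ^ d)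
      = ENNReal.ofReal c * volume (Metric.closedBall x r) := by
        rw [Measure.addHaar_closedBall volume x hr, finrank_euclideanSpace_fin, mul_assoc,
          ENNReal.ofReal_mul hc.le, ENNReal.ofReal_mul ENNReal.toReal_nonneg,
          ENNReal.ofReal_toReal hvt, mul_comm v]
    _ ≤ volume (Metric.closedBall x r ∩ 𝒳) := hb x hx r hr hrD
    _ ≤ volume (Metric.ball x r ∩ 𝒳 ∪ Metric.sphere x r) := by
        refine measure_mono fun y hy => ?_
        rw [← Metric.ball_union_sphere] at hy
        rcases hy.1 with h1 | h1
        · exact Or.inl ⟨h1, hy.2⟩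
        · exact Or.inr h1
    _ ≤ volume (Metric.ball x r ∩ 𝒳) + volume (Metric.sphere x r) := measure_union_le _ _
    _ = volume (Metric.ball x r ∩ 𝒳) := by rw [Measure.addHaar_sphere, add_zero]

theorem lintegral_boundary_le (hd : 1 ≤ d) {Ω : Type*} [MeasurableSpace Ω] {P : Measure Ω}
    [IsProbabilityMeasure P] {W : Ω → Fin 2} {X : Ω → EuclideanSpace ℝ (Fin d)}
    {Y : Fin 2 → Ω → ℝ} (h : MatchingAssumptions 𝒳 η g f P W X Y) {M : ℝ}
    (hM : ∀ L : ℝ, 0 < L → ∀ w, L ^ (1 / (d : ℝ)) *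
      ∫ x in 𝒳, Real.exp (-L * Metric.infDist x 𝒳ᶜ ^ d) * f w x ≤ M)
    (a : Fin 2) {ε : ℝ} (hε : 0 < ε) :
    ∫⁻ x, ENNReal.ofReal (subgroupDensity 𝒳 f P W a x) *
      ENNReal.ofReal (Real.exp (-((Metric.infDist x 𝒳ᶜ / ε) ^ d))) ≤ ENNReal.ofReal (M * ε) := by
  have hX : MeasurableSet 𝒳 := h.compact_support.measurableSet
  obtain ⟨B, hB, hfB, -⟩ := h.exists_density_bound a
  have hf0 := (h.group_density a).2.1
  have hfm := (h.group_density a).1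
  set F : EuclideanSpace ℝ (Fin d) → ℝ :=
    fun x => Real.exp (-((Metric.infDist x 𝒳ᶜ / ε) ^ d)) * f a x with hF
  have hFm : Measurable F := by
    refine Measurable.mul ?_ hfm
    exact Continuous.measurable (by have := Metric.continuous_infDist_pt (𝒳ᶜ); fun_prop)
  have hF0 : ∀ x, 0 ≤ F x := fun x => mul_nonneg (Real.exp_nonneg _) (hf0 x)
  have hexp : ∀ x : EuclideanSpace ℝ (Fin d),
      Real.exp (-((Metric.infDist x 𝒳ᶜ / ε) ^ d)) ≤ 1 := fun x =>
    Real.exp_le_one_iff.2 (neg_nonpos.2 (pow_nonneg (div_nonneg Metric.infDist_nonneg hε.le) _))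
  have hFint : IntegrableOn F 𝒳 := by
    refine Measure.integrableOn_of_bounded (M := B) h.compact_support.measure_lt_top.ne
      hFm.aestronglyMeasurable ((ae_restrict_iff' hX).2 (Filter.Eventually.of_forall ?_))
    intro x hx
    rw [Real.norm_of_nonneg (hF0 x)]
    exact (mul_le_of_le_one_left (hf0 x) (hexp x)).trans (hfB x hx)
  have hMε : ∫ x in 𝒳, F x ≤ M * ε := by
    -- The choice L = ε^(−d) makes L^(1/d) = 1/ε.
    have h1 := hM ((1 / ε) ^ d) (by positivity) a
    rw [one_div (d : ℝ), Real.pow_rpow_inv_natCast (by positivity) (by omega)] at h1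
    have h2 : (∫ x in 𝒳, Real.exp (-(1 / ε) ^ d * Metric.infDist x 𝒳ᶜ ^ d) * f a x) =
        ∫ x in 𝒳, F x := by
      refine integral_congr_ae (Filter.Eventually.of_forall fun x => ?_)
      simp only [hF, neg_mul, ← mul_pow, div_eq_inv_mul, mul_one]
    rw [h2, one_div, inv_mul_le_iff₀ hε, mul_comm ε] at h1
    exact h1
  calc ∫⁻ x, ENNReal.ofReal (subgroupDensity 𝒳 f P W a x) *
        ENNReal.ofReal (Real.exp (-((Metric.infDist x 𝒳ᶜ / ε) ^ d)))
      ≤ ∫⁻ x, 𝒳.indicator (fun x => ENNReal.ofReal (F x)) x := by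
        refine lintegral_mono fun x => ?_
        by_cases hx : x ∈ 𝒳
        · simp only [subgroupDensity, Set.indicator_of_mem hx]
          rw [← ENNReal.ofReal_mul (mul_nonneg measureReal_nonneg (hf0 x)), mul_comm]
          refine ENNReal.ofReal_le_ofReal (mul_le_mul_of_nonneg_left ?_ (Real.exp_nonneg _))
          exact mul_le_of_le_one_left (hf0 x) measureReal_le_one
        · simp [subgroupDensity, Set.indicator_of_notMem hx]
    _ = ENNReal.ofReal (∫ x in 𝒳, F x) := by
        rw [lintegral_indicator hX, ofReal_integral_eq_lintegral_ofReal hFint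
          (Filter.Eventually.of_forall hF0)]
    _ ≤ _ := ENNReal.ofReal_le_ofReal hMε

/-- The constants are read off from a reference law, but only through statements about 𝒳, η, `g` and
`f`. Of another law only P(W = a) enters, and it always lies between η and 1. -/
theorem exists_regularDesign (hd : 1 ≤ d) {Ω₀ : Type*} [MeasurableSpace Ω₀] {P₀ : Measure Ω₀}
    [IsProbabilityMeasure P₀] {W₀ : Ω₀ → Fin 2} {X₀ : Ω₀ → EuclideanSpace ℝ (Fin d)}
    {Y₀ : Fin 2 → Ω₀ → ℝ} (h₀ : MatchingAssumptions 𝒳 η g f P₀ W₀ X₀ Y₀) :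
    ∃ A c : ℝ, 0 < A ∧ 0 < c ∧ ∀ (Ω : Type*) [MeasurableSpace Ω] (P : Measure Ω)
      [IsProbabilityMeasure P] (W : Ω → Fin 2) (X : Ω → EuclideanSpace ℝ (Fin d))
      (Y : Fin 2 → Ω → ℝ), MatchingAssumptions 𝒳 η g f P W X Y →
      RegularDesign 𝒳 (Metric.diam 𝒳) A c (fun a => 𝒳.indicator (g a))
        (subgroupDensity 𝒳 f P W) := by
  have hX : MeasurableSet 𝒳 := h₀.compact_support.measurableSet
  have hD := h₀.diam_pos hd
  choose hgc B hB hB₁ hB₂ hB₃ using h₀.exists_regression_bound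
  choose K hK hK₁ hK₂ using h₀.exists_density_bound
  obtain ⟨M, hM⟩ := h₀.boundary
  obtain ⟨lo, hlo, hloA⟩ := h₀.exists_volume_le_lintegral
  obtain ⟨c, hc, hcb⟩ := h₀.exists_volume_ball_le hd
  have hη := h₀.overlap_pos
  set A : ℝ := |M| + ∑ a, (B a + K a) with hA
  have hBA : ∀ a, B a ≤ A := fun a => by
    have : B a + K a ≤ ∑ a, (B a + K a) :=
      Finset.single_le_sum (f := fun a => B a + K a)
        (fun a _ => (add_pos (hB a) (hK a)).le) (Finset.mem_univ a)
    linarith [hK a, abs_nonneg M]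
  have hKA : ∀ a, K a ≤ A := fun a => by
    have : B a + K a ≤ ∑ a, (B a + K a) :=
      Finset.single_le_sum (f := fun a => B a + K a)
        (fun a _ => (add_pos (hB a) (hK a)).le) (Finset.mem_univ a)
    linarith [hB a, abs_nonneg M]
  have hMA : M ≤ A := by
    have : 0 ≤ ∑ a, (B a + K a) := Finset.sum_nonneg fun a _ => (add_pos (hB a) (hK a)).le
    linarith [le_abs_self M]
  have hApos : 0 < A := (hB 0).trans_le (hBA 0)
  obtain ⟨x₀, hx₀⟩ : 𝒳.Nonempty := by
    rw [Set.nonempty_iff_ne_empty]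
    rintro he
    rw [he, Metric.diam_empty] at hD
    exact lt_irrefl _ hD
  -- The factors bound below the probability of the treatment, the density `f a` in integrated form,
  -- and the volume of a ball within 𝒳.
  refine ⟨A, η * lo * c, hApos, by positivity, fun Ω _ P _ W X Y h => ?_⟩
  have hf0 : ∀ a x, 0 ≤ f a x := fun a => (h.group_density a).2.1
  have hp1 : ∀ a, P.real (W ⁻¹' {a}) ≤ 1 := fun a => measureReal_le_one
  have hball : ∀ a, ∀ x ∈ 𝒳, ∀ r, 0 ≤ r → r ≤ Metric.diam 𝒳 →
      ENNReal.ofReal (η * lo * c * r ^ d) ≤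
        ∫⁻ y in Metric.ball x r, ENNReal.ofReal (subgroupDensity 𝒳 f P W a y) := by
    intro a x hx r hr hrD
    rw [h.lintegral_subgroupDensity a measurableSet_ball,
      h.measure_treatment_inter a measurableSet_ball, mul_assoc, mul_assoc,
      ENNReal.ofReal_mul hη.le, ENNReal.ofReal_mul hlo.le]
    refine mul_le_mul' ?_ ?_
    · rw [← ofReal_measureReal]
      exact ENNReal.ofReal_le_ofReal (h.overlap_le_treatment a)
    · calc _ ≤ ENNReal.ofReal lo * volume (Metric.ball x r ∩ 𝒳) := by
            gcongr; exact hcb x hx r hr hrD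
        _ ≤ _ := (hloA a _ measurableSet_ball).trans
          (lintegral_mono_set Set.inter_subset_left)
  exact
  { D_pos := hD
    A_pos := hApos
    c_pos := by positivity
    measurableSet := hX
    dist_le := fun x hx y hy => Metric.dist_le_diam_of_mem h₀.compact_support.isBounded hx hy
    measurable_g := fun a => by
      classical
      have : 𝒳.indicator (g a) = 𝒳.piecewise (g a) 0 := (Set.piecewise_eq_indicator).symm
      rw [this]
      exact (hgc a).measurable_piecewise continuousOn_const hX
    abs_g_le := fun a x => by
      by_cases hx : x ∈ 𝒳
      · rw [Set.indicator_of_mem hx]; exact (hB₁ a x hx).trans (hBA a)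
      · rw [Set.indicator_of_notMem hx, abs_zero]; exact hApos.le
    g_lipschitz := fun a x hx y hy => by
      rw [Set.indicator_of_mem hx, Set.indicator_of_mem hy]
      exact (hB₂ a x hx y hy).trans (mul_le_mul_of_nonneg_right (hBA a) dist_nonneg)
    g_taylor := fun a x hx => by
      obtain ⟨L, hL, hLy⟩ := hB₃ a x hx
      refine ⟨L, hL.trans (hBA a), fun y hy => ?_⟩
      rw [Set.indicator_of_mem hx, Set.indicator_of_mem hy]
      exact (hLy y hy).trans (mul_le_mul_of_nonneg_right (hBA a) (sq_nonneg _))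
    measurable_m := fun a => ((h.group_density a).1.const_mul _).indicator hX
    m_nonneg := fun a x => Set.indicator_nonneg
      (fun x _ => mul_nonneg measureReal_nonneg (hf0 a x)) x
    m_le := fun a x => Set.indicator_le' (fun x hx =>
      (mul_le_of_le_one_left (hf0 a x) (hp1 a)).trans ((hK₁ a x hx).trans (hKA a)))
      (fun _ _ => hApos.le) x
    m_eq_zero := fun a x hx => Set.indicator_of_notMem hx _
    m_lipschitz := fun a x hx y hy => by
      simp only [subgroupDensity, Set.indicator_of_mem hx, Set.indicator_of_mem hy]
      rw [← mul_sub, abs_mul, abs_of_nonneg measureReal_nonneg]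
      exact (mul_le_of_le_one_left (abs_nonneg _) (hp1 a)).trans ((hK₂ a x hx y hy).trans
        (mul_le_mul_of_nonneg_right (hKA a) dist_nonneg))
    ball_mass := hball
    total_mass := fun a => (hball a x₀ hx₀ _ hD.le le_rfl).trans (setLIntegral_le_lintegral _ _)
    boundary := fun a ε hε => (h.lintegral_boundary_le hd hM a hε).trans
      (ENNReal.ofReal_le_ofReal (mul_le_mul_of_nonneg_right hMA hε.le)) }

end MatchingAssumptions

/-- The assumptions control `g` only on 𝒳. Setting it to zero elsewhere makes it bounded and
measurable everywhere and does not affect the bias when all covariates lie in 𝒳. -/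
theorem conditionalBias_indicator_eq {N : ℕ} (k : ℕ) {w : Fin N → Fin 2}
    {x : Fin N → EuclideanSpace ℝ (Fin d)} (hx : ∀ i, x i ∈ 𝒳) :
    conditionalBias (fun a => 𝒳.indicator (g a)) k w x = conditionalBias g k w x := by
  simp only [conditionalBias, neighbourValue, Set.indicator_of_mem (hx _)]

end Reduction

theorem mainTheorem3 (d : ℕ) (hd : 1 ≤ d) (𝒳 : Set (EuclideanSpace ℝ (Fin d))) (η : ℝ)
    (g f : Fin 2 → EuclideanSpace ℝ (Fin d) → ℝ) :
    ∃ C : ℝ, 0 < C ∧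
      ∀ (Ω : Type*) [MeasurableSpace Ω] (P : Measure Ω) [IsProbabilityMeasure P]
        (W : Ω → Fin 2) (X : Ω → EuclideanSpace ℝ (Fin d)) (Y : Fin 2 → Ω → ℝ),
        MatchingAssumptions 𝒳 η g f P W X Y →
        ∀ (N k : ℕ), 1 ≤ k → k ≤ N →
        ∀ (Ws : Fin N → Ω → Fin 2) (Xs : Fin N → Ω → EuclideanSpace ℝ (Fin d))
          (Ys : Fin N → Fin 2 → Ω → ℝ),
          (∀ i, Measurable (Ws i)) → (∀ i, Measurable (Xs i)) →
          (∀ i w, Measurable (Ys i w)) →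
          iIndepFun (fun (i : Fin N) (ω : Ω) => (Ws i ω, Xs i ω, fun w => Ys i w ω)) P →
          (∀ i, IdentDistrib (fun ω => (Ws i ω, Xs i ω, fun w => Ys i w ω))
            (fun ω => (W ω, X ω, fun w => Y w ω)) P P) →
          Integrable (fun ω =>
            conditionalBias g k (fun i => Ws i ω) (fun i => Xs i ω) ^ 2) P ∧
          ∫ ω, conditionalBias g k (fun i => Ws i ω) (fun i => Xs i ω) ^ 2 ∂P ≤
            C * ((k : ℝ) / (N : ℝ)) ^ (min (3 : ℝ) (4 / (d : ℝ))) := by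
  -- The constant has to be chosen before the law. If some law satisfies the assumptions, it serves
  -- as the reference law; otherwise any constant works.
  by_cases hex : ∃ (Ω : Type _) (_ : MeasurableSpace Ω) (P : Measure Ω)
    (_ : IsProbabilityMeasure P) (W : Ω → Fin 2) (X : Ω → EuclideanSpace ℝ (Fin d))
    (Y : Fin 2 → Ω → ℝ), MatchingAssumptions 𝒳 η g f P W X Y
  swap
  · exact ⟨1, one_pos, fun Ω _ P _ W X Y h => (hex ⟨Ω, _, P, ‹_›, W, X, Y, h⟩).elim⟩
  obtain ⟨Ω₀, _, P₀, _, W₀, X₀, Y₀, h₀⟩ := hex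
  obtain ⟨A, c, hA, hc, hreg⟩ := h₀.exists_regularDesign hd
  obtain ⟨C, hC, hbound⟩ := exists_integral_pairBias_sq_le hd (h₀.diam_pos hd) hA hc
  refine ⟨C, hC, fun Ω _ P _ W X Y h N k hk hkN Ws Xs Ys hWs hXs hYs hind hid => ?_⟩
  have hR := hreg Ω P W X Y h
  set g' : Fin 2 → EuclideanSpace ℝ (Fin d) → ℝ := fun a => 𝒳.indicator (g a)
  set m := subgroupDensity 𝒳 f P W
  have hmap := h.map_eq_designLaw
  have hWX : Measurable fun ω => (W ω, X ω) :=
    h.measurable_treatment.prodMk h.measurable_covariate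
  have : IsProbabilityMeasure (designLaw m) := hmap ▸ Measure.isProbabilityMeasure_map
    hWX.aemeasurable
  have hproj : Measurable fun t : Fin 2 × EuclideanSpace ℝ (Fin d) × (Fin 2 → ℝ) =>
      (t.1, t.2.1) := by fun_prop
  have hWXs : ∀ i, Measurable fun ω => (Ws i ω, Xs i ω) := fun i => (hWs i).prodMk (hXs i)
  have hlaw : ∀ i, P.map (fun ω => (Ws i ω, Xs i ω)) = designLaw m := fun i => by
    rw [← hmap]; exact ((hid i).comp hproj).map_eq
  have hZ : Measurable fun ω (i : Fin N) => (Ws i ω, Xs i ω) := measurable_pi_lambda _ hWXs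
  -- The bias depends only on treatments and covariates, so the i.i.d. vectors are projected to
  -- these and the sample follows a product of design laws.
  have hjoint : P.map (fun ω (i : Fin N) => (Ws i ω, Xs i ω)) =
      Measure.pi fun _ : Fin N => designLaw m := by
    have := (iIndepFun_iff_map_fun_eq_pi_map fun i => (hWXs i).aemeasurable).1
      (hind.comp (fun _ t => (t.1, t.2.1)) fun _ => hproj)
    simpa only [hlaw] using this
  have hmem : ∀ᵐ ω ∂P, ∀ i, Xs i ω ∈ 𝒳 := ae_all_iff.2 fun i => by
    have h1 : MeasurableSet (𝒳ᶜ) := hR.measurableSet.compl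
    have h2 : P.map (Xs i) = P.map X := ((hid i).comp
      (measurable_fst.comp measurable_snd)).map_eq
    have h3 : P (X ⁻¹' 𝒳ᶜ) = 0 := h.ae_mem_support
    rw [← Measure.map_apply h.measurable_covariate h1, ← h2, Measure.map_apply (hXs i) h1] at h3
    exact h3
  have hae : (fun ω => pairBias g' k (fun i => (Ws i ω, Xs i ω)) ^ 2) =ᵐ[P]
      fun ω => conditionalBias g k (fun i => Ws i ω) (fun i => Xs i ω) ^ 2 := by
    filter_upwards [hmem] with ω hω
    rw [pairBias, conditionalBias_indicator_eq k hω]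
  have hmeas : Measurable (pairBias g' k : (Fin N → _) → ℝ) :=
    measurable_pairBias hR.measurable_g k
  constructor
  · refine Integrable.congr ?_ hae
    refine Integrable.of_bound ((hmeas.comp hZ).pow_const 2).aestronglyMeasurable ((2 * A) ^ 2)
      (Filter.Eventually.of_forall fun ω => ?_)
    rw [Real.norm_of_nonneg (sq_nonneg _), ← sq_abs]
    exact pow_le_pow_left₀ (abs_nonneg _) (abs_pairBias_le g' hk hA.le hR.abs_g_le _) 2
  · rw [← integral_congr_ae hae]
    have := hbound 𝒳 g' m hR N k hk hkN
    rwa [← hjoint, integral_map hZ.aemeasurable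
      (hmeas.pow_const 2).aestronglyMeasurable] at this
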